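/- Let $G$ be a finite group, let $\mathbb K=\mathbb R$ or $\mathbb C$, let $k$ be a field with a homomorphism $k\to\mathbb K$, and let $\beta\in Z^3(G,k^*)$, i.e. $\beta(h,i,j)\,\beta(g,hi,j)\,\beta(g,h,i)=\beta(gh,i,j)\,\beta(g,h,ij)$. Let $X$ be a smooth manifold on which $G$ acts trivially and let $A=C^\infty(X)$ be the algebra of smooth $\mathbb K$-valued functions on $X$. Put $$\theta_g(x,y)=\frac{\beta(g,x,y)\,\beta(x,y,(xy)^{-1}gxy)}{\beta(x,x^{-1}gx,y)},\qquad \gamma_x(g,h)=\frac{\beta(g,h,x)\,\beta(x,x^{-1}gx,x^{-1}hx)}{\beta(g,x,x^{-1}hx)} .$$ The twisted Drinfel'd double $D^\beta(k[G])$ is the $k$-algebra with basis $\lfloor g|x\rfloor$ ($g,x\in G$), product $\lfloor g|x\rfloor\lfloor h|y\rfloor=\delta_{g,xhx^{-1}}\,\theta_g(x,y)\,\lfloor g|xy\rfloor$ and comultiplication $\Delta\lfloor g|x\rfloor=\sum_{g_1g_2=g}\gamma_x(g_1,g_2)\lfloor g_1|x\rfloor\otimes\lfloor g_2|x\rfloor$.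 Fix representatives $r$ of the conjugacy classes $[r]$ of $G$, write $Z(\cdot)$ for centralizers, and let $$B^\beta=\bigoplus_{[r]}A\rtimes^{\theta_r}Z(r),\qquad (a\,1_x)(b\,1_y)=\theta_r(x,y)\,ab\,1_{xy}.$$ For a $B^\beta$-module $M$ and $m=xrx^{-1}\in G$ let $M_m$ be the $A\rtimes^{\theta_m}Z(m)$-module obtained from the component of $M$ at $[r]$ by transport along the isomorphism $A\rtimes^{\theta_r}Z(r)\to A\rtimes^{\theta_m}Z(m)$, $1_w\mapsto\frac{\theta_m(x,w)}{\theta_m(xwx^{-1},x)}1_{xwx^{-1}}$; up to isomorphism it does not depend on $x$. For $B^\beta$-modules $M,N$ let $M*N$ be the $B^\beta$-module with component at $[r]$ $$(M*N)_r=\bigoplus_{(g,h)}\mathrm{Ind}_{Z(g,h)}^{Z(r)}\bigl(M_g\otimes_A^{\gamma}N_h\bigr),$$ where $(g,h)$ runs over representatives of the pairs with $gh=r$ modulo simultaneous conjugation by $Z(r)$, $Z(g,h)=Z(g)\cap Z(h)$, where $M_g\otimes^\gamma_AN_h$ is $M_g\otimes_AN_h$ with $1_x$ ($x\in Z(g,h)$)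 acting as $\gamma_x(g,h)\,1_x\otimes 1_x$ (a module over $A\rtimes^{\theta_r}Z(g,h)$), and where $\mathrm{Ind}$ is extension of scalars to $A\rtimes^{\theta_r}Z(r)$. For modules $P,Q$ over $A\otimes_k D^\beta(k[G])$ let $P\otimes_AQ$ carry the action of $A\otimes_k D^\beta(k[G])$ through $\Delta$. $K_0(R)$ is the Grothendieck group of finitely generated projective $R$-modules. Then $B^\beta$ and $A\otimes_kD^\beta(k[G])$ are Morita equivalent as $k$-algebras, and the product on the $K$-theory of finitely generated projective $B^\beta$-modules is given by the comultiplication of $D^\beta(k[G])$. That is: $M*N$ is finitely generated projective if $M,N$ are, and $P\otimes_AQ$ is finitely generated projective if $P,Q$ are; $[M]\cdot[N]=[M*N]$ and $[P]\cdot[Q]=[P\otimes_AQ]$ define biadditive products on $K_0(B^\beta)$ and on $K_0(A\otimes_kD^\beta(k[G]))$; and there is a $k$-linear Morita equivalence $F$ from $B^\beta$-modules to $A\otimes_k D^\beta(k[G])$-modules which preserves finitely generated projective modules and induces a group isomorphism $K_0(B^\beta)\cong K_0(A\otimes_kD^\beta(k[G]))$, $[M]\mapsto[F(M)]$, that carries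 the first product to the second. -/

import Mathlib

open scoped TensorProduct ContDiff Manifold ModuleCat.Algebra

noncomputable section

namespace DrinfeldTwist

/-! ### Cocycles -/

/-- A `3`-cocycle `β ∈ Z³(G, kˣ)` (trivial `G`-action on `kˣ`, inhomogeneous cochains). -/
structure Cocycle3 (G : Type*) [Group G] (k : Type*) [Field k] where
  toFun : G → G → G → kˣ
  cocycle : ∀ g h i j, toFun h i j * toFun g (h * i) j * toFun g h i
    = toFun (g * h) i j * toFun g h (i * j)

/-- A `2`-cocycle `α ∈ Z²(H, kˣ)` (trivial `H`-action on `kˣ`). -/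
structure Cocycle2 (H : Type*) [Group H] (k : Type*) [Field k] where
  toFun : H → H → kˣ
  cocycle : ∀ x y z, toFun x y * toFun (x * y) z = toFun x (y * z) * toFun y z

namespace Cocycle2

variable {H K : Type*} [Group H] [Group K] {k : Type*} [Field k]

lemma one_left (α : Cocycle2 H k) (z : H) : α.toFun 1 z = α.toFun 1 1 := by
  have h := α.cocycle 1 1 z
  simp only [one_mul] at h
  exact (mul_right_cancel h).symm

lemma one_right (α : Cocycle2 H k) (x : H) : α.toFun x 1 = α.toFun 1 1 := by
  have h := α.cocycle x 1 1
  simp only [mul_one] at h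
  exact mul_left_cancel h

/-- Pull-back of a `2`-cocycle along a group homomorphism. -/
def comap (α : Cocycle2 H k) (f : K →* H) : Cocycle2 K k where
  toFun x y := α.toFun (f x) (f y)
  cocycle x y z := by simpa using α.cocycle (f x) (f y) (f z)

end Cocycle2

namespace Cocycle3

variable {G : Type*} [Group G] {k : Type*} [Field k] (β : Cocycle3 G k)

/-- `θ_g(x,y) = β(g,x,y) β(x,y,(xy)⁻¹g(xy)) / β(x,x⁻¹gx,y)`. -/
def theta (g x y : G) : kˣ :=
  β.toFun g x y * β.toFun x y ((x * y)⁻¹ * g * (x * y)) / β.toFun x (x⁻¹ * g * x) y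

/-- `γ_x(g,h) = β(g,h,x) β(x,x⁻¹gx,x⁻¹hx) / β(g,x,x⁻¹hx)`. -/
def gamma (x g h : G) : kˣ :=
  β.toFun g h x * β.toFun x (x⁻¹ * g * x) (x⁻¹ * h * x) / β.toFun g x (x⁻¹ * h * x)

lemma theta_aux {M : Type*} [AddCommGroup M] (b : G → G → G → M)
    (hb : ∀ g h i j, b h i j + b g (h * i) j + b g h i = b (g * h) i j + b g h (i * j))
    (g x y z : G) :
    (b g x y + b x y ((x * y)⁻¹ * g * (x * y)) - b x (x⁻¹ * g * x) y) +
      (b g (x * y) z + b (x * y) z ((x * y * z)⁻¹ * g * (x * y * z))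
        - b (x * y) ((x * y)⁻¹ * g * (x * y)) z) =
    (b g x (y * z) + b x (y * z) ((x * (y * z))⁻¹ * g * (x * (y * z)))
        - b x (x⁻¹ * g * x) (y * z)) +
      (b (x⁻¹ * g * x) y z + b y z ((y * z)⁻¹ * (x⁻¹ * g * x) * (y * z))
        - b y (y⁻¹ * (x⁻¹ * g * x) * y) z) := by
  obtain ⟨a, rfl⟩ : ∃ a, g = x * (y * (z * a * z⁻¹) * y⁻¹) * x⁻¹ :=
    ⟨z⁻¹ * (y⁻¹ * (x⁻¹ * g * x) * y) * z, by group⟩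
  have h1 := hb (x * (y * (z * a * z⁻¹) * y⁻¹) * x⁻¹) x y z
  have h2 := hb x (y * (z * a * z⁻¹) * y⁻¹) y z
  have h3 := hb x y (z * a * z⁻¹) z
  have h4 := hb x y z a
  simp only [mul_assoc, mul_inv_rev, inv_mul_cancel_left, inv_mul_cancel, mul_one] at *
  linear_combination (norm := module) (1 : ℤ) • h1 - (1 : ℤ) • h2 + (1 : ℤ) • h3 - (1 : ℤ) • h4

lemma gamma_aux {M : Type*} [AddCommGroup M] (b : G → G → G → M)
    (hb : ∀ g h i j, b h i j + b g (h * i) j + b g h i = b (g * h) i j + b g h (i * j))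
    (g h x y : G) :
    (b (g * h) x y + b x y ((x * y)⁻¹ * (g * h) * (x * y)) - b x (x⁻¹ * (g * h) * x) y) +
      (b g h (x * y) + b (x * y) ((x * y)⁻¹ * g * (x * y)) ((x * y)⁻¹ * h * (x * y))
        - b g (x * y) ((x * y)⁻¹ * h * (x * y))) =
    (b g x y + b x y ((x * y)⁻¹ * g * (x * y)) - b x (x⁻¹ * g * x) y) +
      (b h x y + b x y ((x * y)⁻¹ * h * (x * y)) - b x (x⁻¹ * h * x) y) +
      ((b g h x + b x (x⁻¹ * g * x) (x⁻¹ * h * x) - b g x (x⁻¹ * h * x)) +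
        (b (x⁻¹ * g * x) (x⁻¹ * h * x) y
          + b y (y⁻¹ * (x⁻¹ * g * x) * y) (y⁻¹ * (x⁻¹ * h * x) * y)
          - b (x⁻¹ * g * x) y (y⁻¹ * (x⁻¹ * h * x) * y))) := by
  obtain ⟨a, rfl⟩ : ∃ a, g = x * (y * a * y⁻¹) * x⁻¹ := ⟨y⁻¹ * (x⁻¹ * g * x) * y, by group⟩
  obtain ⟨c, rfl⟩ : ∃ c, h = x * (y * c * y⁻¹) * x⁻¹ := ⟨y⁻¹ * (x⁻¹ * h * x) * y, by group⟩
  have h1 := hb (x * (y * a * y⁻¹) * x⁻¹) (x * (y * c * y⁻¹) * x⁻¹) x y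
  have h2 := hb (x * (y * a * y⁻¹) * x⁻¹) x (y * c * y⁻¹) y
  have h3 := hb x (y * a * y⁻¹) (y * c * y⁻¹) y
  have h4 := hb (x * (y * a * y⁻¹) * x⁻¹) x y c
  have h5 := hb x (y * a * y⁻¹) y c
  have h6 := hb x y a c
  simp only [mul_assoc, mul_inv_rev, inv_mul_cancel_left, inv_mul_cancel, mul_one] at *
  linear_combination (norm := module) (-1 : ℤ) • h1 + (1 : ℤ) • h2 - (1 : ℤ) • h3
    - (1 : ℤ) • h4 + (1 : ℤ) • h5 - (1 : ℤ) • h6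

lemma theta_mul (g x y z : G) :
    β.theta g x y * β.theta g (x * y) z = β.theta g x (y * z) * β.theta (x⁻¹ * g * x) y z :=
  theta_aux (M := Additive kˣ) β.toFun β.cocycle g x y z

lemma gamma_mul (g h x y : G) :
    β.theta (g * h) x y * β.gamma (x * y) g h =
      β.theta g x y * β.theta h x y * (β.gamma x g h * β.gamma y (x⁻¹ * g * x) (x⁻¹ * h * x)) :=
  gamma_aux (M := Additive kˣ) β.toFun β.cocycle g h x y

lemma theta_one_left (g z : G) : β.theta g 1 z = β.theta g 1 1 := by
  have h := β.theta_mul g 1 1 z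
  simp only [one_mul, inv_one, mul_one] at h
  exact (mul_right_cancel h).symm

lemma theta_one_right (g x : G) : β.theta g x 1 = β.theta (x⁻¹ * g * x) 1 1 := by
  have h := β.theta_mul g x 1 1
  simp only [mul_one] at h
  exact mul_left_cancel h

lemma gamma_one (g h : G) :
    β.gamma 1 g h * β.theta g 1 1 * β.theta h 1 1 = β.theta (g * h) 1 1 := by
  have h := β.gamma_mul g h 1 1
  simp only [inv_one, one_mul, mul_one] at h
  rw [← mul_assoc] at h
  rw [mul_right_cancel h]
  ac_rfl

end Cocycle3

/-- The restriction of `θ_g` to the centralizer `Z(g)` is a `2`-cocycle. -/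
def Cocycle3.thetaZ {G : Type*} [Group G] {k : Type*} [Field k] (β : Cocycle3 G k) (g : G) :
    Cocycle2 (Subgroup.centralizer {g}) k where
  toFun x y := β.theta g x y
  cocycle x y z := by
    have h := β.theta_mul g x y z
    have hx : (x : G)⁻¹ * g * x = g := by
      rw [mul_assoc, ← Subgroup.mem_centralizer_singleton_iff.1 x.2, inv_mul_cancel_left]
    rw [hx] at h
    exact h

/-! ### Twisted crossed products `A ⋊^α H` for the trivial action of `H` on `A` -/

/-- The crossed product `A ⋊^α H` for the trivial action of `H` on `A`: the free `A`-module on `H`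
with `(a 1_x) (b 1_y) = a b α(x,y) 1_{xy}`. -/
def Crossed (A : Type*) [CommRing A] {H : Type*} [Group H] {k : Type*} [Field k]
    (_α : Cocycle2 H k) : Type _ := H →₀ A

namespace Crossed

section basic

variable {A : Type*} [CommRing A] {H : Type*} [Group H] {k : Type*} [Field k]
  {α : Cocycle2 H k}

instance : AddCommGroup (Crossed A α) := inferInstanceAs (AddCommGroup (H →₀ A))

instance {S : Type*} [CommSemiring S] [Algebra S A] : Module S (Crossed A α) :=
  inferInstanceAs (Module S (H →₀ A))

instance {S : Type*} [CommSemiring S] [Algebra S A] : IsScalarTower S A (Crossed A α) :=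
  inferInstanceAs (IsScalarTower S A (H →₀ A))

/-- The element `a 1_x`. -/
def of (x : H) (a : A) : Crossed A α := Finsupp.single x a

lemma of_add (x : H) (a b : A) : (of x (a + b) : Crossed A α) = of x a + of x b :=
  Finsupp.single_add x a b

lemma of_zero (x : H) : (of x 0 : Crossed A α) = 0 := Finsupp.single_zero x

lemma smul_of {S : Type*} [CommSemiring S] [Algebra S A] (s : S) (x : H) (a : A) :
    s • (of x a : Crossed A α) = of x (s • a) := Finsupp.smul_single s x a

lemma induction {p : Crossed A α → Prop} (f : Crossed A α) (h0 : p 0)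
    (hadd : ∀ f g, p f → p g → p (f + g)) (hof : ∀ x a, p (of x a)) : p f :=
  Finsupp.induction_linear f h0 hadd hof

/-- The `A`-linear map with `1_x ↦ ρ(x)`. -/
def linLift {E : Type*} [AddCommGroup E] [Module A E] (ρ : H → E) : Crossed A α →ₗ[A] E :=
  (Finsupp.lsum A fun x => LinearMap.toSpanSingleton A E (ρ x) : (H →₀ A) →ₗ[A] E)

lemma linLift_of {E : Type*} [AddCommGroup E] [Module A E] (ρ : H → E) (x : H) (a : A) :
    linLift (α := α) ρ (of x a) = a • ρ x := by
  change (Finsupp.lsum A fun x => LinearMap.toSpanSingleton A E (ρ x) : (H →₀ A) →ₗ[A] E)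
    (Finsupp.single x a) = _
  rw [Finsupp.lsum_single, LinearMap.toSpanSingleton_apply]

variable [Algebra k A]

/-- The `A`-bilinear multiplication with `1_x 1_y = α(x,y) 1_{xy}`. -/
def mulL : Crossed A α →ₗ[A] Crossed A α →ₗ[A] Crossed A α :=
  linLift fun x => linLift fun y => of (x * y) (algebraMap k A (α.toFun x y))

instance : Mul (Crossed A α) := ⟨fun f g => mulL f g⟩

lemma of_mul_of (x y : H) (a b : A) :
    (of x a * of y b : Crossed A α) = of (x * y) (a * b * algebraMap k A (α.toFun x y)) := by
  change mulL (of x a) (of y b) = _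
  rw [mulL, linLift_of, LinearMap.smul_apply, linLift_of, smul_of, smul_of, smul_eq_mul,
    smul_eq_mul, mul_assoc]

protected lemma mul_add' (f g h : Crossed A α) : f * (g + h) = f * g + f * h :=
  (mulL f).map_add g h

protected lemma add_mul' (f g h : Crossed A α) : (f + g) * h = f * h + g * h :=
  LinearMap.map_add₂ mulL f g h

protected lemma zero_mul' (f : Crossed A α) : 0 * f = 0 := LinearMap.map_zero₂ mulL f

protected lemma mul_zero' (f : Crossed A α) : f * 0 = 0 := (mulL f).map_zero

/-- The unit is `α(1,1)⁻¹ 1_e` (which is `1_e` for a normalized cocycle). -/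
instance : One (Crossed A α) := ⟨of 1 (algebraMap k A ↑(α.toFun 1 1)⁻¹)⟩

lemma one_def : (1 : Crossed A α) = of 1 (algebraMap k A ↑(α.toFun 1 1)⁻¹) := rfl

instance : Ring (Crossed A α) where
  __ : AddCommGroup (Crossed A α) := inferInstance
  left_distrib := Crossed.mul_add'
  right_distrib := Crossed.add_mul'
  zero_mul := Crossed.zero_mul'
  mul_zero := Crossed.mul_zero'
  mul_assoc f g h := by
    induction f using Crossed.induction with
    | h0 => simp only [Crossed.zero_mul']
    | hadd f₁ f₂ h₁ h₂ => simp only [Crossed.add_mul', h₁, h₂]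
    | hof x a =>
      induction g using Crossed.induction with
      | h0 => simp only [Crossed.zero_mul', Crossed.mul_zero']
      | hadd f₁ f₂ h₁ h₂ => simp only [Crossed.add_mul', Crossed.mul_add', h₁, h₂]
      | hof y b =>
        induction h using Crossed.induction with
        | h0 => simp only [Crossed.mul_zero']
        | hadd f₁ f₂ h₁ h₂ => simp only [Crossed.mul_add', h₁, h₂]
        | hof z c =>
          have h := congrArg (fun u : kˣ => algebraMap k A u) (α.cocycle x y z)
          simp only [Units.val_mul, map_mul] at h
          simp only [of_mul_of, mul_assoc x y z]
          congr 1
          linear_combination a * b * c * h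
  one_mul f := by
    induction f using Crossed.induction with
    | h0 => simp only [Crossed.mul_zero']
    | hadd f₁ f₂ h₁ h₂ => simp only [Crossed.mul_add', h₁, h₂]
    | hof x a =>
      rw [one_def, of_mul_of, α.one_left x, one_mul, mul_right_comm, ← map_mul, ← Units.val_mul,
        inv_mul_cancel, Units.val_one, map_one, one_mul]
  mul_one f := by
    induction f using Crossed.induction with
    | h0 => simp only [Crossed.zero_mul']
    | hadd f₁ f₂ h₁ h₂ => simp only [Crossed.add_mul', h₁, h₂]
    | hof x a =>
      rw [one_def, of_mul_of, α.one_right x, mul_one, mul_assoc, ← map_mul, ← Units.val_mul,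
        inv_mul_cancel, Units.val_one, map_one, mul_one]

instance {S : Type*} [CommSemiring S] [Algebra S A] : Algebra S (Crossed A α) :=
  Algebra.ofModule
    (fun s f g => by
      induction f using Crossed.induction with
      | h0 => simp only [smul_zero, zero_mul]
      | hadd f₁ f₂ h₁ h₂ => simp only [smul_add, add_mul, h₁, h₂]
      | hof x a =>
        induction g using Crossed.induction with
        | h0 => simp only [smul_zero, mul_zero]
        | hadd f₁ f₂ h₁ h₂ => simp only [smul_add, mul_add, h₁, h₂]
        | hof y b => simp only [of_mul_of, smul_of, smul_mul_assoc])
    (fun s f g => by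
      induction f using Crossed.induction with
      | h0 => simp only [smul_zero, zero_mul]
      | hadd f₁ f₂ h₁ h₂ => simp only [smul_add, add_mul, h₁, h₂]
      | hof x a =>
        induction g using Crossed.induction with
        | h0 => simp only [smul_zero, mul_zero]
        | hadd f₁ f₂ h₁ h₂ => simp only [smul_add, mul_add, h₁, h₂]
        | hof y b => simp only [of_mul_of, smul_of, smul_mul_assoc, mul_smul_comm])

/-- An algebra homomorphism out of `A ⋊^α H` is given by elements `ρ(x)` of an `A`-algebra with
`ρ(x) ρ(y) = α(x,y) ρ(xy)` and `ρ(1) = α(1,1)`. -/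
def lift {E : Type*} [Ring E] [Algebra A E] (ρ : H → E)
    (hmul : ∀ x y, ρ x * ρ y = algebraMap k A (α.toFun x y) • ρ (x * y))
    (hone : ρ 1 = algebraMap k A (α.toFun 1 1) • 1) : Crossed A α →ₐ[A] E :=
  AlgHom.ofLinearMap (linLift ρ)
    (by
      rw [one_def, linLift_of, hone, smul_smul, ← map_mul, ← Units.val_mul, inv_mul_cancel,
        Units.val_one, map_one, one_smul])
    (fun f g => by
      induction f using Crossed.induction with
      | h0 => rw [zero_mul, map_zero, zero_mul]
      | hadd f₁ f₂ h₁ h₂ => rw [add_mul, map_add, map_add, h₁, h₂, add_mul]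
      | hof x a =>
        induction g using Crossed.induction with
        | h0 => rw [mul_zero, map_zero, mul_zero]
        | hadd f₁ f₂ h₁ h₂ => rw [mul_add, map_add, map_add, h₁, h₂, mul_add]
        | hof y b =>
          rw [of_mul_of, linLift_of, linLift_of, linLift_of, smul_mul_smul_comm, hmul, smul_smul])

/-- The homomorphism `A ⋊^{f^*α} K → A ⋊^α H`, `1_x ↦ 1_{f(x)}`. -/
def map {K : Type*} [Group K] (α : Cocycle2 H k) (f : K →* H) :
    Crossed A (α.comap f) →ₐ[A] Crossed A α :=
  lift (fun x => of (f x) 1)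
    (fun x y => by rw [of_mul_of, smul_of, map_mul, smul_eq_mul, one_mul, one_mul, mul_one]; rfl)
    (by
      have h : (α.comap f).toFun 1 1 = α.toFun 1 1 := by simp only [Cocycle2.comap, map_one]
      rw [one_def, smul_of, map_one, smul_eq_mul, ← map_mul, h,
        ← Units.val_mul, mul_inv_cancel, Units.val_one, map_one])

end basic

end Crossed

/-! ### The twisted Drinfel'd double -/

/-- The algebra `D^β(k[G])`: the `k`-vector space with basis `⌊g|x⌋`, `g, x ∈ G`. -/
def Double {G : Type*} [Group G] {k : Type*} [Field k] (_β : Cocycle3 G k) : Type _ :=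
  G × G →₀ k

namespace Double

variable {G : Type*} [Group G] {k : Type*} [Field k] {β : Cocycle3 G k}

instance : AddCommGroup (Double β) := inferInstanceAs (AddCommGroup (G × G →₀ k))

instance : Module k (Double β) := inferInstanceAs (Module k (G × G →₀ k))

/-- The element `a ⌊g|x⌋`. -/
def of (g x : G) (a : k) : Double β := Finsupp.single (g, x) a

lemma smul_of (s : k) (g x : G) (a : k) : s • (of g x a : Double β) = of g x (s * a) :=
  Finsupp.smul_single s (g, x) a

lemma induction {p : Double β → Prop} (f : Double β) (h0 : p 0)
    (hadd : ∀ f g, p f → p g → p (f + g)) (hof : ∀ g x a, p (of g x a)) : p f :=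
  Finsupp.induction_linear f h0 hadd fun i a => hof i.1 i.2 a

/-- The `k`-linear map with `⌊g|x⌋ ↦ ρ(g,x)`. -/
def linLift {E : Type*} [AddCommGroup E] [Module k E] (ρ : G → G → E) : Double β →ₗ[k] E :=
  (Finsupp.lsum k fun i : G × G => LinearMap.toSpanSingleton k E (ρ i.1 i.2) :
    (G × G →₀ k) →ₗ[k] E)

lemma linLift_of {E : Type*} [AddCommGroup E] [Module k E] (ρ : G → G → E) (g x : G) (a : k) :
    linLift (β := β) ρ (of g x a) = a • ρ g x := by
  change (Finsupp.lsum k fun i : G × G => LinearMap.toSpanSingleton k E (ρ i.1 i.2) :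
    (G × G →₀ k) →ₗ[k] E) (Finsupp.single (g, x) a) = _
  rw [Finsupp.lsum_single, LinearMap.toSpanSingleton_apply]

open Classical in
/-- The `k`-bilinear multiplication with `⌊g|x⌋ ⌊h|y⌋ = δ_{g,xhx⁻¹} θ_g(x,y) ⌊g|xy⌋`. -/
def mulL : Double β →ₗ[k] Double β →ₗ[k] Double β :=
  linLift fun g x => linLift fun h y =>
    if g = x * h * x⁻¹ then of g (x * y) (β.theta g x y : k) else 0

instance : Mul (Double β) := ⟨fun f g => mulL f g⟩

open Classical in
lemma of_mul_of (g x h y : G) (a b : k) : (of g x a * of h y b : Double β) =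
    if g = x * h * x⁻¹ then of g (x * y) (a * b * (β.theta g x y : k)) else 0 := by
  change mulL (of g x a) (of h y b) = _
  rw [mulL, linLift_of, LinearMap.smul_apply, linLift_of]
  split_ifs
  · rw [smul_of, smul_of, mul_assoc]
  · rw [smul_zero, smul_zero]

lemma of_mul_of_eq (x h y : G) (a b : k) : (of (x * h * x⁻¹) x a * of h y b : Double β) =
    of (x * h * x⁻¹) (x * y) (a * b * (β.theta (x * h * x⁻¹) x y : k)) := by
  rw [of_mul_of, if_pos rfl]

lemma of_mul_of_ne {g x h : G} (hg : g ≠ x * h * x⁻¹) (y : G) (a b : k) :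
    (of g x a * of h y b : Double β) = 0 := by
  rw [of_mul_of, if_neg hg]

protected lemma mul_add' (f g h : Double β) : f * (g + h) = f * g + f * h :=
  (mulL f).map_add g h

protected lemma add_mul' (f g h : Double β) : (f + g) * h = f * h + g * h :=
  LinearMap.map_add₂ mulL f g h

protected lemma zero_mul' (f : Double β) : 0 * f = 0 := LinearMap.map_zero₂ mulL f

protected lemma mul_zero' (f : Double β) : f * 0 = 0 := (mulL f).map_zero

protected lemma mul_assoc' (u v w : Double β) : u * v * w = u * (v * w) := by
  induction u using Double.induction with
  | h0 => simp only [Double.zero_mul']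
  | hadd f₁ f₂ h₁ h₂ => simp only [Double.add_mul', h₁, h₂]
  | hof g x a =>
    induction v using Double.induction with
    | h0 => simp only [Double.zero_mul', Double.mul_zero']
    | hadd f₁ f₂ h₁ h₂ => simp only [Double.add_mul', Double.mul_add', h₁, h₂]
    | hof h y b =>
      induction w using Double.induction with
      | h0 => simp only [Double.mul_zero']
      | hadd f₁ f₂ h₁ h₂ => simp only [Double.mul_add', h₁, h₂]
      | hof l z c =>
        by_cases hg : g = x * h * x⁻¹
        · by_cases hh : h = y * l * y⁻¹
          · have e : g = (x * y) * l * (x * y)⁻¹ := by rw [hg, hh]; group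
            rw [of_mul_of, if_pos hg, of_mul_of, if_pos e, of_mul_of, if_pos hh, of_mul_of,
              if_pos hg, mul_assoc x y z]
            have h1 := congrArg (Units.val) (β.theta_mul g x y z)
            have e2 : x⁻¹ * g * x = h := by rw [hg]; group
            rw [e2, Units.val_mul, Units.val_mul] at h1
            congr 1
            linear_combination a * b * c * h1
          · have e : g ≠ (x * y) * l * (x * y)⁻¹ := by
              intro e
              apply hh
              have : x * h * x⁻¹ = x * (y * l * y⁻¹) * x⁻¹ := by rw [← hg, e]; group
              simpa using this
            rw [of_mul_of, if_pos hg, of_mul_of_ne e, of_mul_of_ne hh, Double.mul_zero']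
        · rw [of_mul_of_ne hg, Double.zero_mul', of_mul_of]
          split_ifs
          · rw [of_mul_of_ne hg]
          · rw [Double.mul_zero']

variable [Fintype G]

/-- The unit is `∑_g θ_g(e,e)⁻¹ ⌊g|e⌋` (which is `∑_g ⌊g|e⌋` for a normalized cocycle). -/
instance : One (Double β) := ⟨∑ g : G, of g 1 (↑(β.theta g 1 1)⁻¹ : k)⟩

lemma one_def : (1 : Double β) = ∑ g : G, of g 1 (↑(β.theta g 1 1)⁻¹ : k) := rfl

protected lemma one_mul' (f : Double β) : 1 * f = f := by
  induction f using Double.induction with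
  | h0 => exact Double.mul_zero' _
  | hadd f₁ f₂ h₁ h₂ => rw [Double.mul_add', h₁, h₂]
  | hof h y a =>
    have e : (1 : Double β) * of h y a =
        ∑ g : G, (of g 1 (↑(β.theta g 1 1)⁻¹ : k) * of h y a : Double β) :=
      LinearMap.map_sum₂ mulL _ _ _
    rw [e, Finset.sum_eq_single h]
    · rw [of_mul_of, if_pos (by group), β.theta_one_left h y, one_mul, mul_right_comm,
        ← Units.val_mul, inv_mul_cancel, Units.val_one, one_mul]
    · intro g _ hg
      exact of_mul_of_ne (by simpa using hg) _ _ _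
    · simp

protected lemma mul_one' (f : Double β) : f * 1 = f := by
  induction f using Double.induction with
  | h0 => exact Double.zero_mul' _
  | hadd f₁ f₂ h₁ h₂ => rw [Double.add_mul', h₁, h₂]
  | hof h y a =>
    have e : of h y a * (1 : Double β) =
        ∑ g : G, (of h y a * of g 1 (↑(β.theta g 1 1)⁻¹ : k) : Double β) :=
      map_sum (mulL (of h y a)) _ _
    rw [e, Finset.sum_eq_single (y⁻¹ * h * y)]
    · rw [of_mul_of, if_pos (by group), β.theta_one_right h y, mul_one, mul_assoc,
        ← Units.val_mul, inv_mul_cancel, Units.val_one, mul_one]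
    · intro g _ hg
      refine of_mul_of_ne (fun e => hg ?_) _ _ _
      rw [e]; group
    · simp

instance : Ring (Double β) where
  __ : AddCommGroup (Double β) := inferInstance
  left_distrib := Double.mul_add'
  right_distrib := Double.add_mul'
  zero_mul := Double.zero_mul'
  mul_zero := Double.mul_zero'
  mul_assoc := Double.mul_assoc'
  one_mul := Double.one_mul'
  mul_one := Double.mul_one'

instance : Algebra k (Double β) :=
  Algebra.ofModule (fun s f g => LinearMap.map_smul₂ mulL s f g) (fun s f g => (mulL f).map_smul s g)

/-- `Δ(⌊g|x⌋) = ∑_{g₁g₂=g} γ_x(g₁,g₂) ⌊g₁|x⌋ ⊗ ⌊g₂|x⌋`; the pairs `(g₁,g₂)` with `g₁g₂ = g` are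
the pairs `(a, a⁻¹g)`, `a ∈ G`. -/
def comulBasis (g x : G) : Double β ⊗[k] Double β :=
  ∑ a : G, (β.gamma x a (a⁻¹ * g) : k) • ((of a x 1 : Double β) ⊗ₜ[k] (of (a⁻¹ * g) x 1 : Double β))

lemma comulBasis_mul (x h y : G) :
    (comulBasis (x * h * x⁻¹) x * comulBasis h y : Double β ⊗[k] Double β) =
      (β.theta (x * h * x⁻¹) x y : k) • comulBasis (x * h * x⁻¹) (x * y) := by
  rw [comulBasis, comulBasis, comulBasis, Finset.sum_mul_sum, Finset.smul_sum]
  refine Finset.sum_congr rfl fun a _ => ?_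
  rw [Finset.sum_eq_single (x⁻¹ * a * x)]
  · rw [smul_mul_smul_comm, Algebra.TensorProduct.tmul_mul_tmul, of_mul_of, if_pos (by group),
      of_mul_of, if_pos (by group)]
    have h1 := congrArg (Units.val) (β.gamma_mul a (a⁻¹ * (x * h * x⁻¹)) x y)
    have e1 : a * (a⁻¹ * (x * h * x⁻¹)) = x * h * x⁻¹ := by group
    have e2 : (x⁻¹ * a * x)⁻¹ * h = x⁻¹ * (a⁻¹ * (x * h * x⁻¹)) * x := by group
    have e3 : ∀ (g z : G) (c : k), (of g z (1 * 1 * c) : Double β) = c • of g z 1 := fun g z c => by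
      rw [smul_of, one_mul, one_mul, mul_one]
    rw [e1] at h1
    simp only [Units.val_mul] at h1
    rw [e2, e3, e3, TensorProduct.smul_tmul_smul, smul_smul, smul_smul, h1]
    congr 1
    ring
  · intro b _ hb
    rw [smul_mul_smul_comm, Algebra.TensorProduct.tmul_mul_tmul, of_mul_of_ne,
      TensorProduct.zero_tmul, smul_zero]
    rintro rfl
    exact hb (by group)
  · simp

lemma comulBasis_mul_ne {g x h : G} (hg : g ≠ x * h * x⁻¹) (y : G) :
    (comulBasis g x * comulBasis h y : Double β ⊗[k] Double β) = 0 := by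
  rw [comulBasis, comulBasis, Finset.sum_mul_sum]
  refine Finset.sum_eq_zero fun a _ => Finset.sum_eq_zero fun b _ => ?_
  rw [smul_mul_smul_comm, Algebra.TensorProduct.tmul_mul_tmul]
  by_cases h1 : a = x * b * x⁻¹
  · rw [of_mul_of_ne (g := a⁻¹ * g), TensorProduct.tmul_zero, smul_zero]
    intro h2
    apply hg
    rw [← mul_inv_cancel_left a g, h2, h1]
    group
  · rw [of_mul_of_ne h1, TensorProduct.zero_tmul, smul_zero]

/-- The comultiplication of `D^β(k[G])`, a homomorphism of algebras. -/
def comul : Double β →ₐ[k] Double β ⊗[k] Double β :=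
  AlgHom.ofLinearMap (linLift comulBasis)
    (by
      rw [one_def, map_sum, Algebra.TensorProduct.one_def, one_def, TensorProduct.sum_tmul]
      simp only [linLift_of, comulBasis, Finset.smul_sum, TensorProduct.tmul_sum]
      rw [Finset.sum_comm]
      refine Finset.sum_congr rfl fun a _ => ?_
      refine Fintype.sum_equiv (Equiv.mulLeft a⁻¹) _ _ fun g => ?_
      have h1 := β.gamma_one a (a⁻¹ * g)
      rw [mul_inv_cancel_left] at h1
      have e : ∀ (g z : G) (c : k), (of g z c : Double β) = c • of g z 1 := fun g z c => by
        rw [smul_of, mul_one]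
      have h2 : (β.theta g 1 1)⁻¹ * β.gamma 1 a (a⁻¹ * g) =
          (β.theta a 1 1)⁻¹ * (β.theta (a⁻¹ * g) 1 1)⁻¹ := by
        rw [← h1, mul_assoc, mul_inv, mul_right_comm, inv_mul_cancel, one_mul, mul_inv]
      rw [Equiv.coe_mulLeft, e a 1 ↑(β.theta a 1 1)⁻¹, e (a⁻¹ * g) 1 ↑(β.theta (a⁻¹ * g) 1 1)⁻¹,
        TensorProduct.smul_tmul_smul, smul_smul, ← Units.val_mul, h2, Units.val_mul])
    (fun u v => by
      induction u using Double.induction with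
      | h0 => rw [zero_mul, map_zero, zero_mul]
      | hadd f₁ f₂ h₁ h₂ => rw [add_mul, map_add, map_add, h₁, h₂, add_mul]
      | hof g x a =>
        induction v using Double.induction with
        | h0 => rw [mul_zero, map_zero, mul_zero]
        | hadd f₁ f₂ h₁ h₂ => rw [mul_add, map_add, map_add, h₁, h₂, mul_add]
        | hof h y b =>
          by_cases hg : g = x * h * x⁻¹
          · subst hg
            rw [of_mul_of_eq, linLift_of, linLift_of, linLift_of, smul_mul_smul_comm,
              comulBasis_mul, smul_smul]
          · rw [of_mul_of_ne hg, map_zero, linLift_of, linLift_of, smul_mul_smul_comm,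
              comulBasis_mul_ne hg, smul_zero])

end Double

/-! ### `A ⊗ D^β(k[G])` and the tensor product of its modules -/

section TensorDouble

variable (A : Type*) [CommRing A] {G : Type*} [Group G] [Fintype G] {k : Type*} [Field k]
  [Algebra k A] (β : Cocycle3 G k)

/-- The algebra `A ⊗_k D^β(k[G])`. -/
def TensorDouble : Type _ := A ⊗[k] Double β

instance : Ring (TensorDouble A β) := inferInstanceAs (Ring (A ⊗[k] Double β))

instance : Algebra A (TensorDouble A β) := inferInstanceAs (Algebra A (A ⊗[k] Double β))

instance : Algebra k (TensorDouble A β) := inferInstanceAs (Algebra k (A ⊗[k] Double β))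

instance : IsScalarTower k A (TensorDouble A β) :=
  inferInstanceAs (IsScalarTower k A (A ⊗[k] Double β))

/-- The inclusion `D^β(k[G]) → A ⊗ D^β(k[G])`, `d ↦ 1 ⊗ d`. -/
def TensorDouble.incl : Double β →ₐ[k] TensorDouble A β :=
  (Algebra.TensorProduct.includeRight : Double β →ₐ[k] A ⊗[k] Double β)

variable {A β} in
/-- The `A`-linear extension `A ⊗ D^β(k[G]) → E` of a homomorphism `D^β(k[G]) → E` of `k`-algebras,
for an `A`-algebra `E`. -/
def TensorDouble.lift {E : Type*} [Ring E] [Algebra A E] [Algebra k E] [IsScalarTower k A E]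
    (f : Double β →ₐ[k] E) : TensorDouble A β →ₐ[A] E :=
  (Algebra.TensorProduct.lift (Algebra.ofId A E) f
      (fun a d => show Commute (Algebra.ofId A E a) (f d) from Algebra.commutes a (f d)) :
    A ⊗[k] Double β →ₐ[A] E)

variable {A β} in
lemma TensorDouble.lift_incl {E : Type*} [Ring E] [Algebra A E] [Algebra k E]
    [IsScalarTower k A E] (f : Double β →ₐ[k] E) (d : Double β) :
    TensorDouble.lift f (TensorDouble.incl A β d) = f d := by
  change Algebra.TensorProduct.lift (Algebra.ofId A E) f _ ((1 : A) ⊗ₜ[k] d) = f d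
  rw [Algebra.TensorProduct.lift_tmul, map_one, one_mul]

/-- The homomorphism `D ⊗_k D → (A ⊗ D) ⊗_A (A ⊗ D)`, `d ⊗ d' ↦ (1 ⊗ d) ⊗ (1 ⊗ d')`. -/
def inclTensor : Double β ⊗[k] Double β →ₐ[k] TensorDouble A β ⊗[A] TensorDouble A β :=
  Algebra.TensorProduct.lift
    (((Algebra.TensorProduct.includeLeft : TensorDouble A β →ₐ[A] TensorDouble A β ⊗[A]
      TensorDouble A β).restrictScalars k).comp (TensorDouble.incl A β))
    (((Algebra.TensorProduct.includeRight : TensorDouble A β →ₐ[A] TensorDouble A β ⊗[A]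
      TensorDouble A β).restrictScalars k).comp (TensorDouble.incl A β))
    (fun x y => by
      change (TensorDouble.incl A β x ⊗ₜ[A] (1 : TensorDouble A β)) *
          ((1 : TensorDouble A β) ⊗ₜ[A] TensorDouble.incl A β y) =
        ((1 : TensorDouble A β) ⊗ₜ[A] TensorDouble.incl A β y) *
          (TensorDouble.incl A β x ⊗ₜ[A] (1 : TensorDouble A β))
      rw [Algebra.TensorProduct.tmul_mul_tmul, Algebra.TensorProduct.tmul_mul_tmul, one_mul,
        mul_one, mul_one, one_mul])

/-- The `A`-linear extension `A ⊗ D → (A ⊗ D) ⊗_A (A ⊗ D)` of the comultiplication of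
`D = D^β(k[G])`. -/
def comulA : TensorDouble A β →ₐ[A] TensorDouble A β ⊗[A] TensorDouble A β :=
  TensorDouble.lift ((inclTensor A β).comp Double.comul)

variable (P Q : Type*) [AddCommGroup P] [Module A P] [Module (TensorDouble A β) P]
  [IsScalarTower A (TensorDouble A β) P] [AddCommGroup Q] [Module A Q]
  [Module (TensorDouble A β) Q] [IsScalarTower A (TensorDouble A β) Q]

/-- The tensor product `P ⊗_A Q` of two modules over `A ⊗ D^β(k[G])`, on which `A ⊗ D^β(k[G])` acts
through the comultiplication. -/
def ComulTensor (A : Type*) [CommRing A] {G : Type*} [Group G] {k : Type*} [Field k]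
    (_β : Cocycle3 G k) (P Q : Type*) [AddCommGroup P] [Module A P] [AddCommGroup Q] [Module A Q] :
    Type _ := P ⊗[A] Q

instance : AddCommGroup (ComulTensor A β P Q) := inferInstanceAs (AddCommGroup (P ⊗[A] Q))

/-- The action of `A ⊗ D^β(k[G])` on `P ⊗_A Q` through the comultiplication. -/
def comulAction : TensorDouble A β →ₐ[A] Module.End A (P ⊗[A] Q) :=
  (Module.endTensorEndAlgHom (R := A) (S := A) (A := A) (M := P) (N := Q)).comp
    ((Algebra.TensorProduct.map (Algebra.lsmul A A P) (Algebra.lsmul A A Q)).comp (comulA A β))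

instance : Module (TensorDouble A β) (ComulTensor A β P Q) :=
  Module.compHom (P ⊗[A] Q) (comulAction A β P Q).toRingHom

end TensorDouble

/-! ### The algebra `B^β` -/

section TwistedSum

variable (A : Type*) [CommRing A] {G : Type*} [Group G] {k : Type*} [Field k]
  [Algebra k A] (β : Cocycle3 G k)

/-- The algebra `B^β = ⨁_{[g]} A ⋊^{θ_g} Z(g)`, the (finite) direct sum over the conjugacy classes
`c` of `G`, each represented by `rep c`. -/
abbrev TwistedSum (rep : ConjClasses G → G) : Type _ :=
  (c : ConjClasses G) → Crossed A (β.thetaZ (rep c))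

variable {A} {β}

lemma conj_mem (x g : G) (w : Subgroup.centralizer {g}) :
    x * w * x⁻¹ ∈ Subgroup.centralizer {x * g * x⁻¹} := by
  rw [Subgroup.mem_centralizer_singleton_iff]
  have h := Subgroup.mem_centralizer_singleton_iff.1 w.2
  calc x * w * x⁻¹ * (x * g * x⁻¹) = x * (w * g) * x⁻¹ := by group
    _ = x * g * x⁻¹ * (x * w * x⁻¹) := by rw [h]; group

lemma conj_aux {M : Type*} [AddCommGroup M] {p q r s u v t y n c : M} (t1 : p + q = r + s)
    (t2 : u + v = r + t) (t3 : y + q = n + c) : y - p + (s - t) + u = c + (n - v) := by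
  linear_combination (norm := module) (1 : ℤ) • t3 - (1 : ℤ) • t1 + (1 : ℤ) • t2

lemma conj_mem' {x g m : G} (hm : x * g * x⁻¹ = m) (w : Subgroup.centralizer {g}) :
    x * w * x⁻¹ ∈ Subgroup.centralizer {m} := hm ▸ conj_mem x g w

variable (A β) in
/-- Transport along conjugation by `x`, where `m = xgx⁻¹`: the isomorphism
`A ⋊^{θ_g} Z(g) → A ⋊^{θ_m} Z(m)` given by `1_w ↦ θ_m(x,w) / θ_m(xwx⁻¹,x) 1_{xwx⁻¹}`. -/
def conjHom {x g m : G} (hm : x * g * x⁻¹ = m) :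
    Crossed A (β.thetaZ g) →ₐ[A] Crossed A (β.thetaZ m) :=
  Crossed.lift
    (fun w => Crossed.of ⟨x * w * x⁻¹, conj_mem' hm w⟩
      (algebraMap k A ↑(β.theta m x w / β.theta m (x * w * x⁻¹) x)))
    (fun w w' => by
      subst hm
      have hw : (x * w * x⁻¹)⁻¹ * (x * g * x⁻¹) * (x * w * x⁻¹) = x * g * x⁻¹ := by
        rw [mul_assoc, ← Subgroup.mem_centralizer_singleton_iff.1 (conj_mem x g w),
          inv_mul_cancel_left]
      have hx : x⁻¹ * (x * g * x⁻¹) * x = g := by group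
      have t1 := β.theta_mul (x * g * x⁻¹) (x * w * x⁻¹) x w'
      have t2 := β.theta_mul (x * g * x⁻¹) (x * w * x⁻¹) (x * w' * x⁻¹) x
      have t3 := β.theta_mul (x * g * x⁻¹) x w w'
      rw [hw, show x * (w : G) * x⁻¹ * x = x * w by group] at t1
      rw [hw, show x * (w' : G) * x⁻¹ * x = x * w' by group,
        show x * (w : G) * x⁻¹ * (x * w' * x⁻¹) = x * (w * w' : G) * x⁻¹ by group] at t2
      rw [hx] at t3
      rw [Crossed.of_mul_of, ← map_mul, ← map_mul, ← Units.val_mul, ← Units.val_mul,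
        Crossed.smul_of, smul_eq_mul, ← map_mul, ← Units.val_mul]
      have e1 : (⟨x * w * x⁻¹, conj_mem x g w⟩ * ⟨x * w' * x⁻¹, conj_mem x g w'⟩ :
          Subgroup.centralizer {x * g * x⁻¹}) = ⟨x * ↑(w * w') * x⁻¹, conj_mem x g (w * w')⟩ :=
        Subtype.ext (by push_cast; group)
      rw [e1]
      congr 3
      simp only [Cocycle3.thetaZ, Subgroup.coe_mul]
      exact conj_aux (M := Additive kˣ) t1 t2 t3)
    (by
      subst hm
      have e1 : (⟨x * ↑(1 : Subgroup.centralizer {g}) * x⁻¹, conj_mem x g 1⟩ :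
          Subgroup.centralizer {x * g * x⁻¹}) = 1 :=
        Subtype.ext (by push_cast; group)
      have hx : x⁻¹ * (x * g * x⁻¹) * x = g := by group
      have h1 := β.theta_one_right (x * g * x⁻¹) x
      rw [hx] at h1
      rw [e1, Crossed.one_def, Crossed.smul_of, smul_eq_mul, ← map_mul, ← Units.val_mul]
      simp only [Cocycle3.thetaZ, Subgroup.coe_one, mul_one, mul_inv_cancel]
      rw [h1, β.theta_one_left _ x, div_eq_mul_inv])

variable (A β) in
/-- For `m ∈ G`, the homomorphism `B^β → A ⋊^{θ_m} Z(m)`: projection to the summand of the conjugacy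
class of `m`, followed by transport along a conjugation from its representative to `m`. -/
def sectorHom (rep : ConjClasses G → G) (hrep : ∀ c, ConjClasses.mk (rep c) = c) (m : G) :
    TwistedSum A β rep →ₐ[A] Crossed A (β.thetaZ m) :=
  have h : ∃ x, x * rep (ConjClasses.mk m) * x⁻¹ = m :=
    isConj_iff.1 (ConjClasses.mk_eq_mk_iff_isConj.1 (hrep (ConjClasses.mk m)))
  (conjHom A β h.choose_spec).comp
    (Pi.evalAlgHom A (fun c => Crossed A (β.thetaZ (rep c))) (ConjClasses.mk m))

end TwistedSum

/-! ### Extension of scalars along a homomorphism of (noncommutative) algebras -/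

section BaseChange

variable {A S R : Type*} [CommRing A] [Ring S] [Algebra A S] [Ring R] [Algebra A R]

/-- The `R`-module `R ⊗_S M`, for a homomorphism `f : S → R` of `A`-algebras and an `S`-module
`M`: the quotient of `R ⊗_A M` by the relations `r f(s) ⊗ m = r ⊗ s m`. -/
def BaseChange (f : S →ₐ[A] R) (M : Type*) [AddCommGroup M] [Module A M] [Module S M] : Type _ :=
  (R ⊗[A] M) ⧸ Submodule.span R
    {t : R ⊗[A] M | ∃ (r : R) (s : S) (m : M), t = (r * f s) ⊗ₜ[A] m - r ⊗ₜ[A] (s • m)}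

variable (f : S →ₐ[A] R) (M : Type*) [AddCommGroup M] [Module A M] [Module S M]

instance : AddCommGroup (BaseChange f M) := inferInstanceAs (AddCommGroup (_ ⧸ Submodule.span R _))

instance : Module R (BaseChange f M) := inferInstanceAs (Module R (_ ⧸ Submodule.span R _))

instance : Module A (BaseChange f M) := inferInstanceAs (Module A (_ ⧸ Submodule.span R _))

instance : IsScalarTower A R (BaseChange f M) :=
  inferInstanceAs (IsScalarTower A R (_ ⧸ Submodule.span R _))

end BaseChange

/-! ### The product of two `B^β`-modules -/

section PushPull

variable (A : Type*) [CommRing A] {G : Type*} [Group G] {k : Type*} [Field k]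
  [Algebra k A] (β : Cocycle3 G k)

/-- `Z(g,h) ≤ Z(g)`. -/
lemma pairZ_le_left (g h : G) : Subgroup.centralizer {g, h} ≤ Subgroup.centralizer {g} :=
  Subgroup.centralizer_le (by simp)

/-- `Z(g,h) ≤ Z(h)`. -/
lemma pairZ_le_right (g h : G) : Subgroup.centralizer {g, h} ≤ Subgroup.centralizer {h} :=
  Subgroup.centralizer_le (by simp)

/-- `Z(g,h) ≤ Z(gh)`. -/
lemma pairZ_le_mul {g h r : G} (hr : g * h = r) :
    Subgroup.centralizer {g, h} ≤ Subgroup.centralizer {r} := by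
  intro x hx
  have h1 := Subgroup.mem_centralizer_singleton_iff.1 (pairZ_le_left g h hx)
  have h2 := Subgroup.mem_centralizer_singleton_iff.1 (pairZ_le_right g h hx)
  rw [Subgroup.mem_centralizer_singleton_iff, ← hr, ← mul_assoc, h1, mul_assoc, h2, mul_assoc]

/-- The algebra `A ⋊^{θ_r} Z(g,h)` for `gh = r`. -/
abbrev PairCrossed {g h r : G} (hr : g * h = r) : Type _ :=
  Crossed A ((β.thetaZ r).comap (Subgroup.inclusion (pairZ_le_mul hr)))

variable {g h r : G} (hr : g * h = r)
  (M N : Type*) [AddCommGroup M] [Module A M] [Module (Crossed A (β.thetaZ g)) M]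
  [IsScalarTower A (Crossed A (β.thetaZ g)) M] [AddCommGroup N] [Module A N]
  [Module (Crossed A (β.thetaZ h)) N] [IsScalarTower A (Crossed A (β.thetaZ h)) N]

/-- For a `θ_g`-twisted module `M` over `Z(g)` and a `θ_h`-twisted module `N` over `Z(h)`, the action
of `A ⋊^{θ_{gh}} Z(g,h)` on `M ⊗_A N` in which `x ∈ Z(g,h)` acts by `γ_x(g,h) x ⊗ x`. -/
def gammaAction : PairCrossed A β hr →ₐ[A] Module.End A (M ⊗[A] N) :=
  Crossed.lift
    (fun x => algebraMap k A (β.gamma x g h) • TensorProduct.map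
      (Algebra.lsmul A A M
        (Crossed.of (Subgroup.inclusion (pairZ_le_left g h) x) 1 : Crossed A (β.thetaZ g)))
      (Algebra.lsmul A A N
        (Crossed.of (Subgroup.inclusion (pairZ_le_right g h) x) 1 : Crossed A (β.thetaZ h))))
    (fun x y => by
      have hM : ∀ u v : Subgroup.centralizer {g},
          Algebra.lsmul A A M (Crossed.of u 1 : Crossed A (β.thetaZ g)) *
            Algebra.lsmul A A M (Crossed.of v 1 : Crossed A (β.thetaZ g)) =
          algebraMap k A (β.theta g u v) •
            Algebra.lsmul A A M (Crossed.of (u * v) 1 : Crossed A (β.thetaZ g)) := fun u v => by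
        rw [← map_mul, ← map_smul, Crossed.of_mul_of, Crossed.smul_of, smul_eq_mul, one_mul,
          one_mul, mul_one]
        rfl
      have hN : ∀ u v : Subgroup.centralizer {h},
          Algebra.lsmul A A N (Crossed.of u 1 : Crossed A (β.thetaZ h)) *
            Algebra.lsmul A A N (Crossed.of v 1 : Crossed A (β.thetaZ h)) =
          algebraMap k A (β.theta h u v) •
            Algebra.lsmul A A N (Crossed.of (u * v) 1 : Crossed A (β.thetaZ h)) := fun u v => by
        rw [← map_mul, ← map_smul, Crossed.of_mul_of, Crossed.smul_of, smul_eq_mul, one_mul,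
          one_mul, mul_one]
        rfl
      have hg : (x : G)⁻¹ * g * x = g := by
        rw [mul_assoc, ← Subgroup.mem_centralizer_singleton_iff.1 (pairZ_le_left g h x.2),
          inv_mul_cancel_left]
      have hh : (x : G)⁻¹ * h * x = h := by
        rw [mul_assoc, ← Subgroup.mem_centralizer_singleton_iff.1 (pairZ_le_right g h x.2),
          inv_mul_cancel_left]
      have h1 := congrArg (Units.val) (β.gamma_mul g h x y)
      rw [hg, hh, hr] at h1
      simp only [Units.val_mul] at h1
      rw [smul_mul_smul_comm, ← TensorProduct.map_mul, hM, hN, TensorProduct.map_smul_left,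
        TensorProduct.map_smul_right, smul_smul, smul_smul, smul_smul, ← map_mul, ← map_mul,
        ← map_mul, ← map_mul, ← map_mul]
      congr 1
      simp only [Cocycle2.comap, Cocycle3.thetaZ, Subgroup.coe_inclusion, Subgroup.coe_mul]
      rw [← map_mul, h1]
      congr 1
      ring)
    (by
      have hM : (Crossed.of (Subgroup.inclusion (pairZ_le_left g h) 1) 1 :
          Crossed A (β.thetaZ g)) = algebraMap k A (β.theta g 1 1) • 1 := by
        rw [Crossed.one_def, Crossed.smul_of, smul_eq_mul, ← map_mul, map_one]
        simp [Cocycle3.thetaZ]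
      have hN : (Crossed.of (Subgroup.inclusion (pairZ_le_right g h) 1) 1 :
          Crossed A (β.thetaZ h)) = algebraMap k A (β.theta h 1 1) • 1 := by
        rw [Crossed.one_def, Crossed.smul_of, smul_eq_mul, ← map_mul, map_one]
        simp [Cocycle3.thetaZ]
      have h1 := β.gamma_one g h
      rw [hr] at h1
      rw [hM, hN, map_smul, map_smul, map_one, map_one, TensorProduct.map_smul_left,
        TensorProduct.map_smul_right, TensorProduct.map_one, smul_smul, smul_smul, ← map_mul,
        ← map_mul]
      congr 2
      simp only [Cocycle2.comap, Cocycle3.thetaZ, map_one, Subgroup.coe_one]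
      rw [← h1, Units.val_mul, Units.val_mul])

/-- The tensor product `M ⊗^γ_A N`: the `A`-module `M ⊗_A N` with the `γ`-twisted diagonal action of
`Z(g,h)`. -/
def GammaTensor (A : Type*) [CommRing A] {G : Type*} [Group G] {k : Type*} [Field k]
    (_β : Cocycle3 G k) {g h r : G} (_hr : g * h = r) (M N : Type*) [AddCommGroup M] [Module A M]
    [AddCommGroup N] [Module A N] : Type _ := M ⊗[A] N

instance : AddCommGroup (GammaTensor A β hr M N) := inferInstanceAs (AddCommGroup (M ⊗[A] N))

instance : Module A (GammaTensor A β hr M N) := inferInstanceAs (Module A (M ⊗[A] N))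

instance : Module (PairCrossed A β hr) (GammaTensor A β hr M N) :=
  Module.compHom (M ⊗[A] N) (gammaAction A β hr M N).toRingHom

/-- The pairs `(g,h)` with `gh = r`, up to simultaneous conjugation by elements of `Z(r)`. -/
def pairSetoid (r : G) : Setoid {p : G × G // p.1 * p.2 = r} where
  r p q := ∃ z ∈ Subgroup.centralizer {r}, q.1.1 = z * p.1.1 * z⁻¹ ∧ q.1.2 = z * p.1.2 * z⁻¹
  iseqv :=
    { refl := fun p => ⟨1, one_mem _, by group, by group⟩
      symm := fun {p q} ⟨z, hz, h1, h2⟩ =>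
        ⟨z⁻¹, inv_mem hz, by rw [h1]; group, by rw [h2]; group⟩
      trans := fun {p q s} ⟨z, hz, h1, h2⟩ ⟨w, hw, h3, h4⟩ =>
        ⟨w * z, mul_mem hw hz, by rw [h3, h1]; group, by rw [h4, h2]; group⟩ }

variable (rep : ConjClasses G → G) (hrep : ∀ c, ConjClasses.mk (rep c) = c)
  (V W : Type*) [AddCommGroup V] [Module A V] [Module (TwistedSum A β rep) V]
  [IsScalarTower A (TwistedSum A β rep) V] [AddCommGroup W] [Module A W]
  [Module (TwistedSum A β rep) W] [IsScalarTower A (TwistedSum A β rep) W]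

/-- The sector `V_m` of a `B^β`-module `V` at `m ∈ G`, a `θ_m`-twisted module over `Z(m)`. -/
abbrev Sector (m : G) : Type _ := BaseChange (sectorHom (A := A) (β := β) rep hrep m) V

/-- The `r`-component, `r = rep c`, of the product of two `B^β`-modules `V` and `W`:
`⨁_{(g,h)} Ind_{Z(g,h)}^{Z(r)} (V_g ⊗^γ_A W_h)`, where `(g,h)` runs over representatives of the
pairs with `gh = r` up to conjugation by `Z(r)`. -/
def SectorProduct (c : ConjClasses G) : Type _ :=
  (o : Quotient (pairSetoid (rep c))) →
    BaseChange
      (Crossed.map (A := A) (β.thetaZ (rep c)) (Subgroup.inclusion (pairZ_le_mul o.out.2)))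
      (GammaTensor A β o.out.2 (Sector A β rep hrep V o.out.1.1)
        (Sector A β rep hrep W o.out.1.2))

instance (c : ConjClasses G) : AddCommGroup (SectorProduct A β rep hrep V W c) :=
  inferInstanceAs (AddCommGroup ((o : Quotient (pairSetoid (rep c))) → BaseChange _ _))

instance (c : ConjClasses G) :
    Module (Crossed A (β.thetaZ (rep c))) (SectorProduct A β rep hrep V W c) :=
  inferInstanceAs (Module (Crossed A (β.thetaZ (rep c)))
    ((o : Quotient (pairSetoid (rep c))) → BaseChange _ _))

/-- The product of two `B^β`-modules: pull back to the double sectors `(g,h)`, tensor with the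
`γ`-twisted action of `Z(g,h)`, and push forward to the sectors `gh`. -/
def PushPull : Type _ := (c : ConjClasses G) → SectorProduct A β rep hrep V W c

instance : AddCommGroup (PushPull A β rep hrep V W) :=
  inferInstanceAs (AddCommGroup ((c : ConjClasses G) → SectorProduct A β rep hrep V W c))

instance : Module (TwistedSum A β rep) (PushPull A β rep hrep V W) :=
  Pi.module' (f := fun c => Crossed A (β.thetaZ (rep c)))
    (g := fun c => SectorProduct A β rep hrep V W c)

end PushPull

/-! ### The group `K₀` of a ring -/

section KZero

universe w u

/-- The finitely generated projective modules over a ring. -/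
abbrev FGProj (R : Type u) [Ring R] : Type (max u (w + 1)) :=
  {M : ModuleCat.{w} R // Module.Finite R M ∧ Module.Projective R M}

/-- Isomorphism of finitely generated projective modules. -/
instance FGProj.setoid (R : Type u) [Ring R] : Setoid (FGProj.{w} R) where
  r M N := Nonempty (M.1 ≃ₗ[R] N.1)
  iseqv :=
    { refl := fun _ => ⟨LinearEquiv.refl _ _⟩
      symm := fun ⟨e⟩ => ⟨e.symm⟩
      trans := fun ⟨e⟩ ⟨f⟩ => ⟨e.trans f⟩ }

/-- The set of isomorphism classes of finitely generated projective modules. -/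
def IsoClass (R : Type u) [Ring R] : Type (max u (w + 1)) := Quotient (FGProj.setoid.{w} R)

/-- The isomorphism class of a finitely generated projective module. -/
def IsoClass.mk (R : Type u) [Ring R] (M : Type w) [AddCommGroup M] [Module R M]
    (h : Module.Finite R M ∧ Module.Projective R M) : IsoClass.{w} R :=
  Quotient.mk (FGProj.setoid.{w} R) ⟨ModuleCat.of R M, h⟩

/-- The sum of isomorphism classes is induced by the direct sum of modules. -/
instance (R : Type u) [Ring R] : Add (IsoClass.{w} R) where
  add := Quotient.map₂
    (fun M N => ⟨ModuleCat.of R (M.1 × N.1),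
      haveI := M.2.1; haveI := M.2.2; haveI := N.2.1; haveI := N.2.2
      ⟨inferInstance, inferInstance⟩⟩)
    (fun _ _ ⟨e⟩ _ _ ⟨f⟩ => ⟨LinearEquiv.prodCongr e f⟩)

instance (R : Type u) [Ring R] : Zero (IsoClass.{w} R) where
  zero := IsoClass.mk R PUnit.{w + 1} ⟨inferInstance, inferInstance⟩

instance (R : Type u) [Ring R] : AddCommMonoid (IsoClass.{w} R) where
  nsmul := nsmulRec
  add_assoc := by
    rintro ⟨M⟩ ⟨N⟩ ⟨P⟩
    exact Quotient.sound ⟨LinearEquiv.prodAssoc R M.1 N.1 P.1⟩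
  zero_add := by
    rintro ⟨M⟩
    exact Quotient.sound ⟨(LinearEquiv.uniqueProd : (PUnit.{w + 1} × M.1) ≃ₗ[R] M.1)⟩
  add_zero := by
    rintro ⟨M⟩
    exact Quotient.sound ⟨(LinearEquiv.prodUnique : (M.1 × PUnit.{w + 1}) ≃ₗ[R] M.1)⟩
  add_comm := by
    rintro ⟨M⟩ ⟨N⟩
    exact Quotient.sound ⟨LinearEquiv.prodComm R M.1 N.1⟩

/-- `K₀(R)`: the Grothendieck group of the finitely generated projective `R`-modules. -/
abbrev KZero (R : Type u) [Ring R] : Type (max u (w + 1)) :=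
  Algebra.GrothendieckAddGroup (IsoClass.{w} R)

/-- The class `[M] ∈ K₀(R)` of a finitely generated projective module `M`. -/
def KZero.mk (R : Type u) [Ring R] (M : Type w) [AddCommGroup M] [Module R M]
    (h : Module.Finite R M ∧ Module.Projective R M) : KZero.{w} R :=
  Algebra.GrothendieckAddGroup.of (IsoClass.mk R M h)

end KZero

/-! ### Smooth functions -/

/-- `C^∞(X)`: the algebra of smooth `𝕜`-valued functions, `𝕜 = ℝ` or `ℂ`, on a real manifold. -/
def smoothFunctions (𝕜 : Type*) [RCLike 𝕜] {E H : Type*} [NormedAddCommGroup E] [NormedSpace ℝ E]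
    [TopologicalSpace H] (I : ModelWithCorners ℝ E H) (X : Type*) [TopologicalSpace X]
    [ChartedSpace H X] : Subalgebra 𝕜 (X → 𝕜) where
  carrier := {f | ContMDiff I 𝓘(ℝ, 𝕜) ∞ f}
  mul_mem' hf hg :=
    (contDiff_mul (𝕜 := ℝ) (𝔸 := 𝕜)).contMDiff.comp (hf.prodMk_space hg)
  add_mem' hf hg :=
    (contDiff_add (𝕜 := ℝ) (F := 𝕜)).contMDiff.comp (hf.prodMk_space hg)
  algebraMap_mem' _ := contMDiff_const

end DrinfeldTwist

end

universe u v

open DrinfeldTwist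

open scoped TensorProduct ContDiff Manifold ModuleCat.Algebra

noncomputable section

namespace DrinfeldTwist

/-! ### The standard basis of `A ⊗ D^β(k[G])` -/

/-! The algebra `A ⊗ D^β(k[G])` is a twisted groupoid algebra. The element `⌊g|x⌋` is an arrow,
between `g` and `x⁻¹gx`, of the action groupoid of `G` on itself by conjugation, and products are
compositions up to the scalars `θ`. The identity arrows, rescaled to the idempotents `idem`, sum to
`1`; every arrow is invertible up to a unit of `k` (`basisInv`); and the automorphisms of the object
`g` span a copy of `A ⋊^{θ_g} Z(g)`.

Every object is isomorphic to exactly one representative `rep c`, so a module `P` is determined by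
its components `idem (rep c) • P`, that is, by the `B^β`-module `Restriction`. This functor is the
Morita equivalence. It is full because a map given at the representatives is carried to the other
components along chosen arrows (`extension`), faithful because these arrows are invertible, and
essentially surjective because equivariant functions on arrows restrict to any prescribed
`B^β`-module (`coinducedRestrictionEquiv`).

Both algebras are finite over `A`, so finite generation can be tested over `A`; projectivity is
categorical and passes through the equivalence. For `P ⊗_A Q` a Maschke argument is used: `|G|` is
invertible, since `k` maps to `ℝ` or `ℂ`, and averaging over the arrows turns projectivity over `A`
into projectivity over `A ⊗ D^β(k[G])` (`TensorDouble.projective_of_projective`).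

The products agree for the following reason. By the formula for `Δ`, the component of `P ⊗_A Q` at
`r` is the direct sum of the `P_g ⊗_A Q_h` with `gh = r`. The arrows `⌊r|z⌋` with `z ∈ Z(r)` permute
these summands by simultaneous conjugation, and the stabilizer `Z(g,h)` acts on its summand by the
`γ`-twisted action. Each orbit therefore contributes a module induced from `Z(g,h)`; this is the
bijectivity of `inducedMap`. Together with `sectorEquiv`, which identifies the sectors of a
`B^β`-module with the components of the corresponding `P`, it gives `pushPullEquiv`.

On `K₀` the product of `B^β` is obtained by transport from that of `A ⊗ D^β(k[G])`. Multiplicativity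
is then automatic, and the content lies in `mulTwistedSum_mk`, which computes the transported
product. -/

/-- A unit of `k`, as a scalar in `A`. -/
def unitScalar (A : Type*) [CommRing A] {k : Type*} [Field k] [Algebra k A] : kˣ →* A :=
  (algebraMap k A).toMonoidHom.comp (Units.coeHom k)

section Scalar

variable {A : Type*} [CommRing A] {k : Type*} [Field k] [Algebra k A]

lemma unitScalar_apply (c : kˣ) : unitScalar A c = algebraMap k A c := rfl

variable {P : Type*} [AddCommGroup P] [Module A P]

lemma unitScalar_inv_smul_smul (c : kˣ) (p : P) : unitScalar A c⁻¹ • unitScalar A c • p = p := by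
  rw [smul_smul, ← map_mul, inv_mul_cancel, map_one, one_smul]

lemma unitScalar_smul_inv_smul (c : kˣ) (p : P) : unitScalar A c • unitScalar A c⁻¹ • p = p := by
  rw [smul_smul, ← map_mul, mul_inv_cancel, map_one, one_smul]

end Scalar

variable {A : Type*} [CommRing A] {G : Type*} [Group G] [Fintype G] {k : Type*} [Field k]
  [Algebra k A] {β : Cocycle3 G k}

/-- The cocycle identity for `θ` at `(x, x⁻¹, x)`. It makes the right inverse of an arrow, with its
normalizing scalar, also a left inverse. -/
lemma Cocycle3.theta_inv_right {G : Type*} [Group G] {k : Type*} [Field k] (β : Cocycle3 G k)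
    (g x : G) : β.theta (x⁻¹ * g * x) x⁻¹ x * β.theta (x⁻¹ * g * x) 1 1 =
      β.theta g x x⁻¹ * β.theta g 1 1 := by
  have h := β.theta_mul g x x⁻¹ x
  rw [mul_inv_cancel, inv_mul_cancel, β.theta_one_left g x, β.theta_one_right g x] at h
  rw [h, mul_comm]

namespace TensorDouble

variable (A β) in
/-- The basis element `1 ⊗ ⌊g|x⌋`. -/
def basis (g x : G) : TensorDouble A β := incl A β (Double.of g x 1)

lemma incl_of (g x : G) (a : k) :
    incl A β (Double.of g x a) = algebraMap k A a • basis A β g x := by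
  rw [basis, algebraMap_smul, ← map_smul, Double.smul_of, mul_one]

/-- The composability condition `g = xhx⁻¹` is solved for `h`, so that the hypothesis reads as the
end point of the arrow `⌊g|x⌋`. -/
lemma basis_mul_basis {g x h : G} (hg : x⁻¹ * g * x = h) (y : G) :
    basis A β g x * basis A β h y = unitScalar A (β.theta g x y) • basis A β g (x * y) := by
  rw [basis, basis, ← map_mul, Double.of_mul_of, if_pos (by rw [← hg]; group), incl_of, one_mul,
    one_mul, unitScalar_apply]

lemma basis_mul_basis_ne {g x h : G} (hg : x⁻¹ * g * x ≠ h) (y : G) :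
    basis A β g x * basis A β h y = 0 := by
  rw [basis, basis, ← map_mul, Double.of_mul_of_ne (fun e => hg (by rw [e]; group)), map_zero]

variable (A β) in
/-- The idempotent `1 ⊗ θ_g(1,1)⁻¹ ⌊g|1⌋`. -/
def idem (g : G) : TensorDouble A β := unitScalar A (β.theta g 1 1)⁻¹ • basis A β g 1

lemma basis_one (g : G) : basis A β g 1 = unitScalar A (β.theta g 1 1) • idem A β g := by
  rw [idem, unitScalar_smul_inv_smul]

lemma sum_idem : ∑ g : G, idem A β g = 1 := by
  rw [← map_one (incl A β), Double.one_def, map_sum]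
  exact Finset.sum_congr rfl fun g _ => by rw [incl_of, idem, unitScalar_apply]

/-- Since `θ_g(1,x)` does not depend on `x`, the single scalar in `idem` normalizes all these
products, although `β` need not be normalized. -/
lemma idem_mul_basis (g x : G) : idem A β g * basis A β g x = basis A β g x := by
  rw [idem, smul_mul_assoc, basis_mul_basis (by group), β.theta_one_left g x, one_mul,
    unitScalar_inv_smul_smul]

lemma basis_mul_idem {g x h : G} (hg : x⁻¹ * g * x = h) :
    basis A β g x * idem A β h = basis A β g x := by
  rw [idem, mul_smul_comm, basis_mul_basis hg, β.theta_one_right g x, hg, mul_one,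
    unitScalar_inv_smul_smul]

lemma basis_mul_idem_ne {g x h : G} (hg : x⁻¹ * g * x ≠ h) :
    basis A β g x * idem A β h = 0 := by
  rw [idem, mul_smul_comm, basis_mul_basis_ne hg, smul_zero]

lemma idem_mul_idem (g : G) : idem A β g * idem A β g = idem A β g := by
  nth_rw 1 [idem]
  rw [smul_mul_assoc, basis_mul_idem (by group), ← idem]

variable (A β) in
/-- The inverse of `1 ⊗ ⌊g|x⌋` in the groupoid sense. -/
def basisInv (g x : G) : TensorDouble A β :=
  -- The product of the two arrows is `θ_g(x,x⁻¹) ⌊g|1⌋`, and `⌊g|1⌋` is `θ_g(1,1)` times the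
  -- idempotent; both factors are divided out.
  unitScalar A (β.theta g x x⁻¹ * β.theta g 1 1)⁻¹ • basis A β (x⁻¹ * g * x) x⁻¹

lemma basis_mul_basisInv (g x : G) : basis A β g x * basisInv A β g x = idem A β g := by
  rw [basisInv, mul_smul_comm, basis_mul_basis rfl, mul_inv_cancel, basis_one, smul_smul, smul_smul,
    ← map_mul, ← map_mul, mul_assoc, inv_mul_cancel, map_one, one_smul]

lemma basisInv_mul_basis {g x h : G} (hg : x⁻¹ * g * x = h) :
    basisInv A β g x * basis A β g x = idem A β h := by
  subst hg
  rw [basisInv, smul_mul_assoc, basis_mul_basis (by group), inv_mul_cancel, basis_one, smul_smul,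
    smul_smul, ← map_mul, ← map_mul, mul_assoc, β.theta_inv_right, inv_mul_cancel, map_one,
    one_smul]

lemma basisInv_mul_basis_ne {g g' : G} (hg : g ≠ g') (x y : G) :
    basisInv A β g x * basis A β g' y = 0 := by
  rw [basisInv, smul_mul_assoc, basis_mul_basis_ne (by simpa [mul_assoc] using hg), smul_zero]

lemma idem_mul_basisInv {g x h : G} (hg : x⁻¹ * g * x = h) :
    idem A β h * basisInv A β g x = basisInv A β g x := by
  subst hg
  rw [basisInv, mul_smul_comm, idem_mul_basis]

@[elab_as_elim]
lemma induction {p : TensorDouble A β → Prop} (d : TensorDouble A β) (h0 : p 0)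
    (hadd : ∀ d e, p d → p e → p (d + e)) (hb : ∀ g x (a : A), p (a • basis A β g x)) : p d := by
  refine TensorProduct.induction_on (motive := p) d h0 (fun a d => ?_) hadd
  induction d using Double.induction with
  | h0 => rwa [TensorProduct.tmul_zero]
  | hadd d e h₁ h₂ => rw [TensorProduct.tmul_add]; exact hadd _ _ h₁ h₂
  | hof g x c =>
    have h : (a ⊗ₜ[k] (Double.of g x c : Double β) : TensorDouble A β) =
        (a * algebraMap k A c) • basis A β g x := by
      rw [mul_smul, ← incl_of]
      change _ = a • ((1 : A) ⊗ₜ[k] (Double.of g x c : Double β))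
      rw [TensorProduct.smul_tmul', smul_eq_mul, mul_one]
    rw [h]
    exact hb _ _ _

/-- An `A`-linear map between modules over `A ⊗ D^β(k[G])` which commutes with the standard basis is
linear. -/
def linearMapOfBasis {P Q : Type*} [AddCommGroup P] [Module A P] [Module (TensorDouble A β) P]
    [IsScalarTower A (TensorDouble A β) P] [AddCommGroup Q] [Module A Q]
    [Module (TensorDouble A β) Q] [IsScalarTower A (TensorDouble A β) Q] (f : P →ₗ[A] Q)
    (hf : ∀ g x p, f (basis A β g x • p) = basis A β g x • f p) : P →ₗ[TensorDouble A β] Q where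
  toFun := f
  map_add' := f.map_add
  map_smul' d p := by
    rw [RingHom.id_apply]
    induction d using TensorDouble.induction with
    | h0 => rw [zero_smul, zero_smul, map_zero]
    | hadd d e h₁ h₂ => rw [add_smul, add_smul, map_add, h₁, h₂]
    | hb g x a => rw [smul_assoc, smul_assoc, map_smul, hf]

variable (A β) in
/-- The elements `1 ⊗ ⌊g|x⌋` form a basis over `A`. -/
def moduleBasis : Module.Basis (G × G) A (TensorDouble A β) :=
  Algebra.TensorProduct.basis A
    (⟨LinearEquiv.refl k (G × G →₀ k)⟩ : Module.Basis (G × G) k (Double β))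

lemma moduleBasis_apply (i : G × G) : moduleBasis A β i = basis A β i.1 i.2 :=
  Algebra.TensorProduct.basis_apply _ _

instance : Module.Finite A (TensorDouble A β) := Module.Finite.of_basis (moduleBasis A β)

instance : Module.Free A (TensorDouble A β) := Module.Free.of_basis (moduleBasis A β)

/-- A homomorphism of `A`-algebras out of `A ⊗ D^β(k[G])` is given by the images of the standard
basis. -/
def liftBasis {E : Type*} [Ring E] [Algebra A E] (ρ : G → G → E)
    (hmul : ∀ g x h y, x⁻¹ * g * x = h →
      ρ g x * ρ h y = unitScalar A (β.theta g x y) • ρ g (x * y))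
    (hne : ∀ g x h y, x⁻¹ * g * x ≠ h → ρ g x * ρ h y = 0)
    (hone : ∑ g, unitScalar A (β.theta g 1 1)⁻¹ • ρ g 1 = 1) : TensorDouble A β →ₐ[A] E :=
  have hb : ∀ g x, (moduleBasis A β).constr A (fun i => ρ i.1 i.2) (basis A β g x) = ρ g x :=
    fun g x => by
      rw [← moduleBasis_apply (g, x), Module.Basis.constr_basis]
  AlgHom.ofLinearMap ((moduleBasis A β).constr A fun i => ρ i.1 i.2)
    (by
      rw [← sum_idem, map_sum, ← hone]
      exact Finset.sum_congr rfl fun g _ => by rw [idem, map_smul, hb])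
    (fun d e => by
      induction d using TensorDouble.induction with
      | h0 => rw [zero_mul, map_zero, zero_mul]
      | hadd d e h₁ h₂ => rw [add_mul, map_add, map_add, h₁, h₂, add_mul]
      | hb g x a =>
        induction e using TensorDouble.induction with
        | h0 => rw [mul_zero, map_zero, mul_zero]
        | hadd d e h₁ h₂ => rw [mul_add, map_add, map_add, h₁, h₂, mul_add]
        | hb h y b =>
          rw [smul_mul_smul_comm, map_smul, map_smul, map_smul, smul_mul_smul_comm, hb, hb]
          by_cases hg : x⁻¹ * g * x = h
          · rw [basis_mul_basis hg, map_smul, hb, hmul _ _ _ _ hg]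
          · rw [basis_mul_basis_ne hg, map_zero, hne _ _ _ _ hg])

lemma liftBasis_basis {E : Type*} [Ring E] [Algebra A E] (ρ : G → G → E) (hmul) (hne) (hone)
    (g x : G) : liftBasis (β := β) ρ hmul hne hone (basis A β g x) = ρ g x := by
  rw [← moduleBasis_apply (g, x)]
  exact Module.Basis.constr_basis (moduleBasis A β) A (fun i => ρ i.1 i.2) (g, x)

section Module

variable {P : Type*} [AddCommGroup P] [Module (TensorDouble A β) P]

variable (A β) in
lemma eq_sum_idem_smul (p : P) : p = ∑ g : G, idem A β g • p := by
  rw [← Finset.sum_smul, sum_idem, one_smul]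

variable (A β) in
lemma eq_zero_of_idem_smul {p : P} (hp : ∀ g : G, idem A β g • p = 0) : p = 0 := by
  rw [eq_sum_idem_smul A β p, Finset.sum_eq_zero fun g _ => hp g]

end Module

end TensorDouble

/-! ### Components of modules over `A ⊗ D^β(k[G])` -/

section Component

variable {A : Type*} [CommRing A] {G : Type*} [Group G] [Fintype G] {k : Type*} [Field k]
  [Algebra k A] {β : Cocycle3 G k}

lemma centralizer_conj {G : Type*} [Group G] {g : G} (w : Subgroup.centralizer {g}) :
    (w : G)⁻¹ * g * w = g := by
  rw [mul_assoc, ← Subgroup.mem_centralizer_singleton_iff.1 w.2, inv_mul_cancel_left]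

open TensorDouble

variable (A β) in
/-- The (non-unital) embedding `A ⋊^{θ_g} Z(g) → A ⊗ D^β(k[G])`, `1_w ↦ ⌊g|w⌋`. -/
def crossedEmb (g : G) : Crossed A (β.thetaZ g) →ₗ[A] TensorDouble A β :=
  Crossed.linLift fun w => basis A β g w

lemma crossedEmb_of (g : G) (w : Subgroup.centralizer {g}) (a : A) :
    crossedEmb A β g (Crossed.of w a) = a • basis A β g w := Crossed.linLift_of _ _ _

lemma crossedEmb_one (g : G) : crossedEmb A β g 1 = idem A β g := by
  rw [Crossed.one_def, crossedEmb_of]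
  rfl

lemma crossedEmb_mul (g : G) (r s : Crossed A (β.thetaZ g)) :
    crossedEmb A β g (r * s) = crossedEmb A β g r * crossedEmb A β g s := by
  induction r using Crossed.induction with
  | h0 => rw [zero_mul, map_zero, zero_mul]
  | hadd f₁ f₂ h₁ h₂ => rw [add_mul, map_add, map_add, h₁, h₂, add_mul]
  | hof x a =>
    induction s using Crossed.induction with
    | h0 => rw [mul_zero, map_zero, mul_zero]
    | hadd f₁ f₂ h₁ h₂ => rw [mul_add, map_add, map_add, h₁, h₂, mul_add]
    | hof y b =>
      rw [Crossed.of_mul_of, crossedEmb_of, crossedEmb_of, crossedEmb_of, smul_mul_smul_comm,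
        basis_mul_basis (centralizer_conj x), smul_smul]
      rfl

lemma idem_mul_crossedEmb (g : G) (r : Crossed A (β.thetaZ g)) :
    idem A β g * crossedEmb A β g r = crossedEmb A β g r := by
  rw [← crossedEmb_one, ← crossedEmb_mul, one_mul]

variable (P : Type*) [AddCommGroup P] [Module A P] [Module (TensorDouble A β) P]
  [IsScalarTower A (TensorDouble A β) P]

variable (A β) in
/-- The component of a module over `A ⊗ D^β(k[G])` at `g ∈ G`: the image of the idempotent of
`g`. -/
def component (g : G) : Submodule A P where
  carrier := {p | idem A β g • p = p}
  zero_mem' := smul_zero _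
  add_mem' hp hq := (smul_add _ _ _).trans (congrArg₂ _ hp hq)
  smul_mem' a p hp := by
    change idem A β g • a • p = a • p
    rw [smul_algebra_smul_comm, hp]

variable {P}

lemma mem_component {g : G} {p : P} : p ∈ component A β P g ↔ idem A β g • p = p := Iff.rfl

lemma idem_smul_coe {g : G} (p : component A β P g) : idem A β g • (p : P) = p := p.2

lemma smul_mem_component {g : G} {d : TensorDouble A β} (hd : idem A β g * d = d) (p : P) :
    d • p ∈ component A β P g := by
  rw [mem_component, smul_smul, hd]

lemma basis_smul_mem (g x : G) (p : P) : basis A β g x • p ∈ component A β P g :=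
  smul_mem_component (idem_mul_basis g x) p

lemma idem_smul_mem (g : G) (p : P) : idem A β g • p ∈ component A β P g :=
  smul_mem_component (idem_mul_idem g) p

lemma basisInv_smul_mem {g x h : G} (hg : x⁻¹ * g * x = h) (p : P) :
    basisInv A β g x • p ∈ component A β P h :=
  smul_mem_component (idem_mul_basisInv hg) p

lemma basis_smul_coe_ne {g x h : G} (hg : x⁻¹ * g * x ≠ h) (p : component A β P h) :
    basis A β g x • (p : P) = 0 := by
  rw [← idem_smul_coe p, smul_smul, basis_mul_idem_ne hg, zero_smul]

/-- The embedding `crossedEmb` is not unital, but its value at `1` is `idem g`, which is the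
identity exactly on the component; hence the action is unital there. -/
instance (g : G) : Module (Crossed A (β.thetaZ g)) (component A β P g) where
  smul r p := ⟨crossedEmb A β g r • (p : P), smul_mem_component (idem_mul_crossedEmb g r) _⟩
  one_smul p := Subtype.ext (by
    change crossedEmb A β g 1 • (p : P) = p
    rw [crossedEmb_one, idem_smul_coe])
  mul_smul r s p := Subtype.ext (by
    change crossedEmb A β g (r * s) • (p : P) = crossedEmb A β g r • crossedEmb A β g s • (p : P)
    rw [crossedEmb_mul, mul_smul])
  smul_zero r := Subtype.ext (smul_zero (crossedEmb A β g r))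
  smul_add r p q := Subtype.ext (smul_add (crossedEmb A β g r) (p : P) q)
  add_smul r s p := Subtype.ext (by
    change crossedEmb A β g (r + s) • (p : P) =
      crossedEmb A β g r • (p : P) + crossedEmb A β g s • (p : P)
    rw [map_add, add_smul])
  zero_smul p := Subtype.ext (by
    change crossedEmb A β g 0 • (p : P) = 0
    rw [map_zero, zero_smul])

lemma coe_crossed_smul {g : G} (r : Crossed A (β.thetaZ g)) (p : component A β P g) :
    ((r • p : component A β P g) : P) = crossedEmb A β g r • (p : P) := rfl

instance (g : G) : IsScalarTower A (Crossed A (β.thetaZ g)) (component A β P g) where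
  smul_assoc a r p := Subtype.ext (by
    rw [coe_crossed_smul, map_smul, smul_assoc]
    rfl)

variable (P) in
/-- The `B^β`-module with components those of a module over `A ⊗ D^β(k[G])`. -/
def Restriction (A : Type*) [CommRing A] {G : Type*} [Group G] [Fintype G] {k : Type*} [Field k]
    [Algebra k A] (β : Cocycle3 G k) (rep : ConjClasses G → G)
    (P : Type*) [AddCommGroup P] [Module A P] [Module (TensorDouble A β) P]
    [IsScalarTower A (TensorDouble A β) P] : Type _ :=
  (c : ConjClasses G) → component A β P (rep c)

variable {rep : ConjClasses G → G}

instance : AddCommGroup (Restriction A β rep P) :=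
  inferInstanceAs (AddCommGroup ((c : ConjClasses G) → component A β P (rep c)))

instance : Module A (Restriction A β rep P) :=
  inferInstanceAs (Module A ((c : ConjClasses G) → component A β P (rep c)))

instance : Module (TwistedSum A β rep) (Restriction A β rep P) :=
  Pi.module' (f := fun c => Crossed A (β.thetaZ (rep c)))
    (g := fun c => component A β P (rep c))

lemma Restriction.smul_apply (b : TwistedSum A β rep) (p : Restriction A β rep P)
    (c : ConjClasses G) : (b • p) c = b c • p c := rfl

instance : IsScalarTower A (TwistedSum A β rep) (Restriction A β rep P) where
  smul_assoc a b p := funext fun c => smul_assoc a (b c) (p c)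

/-- The map on components induced by a linear map. -/
def componentMap {Q : Type*} [AddCommGroup Q] [Module A Q] [Module (TensorDouble A β) Q]
    [IsScalarTower A (TensorDouble A β) Q] (f : P →ₗ[TensorDouble A β] Q) (g : G) :
    component A β P g →ₗ[Crossed A (β.thetaZ g)] component A β Q g where
  toFun p := ⟨f p, by rw [mem_component, ← map_smul, idem_smul_coe]⟩
  map_add' p q := Subtype.ext (map_add f (p : P) q)
  map_smul' r p := Subtype.ext (map_smul f (crossedEmb A β g r) (p : P))

variable (rep) in
/-- The `B^β`-linear map induced by a linear map of modules over `A ⊗ D^β(k[G])`. -/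
def Restriction.map {Q : Type*} [AddCommGroup Q] [Module A Q] [Module (TensorDouble A β) Q]
    [IsScalarTower A (TensorDouble A β) Q] (f : P →ₗ[TensorDouble A β] Q) :
    Restriction A β rep P →ₗ[TwistedSum A β rep] Restriction A β rep Q where
  toFun p c := componentMap f (rep c) (p c)
  map_add' p q := funext fun c => map_add (componentMap f (rep c)) (p c) (q c)
  map_smul' b p := funext fun c => map_smul (componentMap f (rep c)) (b c) (p c)

lemma Restriction.coe_map_apply {Q : Type*} [AddCommGroup Q] [Module A Q]
    [Module (TensorDouble A β) Q] [IsScalarTower A (TensorDouble A β) Q]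
    (f : P →ₗ[TensorDouble A β] Q) (p : Restriction A β rep P) (c : ConjClasses G) :
    (Restriction.map rep f p c : Q) = f (p c) := rfl

/-- The linear equivalence of restrictions induced by a linear equivalence. -/
def Restriction.congr {Q : Type*} [AddCommGroup Q] [Module A Q]
    [Module (TensorDouble A β) Q] [IsScalarTower A (TensorDouble A β) Q]
    (f : P ≃ₗ[TensorDouble A β] Q) :
    Restriction A β rep P ≃ₗ[TwistedSum A β rep] Restriction A β rep Q :=
  LinearEquiv.ofLinearMap (Restriction.map rep f.toLinearMap)
    (Restriction.map rep f.symm.toLinearMap)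
    (LinearMap.ext fun q => funext fun c => Subtype.ext (f.apply_symm_apply (q c : Q)))
    (LinearMap.ext fun p => funext fun c => Subtype.ext (f.symm_apply_apply (p c : P)))

end Component

/-! ### Restriction is an equivalence of categories -/

section Conjugator

variable {G : Type*} [Group G] {rep : ConjClasses G → G}
  (hrep : ∀ c, ConjClasses.mk (rep c) = c)

include hrep in
lemma exists_conjugator (m : G) : ∃ x, x * rep (ConjClasses.mk m) * x⁻¹ = m :=
  isConj_iff.1 (ConjClasses.mk_eq_mk_iff_isConj.1 (hrep (ConjClasses.mk m)))

/-- An element which conjugates the representative of the class of `m` to `m`. -/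
def conjugator (m : G) : G := (exists_conjugator hrep m).choose

lemma conjugator_spec (m : G) :
    conjugator hrep m * rep (ConjClasses.mk m) * (conjugator hrep m)⁻¹ = m :=
  (exists_conjugator hrep m).choose_spec

lemma conjugator_spec' (m : G) :
    (conjugator hrep m)⁻¹ * m * conjugator hrep m = rep (ConjClasses.mk m) := by
  generalize hx : conjugator hrep m = x
  have h := conjugator_spec hrep m
  rw [hx] at h
  calc x⁻¹ * m * x = x⁻¹ * (x * rep (ConjClasses.mk m) * x⁻¹) * x := by rw [h]
    _ = _ := by group

include hrep in
lemma mk_conj_rep {c : ConjClasses G} {x m : G} (h : x⁻¹ * rep c * x = m) :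
    ConjClasses.mk m = c := by
  rw [← hrep c, ConjClasses.mk_eq_mk_iff_isConj, isConj_iff]
  exact ⟨x, by rw [← h]; group⟩

end Conjugator

/-! ### Elements of `B^β` supported at one conjugacy class -/

namespace TwistedSum

variable {A : Type*} [CommRing A] {G : Type*} [Group G] {k : Type*} [Field k]
  [Algebra k A] {β : Cocycle3 G k} {rep : ConjClasses G → G}

/-- An element of one summand of `B^β`. -/
def single (c : ConjClasses G) (r : Crossed A (β.thetaZ (rep c))) : TwistedSum A β rep :=
  open Classical in Pi.single c r

lemma single_same (c : ConjClasses G) (r : Crossed A (β.thetaZ (rep c))) :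
    (single c r : TwistedSum A β rep) c = r := by
  classical
  exact Pi.single_eq_same (M := fun c => Crossed A (β.thetaZ (rep c))) c r

lemma single_ne {c d : ConjClasses G} (h : d ≠ c) (r : Crossed A (β.thetaZ (rep c))) :
    (single c r : TwistedSum A β rep) d = 0 := by
  classical
  exact Pi.single_eq_of_ne (M := fun c => Crossed A (β.thetaZ (rep c))) h r

lemma single_ext {c : ConjClasses G} {b : TwistedSum A β rep} {r : Crossed A (β.thetaZ (rep c))}
    (h : b c = r) (h' : ∀ d, d ≠ c → b d = 0) : b = single c r := by
  funext d
  by_cases hd : d = c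
  · subst hd
    rw [h, single_same]
  · rw [h' d hd, single_ne hd]

lemma single_mul_single (c : ConjClasses G) (r s : Crossed A (β.thetaZ (rep c))) :
    (single c r * single c s : TwistedSum A β rep) = single c (r * s) :=
  single_ext (by rw [Pi.mul_apply, single_same, single_same])
    fun d hd => by rw [Pi.mul_apply, single_ne hd, zero_mul]

lemma mul_single_one (c : ConjClasses G) (b : TwistedSum A β rep) :
    b * single c 1 = single c (b c) :=
  single_ext (by rw [Pi.mul_apply, single_same, mul_one])
    fun d hd => by rw [Pi.mul_apply, single_ne hd, mul_zero]

lemma single_smul (c : ConjClasses G) (a : A) (r : Crossed A (β.thetaZ (rep c))) :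
    (single c (a • r) : TwistedSum A β rep) = a • single c r :=
  (single_ext (by rw [Pi.smul_apply, single_same])
    fun d hd => by rw [Pi.smul_apply, single_ne hd, smul_zero]).symm

lemma single_add (c : ConjClasses G) (r s : Crossed A (β.thetaZ (rep c))) :
    (single c (r + s) : TwistedSum A β rep) = single c r + single c s :=
  (single_ext (by rw [Pi.add_apply, single_same, single_same])
    fun d hd => by rw [Pi.add_apply, single_ne hd, single_ne hd, add_zero]).symm

lemma single_zero (c : ConjClasses G) : (single c 0 : TwistedSum A β rep) = 0 :=
  (single_ext rfl fun _ _ => rfl).symm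

lemma sum_single_one [Fintype (ConjClasses G)] :
    ∑ c, (single c 1 : TwistedSum A β rep) = 1 := by
  classical
  funext d
  rw [Finset.sum_apply, Finset.sum_eq_single d _ (by simp)]
  · exact single_same _ _
  · intro c _ hc
    exact single_ne hc.symm _

lemma single_one_mul_single_ne {c d : ConjClasses G} (h : c ≠ d)
    (r : Crossed A (β.thetaZ (rep d))) :
    (single c 1 * single d r : TwistedSum A β rep) = 0 := by
  funext e
  by_cases he : e = d
  · rw [Pi.mul_apply, single_ne (by rintro rfl; exact h he), zero_mul]
    rfl
  · rw [Pi.mul_apply, single_ne he, mul_zero]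
    rfl

end TwistedSum

/-! ### Restriction is fully faithful -/

section Full

open TensorDouble

variable {A : Type*} [CommRing A] {G : Type*} [Group G] [Fintype G] {k : Type*} [Field k]
  [Algebra k A] {β : Cocycle3 G k} {rep : ConjClasses G → G}
  (hrep : ∀ c, ConjClasses.mk (rep c) = c)
  {P : Type*} [AddCommGroup P] [Module A P] [Module (TensorDouble A β) P]
  [IsScalarTower A (TensorDouble A β) P]
  {Q : Type*} [AddCommGroup Q] [Module A Q] [Module (TensorDouble A β) Q]
  [IsScalarTower A (TensorDouble A β) Q]

/-- Every object is joined to a representative by an invertible arrow, so the arrows at the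
representatives recover each `idem g • p`, and hence `p`. -/
lemma eq_of_basis_rep_smul (A : Type*) [CommRing A] {G : Type*} [Group G] [Fintype G] {k : Type*}
    [Field k] [Algebra k A] (β : Cocycle3 G k) {rep : ConjClasses G → G}
    (hrep : ∀ c, ConjClasses.mk (rep c) = c) {P : Type*} [AddCommGroup P]
    [Module (TensorDouble A β) P] {p q : P}
    (h : ∀ c x, basis A β (rep c) x • p = basis A β (rep c) x • q) : p = q := by
  rw [← sub_eq_zero]
  refine eq_zero_of_idem_smul A β fun g => ?_
  have e : (conjugator hrep g)⁻¹⁻¹ * rep (ConjClasses.mk g) * (conjugator hrep g)⁻¹ = g := by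
    rw [inv_inv, conjugator_spec]
  rw [← basisInv_mul_basis e, mul_smul, smul_sub, h, sub_self, smul_zero]

open Classical in
/-- The inclusion of a component into the restriction. -/
def Restriction.single (c : ConjClasses G) :
    component A β P (rep c) →ₗ[A] Restriction A β rep P :=
  LinearMap.single A (fun c => component A β P (rep c)) c

open Classical in
lemma Restriction.single_eq (c : ConjClasses G) (p : component A β P (rep c)) :
    (Restriction.single c p : Restriction A β rep P) =
      Pi.single (M := fun c => component A β P (rep c)) c p := rfl

lemma Restriction.single_apply_same (c : ConjClasses G) (p : component A β P (rep c)) :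
    (Restriction.single c p : Restriction A β rep P) c = p := by
  classical
  rw [Restriction.single_eq, Pi.single_eq_same]

lemma Restriction.single_apply_ne {c d : ConjClasses G} (h : d ≠ c)
    (p : component A β P (rep c)) : (Restriction.single c p : Restriction A β rep P) d = 0 := by
  classical
  rw [Restriction.single_eq, Pi.single_eq_of_ne h]

lemma Restriction.single_smul (c : ConjClasses G) (r : Crossed A (β.thetaZ (rep c)))
    (p : Restriction A β rep P) :
    (TwistedSum.single c r : TwistedSum A β rep) • p = Restriction.single c (r • p c) := by
  funext d
  rw [Restriction.smul_apply]
  by_cases h : d = c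
  · subst h
    rw [TwistedSum.single_same, Restriction.single_apply_same]
  · rw [TwistedSum.single_ne h, Restriction.single_apply_ne h, zero_smul]

variable (φ : Restriction A β rep P →ₗ[TwistedSum A β rep] Restriction A β rep Q)

/-- The part of a map of restrictions at one conjugacy class, extended by zero. -/
def sectorPart (c : ConjClasses G) : P →ₗ[A] Q :=
  (component A β Q (rep c)).subtype ∘ₗ
    ({ toFun := fun p => φ p c
       map_add' := fun p q => congrFun (map_add φ p q) c
       map_smul' := fun a p => congrFun (map_smul (φ.restrictScalars A) a p) c } :
      Restriction A β rep P →ₗ[A] component A β Q (rep c)) ∘ₗ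
    Restriction.single c ∘ₗ
    (Algebra.lsmul A A P (idem A β (rep c))).codRestrict _ (fun p => idem_smul_mem (rep c) p)

lemma sectorPart_apply (c : ConjClasses G) (p : P) :
    sectorPart φ c p = φ (Restriction.single c ⟨idem A β (rep c) • p, idem_smul_mem _ p⟩) c := rfl

/-- On the component at `rep c` the arrow `⌊rep c|w⌋` acts as the element `1_w` of the summand of
`B^β` at `c`, and `φ` is linear over `B^β`. -/
lemma sectorPart_basis_smul (c : ConjClasses G) (w : Subgroup.centralizer {rep c}) (p : P) :
    sectorPart φ c (basis A β (rep c) w • p) = basis A β (rep c) w • sectorPart φ c p := by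
  have h : (Restriction.single c ⟨idem A β (rep c) • basis A β (rep c) w • p, idem_smul_mem _ _⟩ :
      Restriction A β rep P) = (TwistedSum.single c (Crossed.of w 1) : TwistedSum A β rep) •
        (Restriction.single c ⟨idem A β (rep c) • p, idem_smul_mem _ _⟩ :
          Restriction A β rep P) := by
    rw [Restriction.single_smul, Restriction.single_apply_same]
    congr 1
    refine Subtype.ext ?_
    change idem A β (rep c) • basis A β (rep c) w • p = crossedEmb A β (rep c) _ •
      idem A β (rep c) • p
    rw [crossedEmb_of, one_smul, smul_smul, smul_smul, idem_mul_basis,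
      basis_mul_idem (centralizer_conj w)]
  rw [sectorPart_apply, h, map_smul, Restriction.smul_apply, TwistedSum.single_same,
    coe_crossed_smul,
    crossedEmb_of, one_smul, sectorPart_apply]

/-- The map of modules over `A ⊗ D^β(k[G])` with a given restriction, as an `A`-linear map. -/
def extensionAux : P →ₗ[A] Q :=
  -- The part of an element at `g` is carried to the representative of the class of `g` by an
  -- inverse arrow, mapped there by `φ`, and carried back.
  ∑ g : G, Algebra.lsmul A A Q (basis A β g (conjugator hrep g)) ∘ₗ
    sectorPart φ (ConjClasses.mk g) ∘ₗ Algebra.lsmul A A P (basisInv A β g (conjugator hrep g))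

/-- Only the summand at `g = x⁻¹ (rep c) x` is composable with `⌊rep c|x⌋`. There `x` times the
chosen conjugator centralizes `rep c`, so the composite arrow commutes with `φ` by
`sectorPart_basis_smul`, and the scalars cancel. The right-hand side no longer involves the
conjugators, which is what yields linearity of `extension`. -/
lemma basis_smul_extensionAux (c : ConjClasses G) (x : G) (p : P) :
    basis A β (rep c) x • extensionAux hrep φ p = sectorPart φ c (basis A β (rep c) x • p) := by
  rw [extensionAux, LinearMap.sum_apply, Finset.smul_sum,
    Finset.sum_eq_single (x⁻¹ * rep c * x) _ (by simp)]
  · generalize hg : x⁻¹ * rep c * x = g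
    obtain rfl : ConjClasses.mk g = c := mk_conj_rep hrep hg
    change basis A β _ x • basis A β g _ • sectorPart φ _ (basisInv A β g _ • p) = _
    have hw : x * conjugator hrep g ∈ Subgroup.centralizer {rep (ConjClasses.mk g)} := by
      have h1 : rep (ConjClasses.mk g) * x = x * g := by
        calc _ = x * (x⁻¹ * rep (ConjClasses.mk g) * x) := by group
          _ = _ := by rw [hg]
      have h2 : conjugator hrep g * rep (ConjClasses.mk g) = g * conjugator hrep g := by
        rw [← conjugator_spec' hrep g]; group
      rw [Subgroup.mem_centralizer_singleton_iff, mul_assoc, h2, ← mul_assoc, ← h1, mul_assoc]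
    have h := sectorPart_basis_smul φ _ ⟨_, hw⟩ (basisInv A β g (conjugator hrep g) • p)
    rw [smul_smul, basis_mul_basis hg, smul_assoc, ← h, ← map_smul, ← smul_assoc,
      ← basis_mul_basis hg, mul_smul, ← mul_smul (basis A β g _), basis_mul_basisInv, smul_smul,
      basis_mul_idem hg]
  · intro g _ hg
    change basis A β _ x • basis A β g _ • sectorPart φ _ (basisInv A β g _ • p) = _
    rw [smul_smul, basis_mul_basis_ne (Ne.symm hg), zero_smul]

/-- The map of modules over `A ⊗ D^β(k[G])` with a given restriction. -/
def extension : P →ₗ[TensorDouble A β] Q :=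
  linearMapOfBasis (extensionAux hrep φ) fun h y p => by
    refine eq_of_basis_rep_smul A β hrep fun c x => ?_
    rw [basis_smul_extensionAux, smul_smul, smul_smul]
    by_cases hg : x⁻¹ * rep c * x = h
    · rw [basis_mul_basis hg, smul_assoc, smul_assoc, map_smul, basis_smul_extensionAux]
    · rw [basis_mul_basis_ne hg, zero_smul, zero_smul, map_zero]

/-- The case `x = 1` of `basis_smul_extensionAux`, after cancelling `θ(1,1)`; on an element of the
component at `rep c` the idempotents involved do nothing. -/
lemma map_extension : Restriction.map rep (extension hrep φ) = φ := by
  refine LinearMap.ext fun p => funext fun c => Subtype.ext ?_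
  have h1 : idem A β (rep c) • extension hrep φ (p c) = sectorPart φ c (p c) := by
    have h := basis_smul_extensionAux hrep φ c 1 (p c)
    rw [basis_one, smul_assoc, smul_assoc, map_smul, idem_smul_coe] at h
    rw [← unitScalar_inv_smul_smul (A := A) (β.theta (rep c) 1 1) (sectorPart φ c (p c)), ← h,
      unitScalar_inv_smul_smul]
    rfl
  have h2 : (Restriction.single c ⟨idem A β (rep c) • (p c : P), idem_smul_mem _ _⟩ :
      Restriction A β rep P) = (TwistedSum.single c 1 : TwistedSum A β rep) • p := by
    rw [Restriction.single_smul, one_smul]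
    congr 1
    exact Subtype.ext (idem_smul_coe _)
  rw [Restriction.coe_map_apply, ← idem_smul_coe (p c), map_smul, h1, sectorPart_apply, h2,
    map_smul, Restriction.smul_apply, TwistedSum.single_same, one_smul]

-- For each `c` and `x` the vector `⌊rep c|x⌋ p` lies in the component at `rep c`, where the two
-- maps agree; `eq_of_basis_rep_smul` then separates points.
include hrep in
lemma Restriction.map_injective {f f' : P →ₗ[TensorDouble A β] Q}
    (h : Restriction.map rep f = Restriction.map rep f') : f = f' := by
  refine LinearMap.ext fun p => eq_of_basis_rep_smul A β hrep fun c x => ?_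
  have h1 := congrArg (fun q : Restriction A β rep Q => (q c : Q))
    (LinearMap.congr_fun h (Restriction.single c ⟨_, basis_smul_mem (rep c) x p⟩))
  simp only [Restriction.coe_map_apply, Restriction.single_apply_same] at h1
  rw [← map_smul, ← map_smul, h1]

end Full

/-! ### Coinduction of `B^β`-modules -/

section Coinduced

open TensorDouble

variable {A : Type*} [CommRing A] {G : Type*} [Group G] [Fintype G] {k : Type*} [Field k]
  [Algebra k A] {β : Cocycle3 G k} {rep : ConjClasses G → G}

/-- The functions on `ConjClasses G × G`, a module over `A ⊗ D^β(k[G])`. -/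
def FunctionModule (A : Type*) [CommRing A] {G : Type*} [Group G] {k : Type*} [Field k]
    (_β : Cocycle3 G k) (_rep : ConjClasses G → G) (M : Type*) [AddCommGroup M] [Module A M] :
    Type _ := ConjClasses G → G → M

variable {M : Type*} [AddCommGroup M] [Module A M]

instance : AddCommGroup (FunctionModule A β rep M) :=
  inferInstanceAs (AddCommGroup (ConjClasses G → G → M))

instance : Module A (FunctionModule A β rep M) :=
  inferInstanceAs (Module A (ConjClasses G → G → M))

open Classical in
variable (A β rep M) in
/-- The action of `⌊g|y⌋` on functions. -/
def functionOp (g y : G) : Module.End A (FunctionModule A β rep M) where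
  -- The value of `f` at `(c, x)` plays the role of `⌊rep c|x⌋` applied to an element, so the
  -- formula copies the product `⌊rep c|x⌋ ⌊g|y⌋`.
  toFun f c x := if x⁻¹ * rep c * x = g then unitScalar A (β.theta (rep c) x y) • f c (x * y) else 0
  map_add' f f' := funext fun c => funext fun x => by
    change (if _ then _ • (f c (x * y) + f' c (x * y)) else 0) = ite _ _ _ + ite _ _ _
    split_ifs
    · rw [smul_add]
    · rw [add_zero]
  map_smul' a f := funext fun c => funext fun x => by
    change (if _ then _ • (a • f c (x * y)) else 0) = a • ite _ _ _
    split_ifs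
    · rw [smul_comm]
    · rw [smul_zero]

omit [Fintype G] in
lemma functionOp_apply {c : ConjClasses G} {x g : G} (h : x⁻¹ * rep c * x = g) (y : G)
    (f : FunctionModule A β rep M) :
    functionOp A β rep M g y f c x = unitScalar A (β.theta (rep c) x y) • f c (x * y) := if_pos h

omit [Fintype G] in
lemma functionOp_apply_ne {c : ConjClasses G} {x g : G} (h : x⁻¹ * rep c * x ≠ g) (y : G)
    (f : FunctionModule A β rep M) : functionOp A β rep M g y f c x = 0 := if_neg h

variable (A β rep M) in
/-- The action of `A ⊗ D^β(k[G])` on functions. -/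
def functionAction : TensorDouble A β →ₐ[A] Module.End A (FunctionModule A β rep M) :=
  liftBasis (functionOp A β rep M)
    (fun g x h y hg => LinearMap.ext fun f => funext fun c => funext fun z => by
      change functionOp A β rep M g x (functionOp A β rep M h y f) c z =
        unitScalar A (β.theta g x y) • functionOp A β rep M g (x * y) f c z
      by_cases hz : z⁻¹ * rep c * z = g
      · have h1 : (z * x)⁻¹ * rep c * (z * x) = h := by rw [← hg, ← hz]; group
        have h2 := β.theta_mul (rep c) z x y
        rw [hz] at h2
        rw [functionOp_apply hz, functionOp_apply h1, functionOp_apply hz, smul_smul, smul_smul,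
          ← map_mul, ← map_mul, h2, mul_assoc, mul_comm (β.theta g x y)]
      · rw [functionOp_apply_ne hz, functionOp_apply_ne hz, smul_zero])
    (fun g x h y hg => LinearMap.ext fun f => funext fun c => funext fun z => by
      change functionOp A β rep M g x (functionOp A β rep M h y f) c z = 0
      by_cases hz : z⁻¹ * rep c * z = g
      · have h1 : (z * x)⁻¹ * rep c * (z * x) ≠ h := by
          intro e
          apply hg
          rw [← e, ← hz]
          group
        rw [functionOp_apply hz, functionOp_apply_ne h1, smul_zero]
      · rw [functionOp_apply_ne hz])
    (LinearMap.ext fun f => funext fun c => funext fun z => by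
      rw [LinearMap.sum_apply]
      change (∑ g : G, fun c z => unitScalar A (β.theta g 1 1)⁻¹ • functionOp A β rep M g 1 f c z)
        c z = f c z
      rw [Finset.sum_apply, Finset.sum_apply, Finset.sum_eq_single (z⁻¹ * rep c * z) _ (by simp)]
      · rw [functionOp_apply rfl, β.theta_one_right (rep c) z, unitScalar_inv_smul_smul, mul_one]
      · intro g _ hg
        rw [functionOp_apply_ne (Ne.symm hg), smul_zero])

instance : Module (TensorDouble A β) (FunctionModule A β rep M) :=
  Module.compHom _ (functionAction A β rep M).toRingHom

lemma functionModule_smul (d : TensorDouble A β) (f : FunctionModule A β rep M) :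
    d • f = functionAction A β rep M d f := rfl

lemma functionModule_basis_smul (g y : G) (f : FunctionModule A β rep M) :
    basis A β g y • f = functionOp A β rep M g y f := by
  rw [functionModule_smul, functionAction, liftBasis_basis]

instance : IsScalarTower A (TensorDouble A β) (FunctionModule A β rep M) where
  smul_assoc a d f := by
    rw [functionModule_smul, functionModule_smul, map_smul]
    rfl

end Coinduced

section Coinduced

open TensorDouble

variable {A : Type*} [CommRing A] {G : Type*} [Group G] [Fintype G] {k : Type*} [Field k]
  [Algebra k A] {β : Cocycle3 G k} {rep : ConjClasses G → G}
  {M : Type*} [AddCommGroup M] [Module A M]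
  [Module (TwistedSum A β rep) M] [IsScalarTower A (TwistedSum A β rep) M]

variable (A β rep M) in
/-- The equivariant functions on `ConjClasses G × G`. -/
def coinduced : Submodule (TensorDouble A β) (FunctionModule A β rep M) where
  -- The condition copies `⌊rep c|w⌋ ⌊rep c|x⌋ = θ(w,x) ⌊rep c|wx⌋`. The case `w = 1` also forces
  -- the values at `c` into the summand of `M` at `c`, so the functions may take values in all of
  -- `M`.
  carrier := {f | ∀ c (w : Subgroup.centralizer {rep c}) x,
    unitScalar A (β.theta (rep c) w x) • f c (w * x) =
      (TwistedSum.single c (Crossed.of w 1) : TwistedSum A β rep) • f c x}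
  zero_mem' c w x := by
    change unitScalar A _ • (0 : M) = _ • (0 : M)
    rw [smul_zero, smul_zero]
  add_mem' {f f'} hf hf' c w x := by
    change unitScalar A _ • (f c (w * x) + f' c (w * x)) = _ • (f c x + f' c x)
    rw [smul_add, smul_add, hf, hf']
  smul_mem' d f hf := by
    induction d using TensorDouble.induction with
    | h0 =>
      intro c w x
      rw [zero_smul]
      change unitScalar A _ • (0 : M) = _ • (0 : M)
      rw [smul_zero, smul_zero]
    | hadd d e h₁ h₂ =>
      intro c w x
      rw [add_smul]
      change unitScalar A _ • ((d • f) c (w * x) + (e • f) c (w * x)) =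
        _ • ((d • f) c x + (e • f) c x)
      rw [smul_add, smul_add, h₁, h₂]
    | hb g y a =>
      intro c w x
      rw [smul_assoc, functionModule_basis_smul]
      change unitScalar A _ • a • functionOp A β rep M g y f c (w * x) =
        _ • a • functionOp A β rep M g y f c x
      have hw : (w * x)⁻¹ * rep c * (w * x) = x⁻¹ * rep c * x := by
        calc _ = x⁻¹ * ((w : G)⁻¹ * rep c * w) * x := by group
          _ = _ := by rw [centralizer_conj w]
      by_cases hx : x⁻¹ * rep c * x = g
      -- Translation by `w` on the left and by `y` on the right commute up to exactly this cocycle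
      -- identity, in which `w⁻¹ (rep c) w = rep c`.
      · have h2 := β.theta_mul (rep c) w x y
        rw [centralizer_conj w] at h2
        have h3 := hf c w (x * y)
        have h4 : ∀ (b : TwistedSum A β rep) (u : A) (m : M), b • a • u • m = a • u • b • m :=
          fun b u m => by rw [smul_algebra_smul_comm, smul_algebra_smul_comm]
        have h5 : ∀ (u v : A) (m : M), u • a • v • m = a • (u * v) • m :=
          fun u v m => by rw [smul_comm u a, smul_smul u v]
        rw [functionOp_apply (hw.trans hx), functionOp_apply hx]
        refine (h5 _ _ _).trans (Eq.trans ?_ (h4 _ _ _).symm)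
        refine Eq.trans ?_ (congrArg (fun m => a • unitScalar A (β.theta (rep c) x y) • m) h3)
        rw [smul_smul (unitScalar A _) (unitScalar A _), ← map_mul, ← map_mul, h2,
          mul_comm (β.theta _ w _), mul_assoc]
      · rw [functionOp_apply_ne (hw.trans_ne hx), functionOp_apply_ne hx]
        have h4 : ∀ b : TwistedSum A β rep, b • a • (0 : M) = 0 := fun b => by
          rw [smul_zero, smul_zero]
        exact (by rw [smul_zero, smul_zero] : _ • a • (0 : M) = 0).trans (h4 _).symm

end Coinduced

section Coinduced

open TensorDouble

variable {A : Type*} [CommRing A] {G : Type*} [Group G] [Fintype G] {k : Type*} [Field k]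
  [Algebra k A] {β : Cocycle3 G k} {rep : ConjClasses G → G}
  {M : Type*} [AddCommGroup M] [Module A M]
  [Module (TwistedSum A β rep) M] [IsScalarTower A (TwistedSum A β rep) M]

/-- The value of an equivariant function. -/
def coinducedEval (c : ConjClasses G) (x : G) : coinduced A β rep M →ₗ[A] M where
  toFun f := f.1 c x
  map_add' _ _ := rfl
  map_smul' _ _ := rfl

lemma coinducedEval_centralizer (f : coinduced A β rep M) (c : ConjClasses G)
    (w : Subgroup.centralizer {rep c}) :
    unitScalar A (β.theta (rep c) 1 1) • coinducedEval c w f =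
      (TwistedSum.single c (Crossed.of w 1) : TwistedSum A β rep) • coinducedEval c 1 f := by
  have h := f.2 c w 1
  rw [β.theta_one_right (rep c) w, centralizer_conj w, mul_one] at h
  exact h

/-- Equivariance for `w = 1`: the value at `(c, 1)` lies in the summand of `M` at `c`. -/
lemma coinducedEval_one (f : coinduced A β rep M) (c : ConjClasses G) :
    (TwistedSum.single c 1 : TwistedSum A β rep) • coinducedEval c 1 f = coinducedEval c 1 f := by
  have h := coinducedEval_centralizer f c 1
  rw [Crossed.one_def, ← unitScalar_apply, ← mul_one (unitScalar A _), ← smul_eq_mul,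
    ← Crossed.smul_of, TwistedSum.single_smul, smul_assoc]
  refine (congrArg (fun m : M => unitScalar A (β.theta (rep c) 1 1)⁻¹ • m) h.symm).trans ?_
  exact unitScalar_inv_smul_smul _ _

lemma coinducedEval_basis_smul {c : ConjClasses G} {g x : G} (h : x⁻¹ * rep c * x = g) (y : G)
    (f : coinduced A β rep M) : coinducedEval c x (basis A β g y • f) =
      unitScalar A (β.theta (rep c) x y) • coinducedEval c (x * y) f := by
  change (basis A β g y • f.1) c x = _
  rw [functionModule_basis_smul]
  exact functionOp_apply h y f.1

lemma coinducedEval_basis_smul_ne {c : ConjClasses G} {g x : G} (h : x⁻¹ * rep c * x ≠ g) (y : G)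
    (f : coinduced A β rep M) : coinducedEval c x (basis A β g y • f) = 0 := by
  change (basis A β g y • f.1) c x = _
  rw [functionModule_basis_smul]
  exact functionOp_apply_ne h y f.1

lemma coinducedEval_crossedEmb_smul (f : coinduced A β rep M) (c : ConjClasses G)
    (r : Crossed A (β.thetaZ (rep c))) : coinducedEval c 1 (crossedEmb A β (rep c) r • f) =
      (TwistedSum.single c r : TwistedSum A β rep) • coinducedEval c 1 f := by
  induction r using Crossed.induction with
  | h0 => rw [map_zero, zero_smul, map_zero, TwistedSum.single_zero, zero_smul]
  | hadd r s h₁ h₂ => rw [map_add, add_smul, map_add, h₁, h₂, TwistedSum.single_add, add_smul]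
  | hof w a =>
    rw [crossedEmb_of, smul_assoc, map_smul, coinducedEval_basis_smul (by group),
      β.theta_one_left (rep c) w, one_mul, coinducedEval_centralizer, ← smul_assoc,
      ← TwistedSum.single_smul, Crossed.smul_of, smul_eq_mul, mul_one]

/-- The idempotent of `rep c` acts on functions as multiplication by the indicator of the set `x⁻¹
(rep d) x = rep c`. -/
lemma coinducedEval_component_ne {c : ConjClasses G}
    (f : component A β (coinduced A β rep M) (rep c))
    {d : ConjClasses G} {x : G} (h : x⁻¹ * rep d * x ≠ rep c) :
    coinducedEval d x (f : coinduced A β rep M) = 0 := by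
  rw [← idem_smul_coe f, idem, smul_assoc, map_smul, coinducedEval_basis_smul_ne h, smul_zero]

open Classical in
/-- The equivariant function with a given value at one point. -/
def coinducedSingle (c : ConjClasses G) (m : M) : FunctionModule A β rep M := fun d x =>
  if h : d = c ∧ x ∈ Subgroup.centralizer {rep c} then
    -- This value is forced by `coinducedEval_centralizer`; the scalar makes the value at `x = 1`
    -- the summand of `m` at `c`.
    unitScalar A (β.theta (rep c) 1 1)⁻¹ •
      (TwistedSum.single c (Crossed.of ⟨x, h.2⟩ 1) : TwistedSum A β rep) • m
  else 0

omit [IsScalarTower A (TwistedSum A β rep) M] in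
lemma coinducedSingle_apply (c : ConjClasses G) (w : Subgroup.centralizer {rep c}) (m : M) :
    (coinducedSingle c m : FunctionModule A β rep M) c w =
    unitScalar A (β.theta (rep c) 1 1)⁻¹ •
      (TwistedSum.single c (Crossed.of w 1) : TwistedSum A β rep) • m := dif_pos ⟨rfl, w.2⟩

omit [IsScalarTower A (TwistedSum A β rep) M] in
lemma coinducedSingle_apply_ne {c d : ConjClasses G} {x : G}
    (h : ¬(d = c ∧ x ∈ Subgroup.centralizer {rep c})) (m : M) :
    (coinducedSingle c m : FunctionModule A β rep M) d x = 0 := dif_neg h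

/-- Left multiplication by `Z(rep c)` preserves the support, and on the support the condition is the
product `1_w 1_x` in the crossed product. -/
lemma coinducedSingle_mem (c : ConjClasses G) (m : M) :
    (coinducedSingle c m : FunctionModule A β rep M) ∈ coinduced A β rep M := by
  intro d w x
  by_cases h : d = c ∧ x ∈ Subgroup.centralizer {rep c}
  · obtain ⟨rfl, hx⟩ := h
    refine (congrArg (fun m : M => unitScalar A (β.theta (rep d) w x) • m)
      (coinducedSingle_apply (A := A) (β := β) d (w * ⟨x, hx⟩) m)).trans
      (Eq.trans ?_ (congrArg (fun m : M => (TwistedSum.single d (Crossed.of w 1) :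
        TwistedSum A β rep) • m) (coinducedSingle_apply (A := A) (β := β) d ⟨x, hx⟩ m)).symm)
    rw [smul_algebra_smul_comm _ (TwistedSum.single d _), smul_smul (TwistedSum.single d _),
      TwistedSum.single_mul_single, Crossed.of_mul_of, smul_comm (unitScalar A _) (unitScalar A _),
      ← smul_assoc (unitScalar A _) (TwistedSum.single d _), ← TwistedSum.single_smul,
      Crossed.smul_of]
    congr 4
    rw [mul_one, one_mul, smul_eq_mul, mul_one]
    rfl
  · have h' : ¬(d = c ∧ (w * x : G) ∈ Subgroup.centralizer {rep c}) := by
      rintro ⟨rfl, hx⟩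
      exact h ⟨rfl, by simpa using mul_mem (inv_mem w.2) hx⟩
    rw [coinducedSingle_apply_ne (A := A) (β := β) h, coinducedSingle_apply_ne (A := A) (β := β) h']
    exact (smul_zero _).trans (smul_zero _).symm

lemma coinducedSingle_mem_component (c : ConjClasses G) (m : M) :
    (⟨coinducedSingle c m, coinducedSingle_mem c m⟩ : coinduced A β rep M) ∈
      component A β (coinduced A β rep M) (rep c) := by
  rw [mem_component]
  refine Subtype.ext (funext fun d => funext fun x => ?_)
  change coinducedEval d x (idem A β (rep c) • (⟨coinducedSingle c m, coinducedSingle_mem c m⟩ :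
    coinduced A β rep M)) = coinducedSingle c m d x
  rw [idem, smul_assoc, map_smul]
  by_cases hx : x⁻¹ * rep d * x = rep c
  · rw [coinducedEval_basis_smul hx, β.theta_one_right (rep d) x, hx, unitScalar_inv_smul_smul,
      mul_one]
    rfl
  · rw [coinducedEval_basis_smul_ne hx, smul_zero]
    refine (coinducedSingle_apply_ne ?_ m).symm
    rintro ⟨rfl, h⟩
    exact hx (centralizer_conj ⟨x, h⟩)

variable [Fintype (ConjClasses G)]

/-- The map from the restriction of the coinduced module. -/
def coinducedRestriction :
    Restriction A β rep (coinduced A β rep M) →ₗ[TwistedSum A β rep] M where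
  toFun f := ∑ c, coinducedEval c 1 (f c : coinduced A β rep M)
  map_add' f f' := by
    rw [← Finset.sum_add_distrib]
    exact Finset.sum_congr rfl fun c _ => map_add (coinducedEval c 1) (f c).1 (f' c).1
  map_smul' b f := by
    rw [RingHom.id_apply, Finset.smul_sum]
    refine Finset.sum_congr rfl fun c _ => ?_
    rw [Restriction.smul_apply, coe_crossed_smul, coinducedEval_crossedEmb_smul,
      ← TwistedSum.mul_single_one, mul_smul, coinducedEval_one]

lemma coinducedRestriction_apply (f : Restriction A β rep (coinduced A β rep M)) :
    coinducedRestriction f = ∑ c, coinducedEval c 1 (f c : coinduced A β rep M) := rfl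

/-- The idempotents of `B^β` separate the summands, so all values at `(c, 1)` vanish. A function in
the component of `rep c` is supported on pairs `(c, x)` with `x ∈ Z(rep c)`, because distinct
representatives are not conjugate, and there equivariance determines it by its value at `x = 1`. -/
lemma coinducedRestriction_injective (hrep : ∀ c, ConjClasses.mk (rep c) = c) :
    Function.Injective (coinducedRestriction :
      Restriction A β rep (coinduced A β rep M) →ₗ[TwistedSum A β rep] M) := by
  rw [injective_iff_map_eq_zero]
  intro f hf
  have h1 : ∀ c, coinducedEval c 1 (f c : coinduced A β rep M) = 0 := fun c => by
    have h := congrArg (fun m => (TwistedSum.single c 1 : TwistedSum A β rep) • m) hf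
    simp only [coinducedRestriction_apply, smul_zero, Finset.smul_sum] at h
    rwa [Finset.sum_eq_single c _ (by simp), coinducedEval_one] at h
    intro d _ hd
    rw [← coinducedEval_one, smul_smul, TwistedSum.single_one_mul_single_ne hd.symm, zero_smul]
  refine funext fun c => Subtype.ext (Subtype.ext (funext fun d => funext fun x => ?_))
  change coinducedEval d x (f c : coinduced A β rep M) = 0
  by_cases hx : x⁻¹ * rep d * x = rep c
  · obtain rfl : c = d := by rw [← mk_conj_rep hrep hx, hrep]
    have hw : x ∈ Subgroup.centralizer {rep c} := by
      rw [Subgroup.mem_centralizer_singleton_iff]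
      nth_rw 1 [← hx]
      group
    have h := coinducedEval_centralizer (f c : coinduced A β rep M) c ⟨x, hw⟩
    rw [h1, smul_zero] at h
    rw [← unitScalar_inv_smul_smul (A := A) (β.theta (rep c) 1 1) (coinducedEval c x _), h,
      smul_zero]
  · exact coinducedEval_component_ne (f c) hx

lemma coinducedRestriction_surjective :
    Function.Surjective (coinducedRestriction :
      Restriction A β rep (coinduced A β rep M) →ₗ[TwistedSum A β rep] M) := by
  intro m
  refine ⟨fun c => ⟨_, coinducedSingle_mem_component c m⟩,
    (coinducedRestriction_apply _).trans ?_⟩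
  -- The function built for `c` takes at `(c, 1)` the value of the `c`-th idempotent on `m`, and
  -- these idempotents sum to `1`.
  have hm : ∑ c, (TwistedSum.single c 1 : TwistedSum A β rep) • m = m := by
    rw [← Finset.sum_smul, TwistedSum.sum_single_one, one_smul]
  refine Eq.trans ?_ hm
  refine Finset.sum_congr rfl fun c _ => ?_
  refine (coinducedSingle_apply c 1 m).trans ?_
  rw [← smul_assoc, ← TwistedSum.single_smul, Crossed.smul_of, smul_eq_mul, mul_one]
  rfl

/-- The restriction of the coinduced module is the module itself. -/
def coinducedRestrictionEquiv (hrep : ∀ c, ConjClasses.mk (rep c) = c) :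
    Restriction A β rep (coinduced A β rep M) ≃ₗ[TwistedSum A β rep] M :=
  LinearEquiv.ofBijective coinducedRestriction
    ⟨coinducedRestriction_injective hrep, coinducedRestriction_surjective⟩

end Coinduced

/-! ### The Morita equivalence -/

section Morita

open CategoryTheory

universe w

variable {A : Type u} [CommRing A] {G : Type v} [Group G] [Fintype G] {k : Type w} [Field k]
  [Algebra k A] {β : Cocycle3 G k} {rep : ConjClasses G → G}

variable (A β rep) in
/-- Restriction, as a functor. -/
def restrictionFunctor :
    ModuleCat.{max u v w} (TensorDouble A β) ⥤ ModuleCat.{max u v w} (TwistedSum A β rep) where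
  obj P := ModuleCat.of _ (Restriction A β rep P)
  map f := ModuleCat.ofHom (Restriction.map rep f.hom)

instance : (restrictionFunctor A β rep).Additive where

instance : (restrictionFunctor A β rep).Linear k where
  map_smul {P Q} f a := by
    ext p
    refine funext fun c => Subtype.ext ?_
    change algebraMap k (TensorDouble A β) a • f.hom (p c : P) =
      crossedEmb A β (rep c) (algebraMap k (TwistedSum A β rep) a c) • f.hom (p c : P)
    -- Scalars act through the two algebras separately; on the component at `rep c` the scalar from
    -- `B^β` becomes a multiple of `idem (rep c)`, which acts there as that scalar.
    have h : algebraMap k (TwistedSum A β rep) a c = algebraMap k A a • 1 := by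
      rw [Pi.algebraMap_apply, Algebra.algebraMap_eq_smul_one, algebraMap_smul]
    rw [h, map_smul, crossedEmb_one, smul_assoc, ← map_smul f.hom (TensorDouble.idem A β (rep c)),
      idem_smul_coe, IsScalarTower.algebraMap_apply k A (TensorDouble A β), algebraMap_smul]

/-- The restriction of a module which is isomorphic to an object of the module category. -/
def restrictionFunctorObjEquiv {N : ModuleCat.{max u v w} (TensorDouble A β)}
    {P : Type (max u v w)} [AddCommGroup P] [Module A P] [Module (TensorDouble A β) P]
    [IsScalarTower A (TensorDouble A β) P] (f : N ≃ₗ[TensorDouble A β] P) :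
    (restrictionFunctor A β rep).obj N ≃ₗ[TwistedSum A β rep] Restriction A β rep P :=
  Restriction.congr (P := N) f

lemma restrictionFunctor_isEquivalence (hrep : ∀ c, ConjClasses.mk (rep c) = c) :
    (restrictionFunctor A β rep).IsEquivalence where
  faithful := ⟨fun {P Q f f'} h => ModuleCat.hom_ext
    (Restriction.map_injective hrep (congrArg ModuleCat.Hom.hom h))⟩
  full := ⟨fun {P Q} φ => ⟨ModuleCat.ofHom (extension hrep φ.hom),
    ModuleCat.hom_ext (map_extension hrep φ.hom)⟩⟩
  essSurj := ⟨fun M => by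
    have : Fintype (ConjClasses G) := Fintype.ofFinite _
    exact ⟨ModuleCat.of _ (coinduced A β rep M),
      ⟨((restrictionFunctorObjEquiv (LinearEquiv.refl _ (coinduced A β rep M))).trans
        (coinducedRestrictionEquiv (A := A) (β := β) (M := M) hrep)).toModuleIso⟩⟩⟩

/-- The Morita equivalence of `B^β` and `A ⊗ D^β(k[G])`. -/
def moritaEquivalence (A : Type u) [CommRing A] {G : Type v} [Group G] [Fintype G] {k : Type w}
    [Field k] [Algebra k A] (β : Cocycle3 G k) {rep : ConjClasses G → G}
    (hrep : ∀ c, ConjClasses.mk (rep c) = c) :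
    MoritaEquivalence k (TwistedSum A β rep) (TensorDouble A β) :=
  haveI := restrictionFunctor_isEquivalence (A := A) (β := β) hrep
  haveI : (restrictionFunctor A β rep).asEquivalence.functor.Linear k :=
    inferInstanceAs ((restrictionFunctor A β rep).Linear k)
  { eqv := (restrictionFunctor A β rep).asEquivalence.symm
    linear := (restrictionFunctor A β rep).asEquivalence.inverseLinear k }

end Morita

/-! ### Finiteness and projectivity -/

section Finite

open TensorDouble

variable {A : Type*} [CommRing A] {G : Type*} [Group G] [Fintype G] {k : Type*} [Field k]
  [Algebra k A] {β : Cocycle3 G k} {rep : ConjClasses G → G}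
  (hrep : ∀ c, ConjClasses.mk (rep c) = c)
  (P : Type*) [AddCommGroup P] [Module A P] [Module (TensorDouble A β) P]
  [IsScalarTower A (TensorDouble A β) P]

instance {H : Type*} [Group H] [Finite H] (α : Cocycle2 H k) : Module.Finite A (Crossed A α) :=
  inferInstanceAs (Module.Finite A (H →₀ A))

instance : Module.Finite A (TwistedSum A β rep) := Module.Finite.pi

/-- Finite generation may be tested over `A`, over which both algebras are finite, and each
component is the image of `P` under an idempotent. -/
lemma Restriction.finite [Module.Finite (TensorDouble A β) P] :
    Module.Finite (TwistedSum A β rep) (Restriction A β rep P) := by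
  have h1 : Module.Finite A P := Module.Finite.trans (TensorDouble A β) P
  have h2 : ∀ g, Module.Finite A (component A β P g) := fun g =>
    Module.Finite.of_surjective
      ((Algebra.lsmul A A P (idem A β g)).codRestrict (component A β P g) (idem_smul_mem g))
      fun p => ⟨p, Subtype.ext (idem_smul_coe p)⟩
  have h3 : Module.Finite A (∀ c, component A β P (rep c)) := Module.Finite.pi
  have h4 : Module.Finite A (Restriction A β rep P) := h3
  exact Module.Finite.of_restrictScalars_finite A _ _

-- Over `A`, the module `P` is a quotient of finitely many copies of the components at
-- representatives: the part at `g` is reached from the representative of its class by one arrow.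
include hrep in
lemma Restriction.finite_of_finite [Module.Finite (TwistedSum A β rep) (Restriction A β rep P)] :
    Module.Finite (TensorDouble A β) P := by
  have h1 : Module.Finite A (Restriction A β rep P) :=
    Module.Finite.trans (TwistedSum A β rep) _
  have h1' : Module.Finite A (∀ c, component A β P (rep c)) := h1
  have h2 : ∀ c, Module.Finite A (component A β P (rep c)) := fun c =>
    Module.Finite.of_surjective
      (LinearMap.proj c : (∀ c, component A β P (rep c)) →ₗ[A] component A β P (rep c))
      (fun p => ⟨Restriction.single c p, Restriction.single_apply_same c p⟩)
  let f : (∀ g : G, component A β P (rep (ConjClasses.mk g))) →ₗ[A] P :=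
    ∑ g, Algebra.lsmul A A P (basis A β g (conjugator hrep g)) ∘ₗ
      (component A β P (rep (ConjClasses.mk g))).subtype ∘ₗ LinearMap.proj g
  have h3 : Module.Finite A P := Module.Finite.of_surjective f fun p =>
    ⟨fun g => ⟨basisInv A β g (conjugator hrep g) • p,
      basisInv_smul_mem (conjugator_spec' hrep g) p⟩, by
      rw [LinearMap.sum_apply]
      change ∑ g, basis A β g _ • basisInv A β g _ • p = p
      simp only [smul_smul, basis_mul_basisInv]
      exact (eq_sum_idem_smul A β p).symm⟩
  exact Module.Finite.of_restrictScalars_finite A _ _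

end Finite

/-! ### Projectivity over `A ⊗ D^β(k[G])` by averaging over arrows -/

section Separable

open TensorDouble

variable {A : Type*} [CommRing A] {G : Type*} [Group G] [Fintype G] {k : Type*} [Field k]
  [Algebra k A] {β : Cocycle3 G k}

/-- The groupoid identity `(xy)⁻¹x = y⁻¹`, with its scalar; it is the change of variables in
`averageSection`. -/
lemma TensorDouble.basisInv_mul_basis_mul {g x h y : G} (hg : x⁻¹ * g * x = h) :
    basisInv A β g (x * y) * basis A β g x =
      unitScalar A (β.theta g x y) • basisInv A β h y := by
  rw [← basis_mul_idem hg, ← basis_mul_basisInv h y, ← mul_assoc (basis A β g x),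
    basis_mul_basis hg, smul_mul_assoc, mul_smul_comm, ← mul_assoc,
    basisInv_mul_basis (h := y⁻¹ * h * y) (by rw [← hg]; group), idem_mul_basisInv rfl]

variable (P : Type*) [AddCommGroup P] [Module A P] [Module (TensorDouble A β) P]
  [IsScalarTower A (TensorDouble A β) P]

/-- The averaged section of the action map `D ⊗_A P → P`, up to the factor `|G|`. -/
def averageSection : P →ₗ[TensorDouble A β] TensorDouble A β ⊗[A] P :=
  linearMapOfBasis (∑ g : G, ∑ x : G, TensorProduct.mk A (TensorDouble A β) P (basis A β g x) ∘ₗ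
      Algebra.lsmul A A P (basisInv A β g x)) fun h y p => by
    simp only [LinearMap.sum_apply, LinearMap.comp_apply, TensorProduct.mk_apply,
      Finset.smul_sum, TensorProduct.smul_tmul', smul_eq_mul, smul_smul, Algebra.lsmul_coe]
    -- By composability only `g = h` survives when the arrow acts on `p`, and only `g = y⁻¹hy` when
    -- it multiplies the sum from the left.
    refine (Finset.sum_eq_single h (fun g _ hg => Finset.sum_eq_zero fun x _ => ?_)
      (by simp)).trans (Eq.trans ?_ (Finset.sum_eq_single (y⁻¹ * h * y)
        (fun g _ hg => Finset.sum_eq_zero fun x _ => ?_) (by simp)).symm)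
    · rw [basisInv_mul_basis_ne hg, zero_smul, TensorProduct.tmul_zero]
    -- Replacing `x` by `yx` matches the two sums; both sides acquire the same `θ`, which moves
    -- across the tensor product over `A`.
    · refine (Fintype.sum_equiv (Equiv.mulLeft y) _ _ fun x => ?_).symm
      rw [Equiv.coe_mulLeft, basis_mul_basis rfl, basisInv_mul_basis_mul rfl, smul_assoc,
        TensorProduct.smul_tmul]
    · rw [basis_mul_basis_ne (Ne.symm hg), TensorProduct.zero_tmul]

lemma averageSection_apply (p : P) : averageSection P p =
    ∑ g : G, ∑ x : G, basis A β g x ⊗ₜ[A] (basisInv A β g x • p) := by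
  change (∑ g : G, ∑ x : G, TensorProduct.mk A (TensorDouble A β) P (basis A β g x) ∘ₗ
      Algebra.lsmul A A P (basisInv A β g x)) p = _
  simp only [LinearMap.sum_apply]
  rfl

/-- If `|G|` is invertible in `A`, then modules over `A ⊗ D^β(k[G])` are projective if they are
projective over `A`. -/
theorem TensorDouble.projective_of_projective (hG : IsUnit (Fintype.card G : A))
    [Module.Projective A P] : Module.Projective (TensorDouble A β) P := by
  obtain ⟨u, hu⟩ := hG
  let μ : TensorDouble A β ⊗[A] P →ₗ[TensorDouble A β] P :=
    TensorProduct.AlgebraTensorModule.lift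
      { toFun := fun d => (LinearMap.toSpanSingleton (TensorDouble A β) (P →ₗ[A] P) LinearMap.id d)
        map_add' := fun d e => map_add _ d e
        map_smul' := fun d e => map_smul _ d e }
  have hμ : ∀ d p, μ (d ⊗ₜ[A] p) = d • p := fun d p => rfl
  -- The module `(A ⊗ D^β(k[G])) ⊗_A P` is projective by extension of scalars. Composing the average
  -- with the action map gives `idem g` once for each `x`, hence `|G|` in total.
  refine Module.Projective.of_split ((↑u⁻¹ : A) • averageSection P) μ (LinearMap.ext fun p => ?_)
  change μ ((↑u⁻¹ : A) • averageSection P p) = p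
  rw [← algebraMap_smul (TensorDouble A β), map_smul, algebraMap_smul, averageSection_apply]
  simp only [map_sum, hμ, smul_smul, basis_mul_basisInv, Finset.sum_const, Finset.card_univ]
  rw [← Finset.smul_sum, ← eq_sum_idem_smul, ← Nat.cast_smul_eq_nsmul A, ← hu, smul_smul,
    Units.inv_mul, one_smul]

/-- Projective modules over `A ⊗ D^β(k[G])` are projective over `A`. -/
lemma TensorDouble.projective_base [Module.Projective (TensorDouble A β) P] :
    Module.Projective A P := by
  obtain ⟨s, hs⟩ := Module.projective_def'.1 (inferInstance :
    Module.Projective (TensorDouble A β) P)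
  -- The section lands in a free module over `A ⊗ D^β(k[G])`, which is projective over `A` because
  -- the algebra is free over `A`.
  exact Module.Projective.of_split (s.restrictScalars A)
    ((Finsupp.linearCombination (TensorDouble A β) id).restrictScalars A)
    (LinearMap.ext fun p => LinearMap.congr_fun hs p)

end Separable

/-! ### Tensor products of modules over `A ⊗ D^β(k[G])` -/

section ComulTensor

open TensorDouble

variable {A : Type*} [CommRing A] {G : Type*} [Group G] [Fintype G] {k : Type*} [Field k]
  [Algebra k A] {β : Cocycle3 G k}

section Basic

variable {A : Type*} [CommRing A] {G : Type*} [Group G] {k : Type*} [Field k] {β : Cocycle3 G k}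
  {P Q : Type*} [AddCommGroup P] [Module A P] [AddCommGroup Q] [Module A Q]

instance : Module A (ComulTensor A β P Q) := inferInstanceAs (Module A (P ⊗[A] Q))

namespace ComulTensor

variable (A β) in
/-- A pure tensor. -/
def tmul (p : P) (q : Q) : ComulTensor A β P Q := p ⊗ₜ[A] q

@[elab_as_elim]
protected lemma induction {p : ComulTensor A β P Q → Prop} (t : ComulTensor A β P Q) (h0 : p 0)
    (hadd : ∀ s t, p s → p t → p (s + t)) (ht : ∀ x y, p (tmul A β x y)) : p t :=
  TensorProduct.induction_on (motive := p) t h0 ht hadd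

lemma zero_tmul (q : Q) : tmul A β (0 : P) q = 0 := TensorProduct.zero_tmul _ _

end ComulTensor

end Basic

/-- An `A`-linear equivalence which commutes with the standard basis of `A ⊗ D^β(k[G])`. -/
def TensorDouble.linearEquivOfBasis {P Q : Type*} [AddCommGroup P] [Module A P]
    [Module (TensorDouble A β) P] [IsScalarTower A (TensorDouble A β) P] [AddCommGroup Q]
    [Module A Q] [Module (TensorDouble A β) Q] [IsScalarTower A (TensorDouble A β) Q]
    (e : P ≃ₗ[A] Q) (he : ∀ g x p, e (basis A β g x • p) = basis A β g x • e p) :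
    P ≃ₗ[TensorDouble A β] Q :=
  { linearMapOfBasis e.toLinearMap he with
    invFun := e.symm
    left_inv := e.left_inv
    right_inv := e.right_inv }

variable {P Q : Type*} [AddCommGroup P] [Module A P] [Module (TensorDouble A β) P]
  [IsScalarTower A (TensorDouble A β) P] [AddCommGroup Q] [Module A Q]
  [Module (TensorDouble A β) Q] [IsScalarTower A (TensorDouble A β) Q]

namespace ComulTensor

lemma smul_def (d : TensorDouble A β) (t : ComulTensor A β P Q) :
    d • t = (comulAction A β P Q d t : P ⊗[A] Q) := rfl

instance : IsScalarTower A (TensorDouble A β) (ComulTensor A β P Q) where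
  smul_assoc a d t := by
    rw [smul_def, smul_def, map_smul]
    rfl

lemma comulA_basis (g x : G) : comulA A β (basis A β g x) =
    ∑ a : G, unitScalar A (β.gamma x a (a⁻¹ * g)) •
      (basis A β a x ⊗ₜ[A] basis A β (a⁻¹ * g) x) := by
  have h : (Double.comul (Double.of g x 1 : Double β)) = Double.comulBasis g x := by
    change Double.linLift Double.comulBasis (Double.of g x 1) = _
    rw [Double.linLift_of, one_smul]
  rw [comulA, basis, TensorDouble.lift_incl, AlgHom.comp_apply, h, Double.comulBasis, map_sum]
  refine Finset.sum_congr rfl fun a _ => ?_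
  rw [map_smul, unitScalar_apply, algebraMap_smul]
  congr 1
  change Algebra.TensorProduct.lift _ _ _ _ = _
  rw [Algebra.TensorProduct.lift_tmul]
  change (basis A β a x ⊗ₜ[A] (1 : TensorDouble A β)) *
    ((1 : TensorDouble A β) ⊗ₜ[A] basis A β (a⁻¹ * g) x) = _
  rw [Algebra.TensorProduct.tmul_mul_tmul, one_mul, mul_one]

lemma basis_smul_tmul (g x : G) (p : P) (q : Q) : basis A β g x • tmul A β p q =
    ∑ a : G, unitScalar A (β.gamma x a (a⁻¹ * g)) •
      tmul A β (basis A β a x • p) (basis A β (a⁻¹ * g) x • q) := by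
  rw [smul_def]
  change Module.endTensorEndAlgHom (R := A) (S := A) (A := A) (M := P) (N := Q)
    (Algebra.TensorProduct.map (Algebra.lsmul A A P) (Algebra.lsmul A A Q)
      (comulA A β (basis A β g x))) (p ⊗ₜ[A] q) = _
  rw [comulA_basis]
  simp only [map_sum, map_smul, LinearMap.sum_apply, LinearMap.smul_apply,
    Algebra.TensorProduct.map_tmul]
  rfl

variable {P' Q' : Type*} [AddCommGroup P'] [Module A P'] [Module (TensorDouble A β) P']
  [IsScalarTower A (TensorDouble A β) P'] [AddCommGroup Q'] [Module A Q']
  [Module (TensorDouble A β) Q'] [IsScalarTower A (TensorDouble A β) Q']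

/-- The tensor product of linear equivalences. -/
def congr (e : P ≃ₗ[TensorDouble A β] P') (f : Q ≃ₗ[TensorDouble A β] Q') :
    ComulTensor A β P Q ≃ₗ[TensorDouble A β] ComulTensor A β P' Q' :=
  let h : ComulTensor A β P Q ≃ₗ[A] ComulTensor A β P' Q' :=
    TensorProduct.congr (e.restrictScalars A) (f.restrictScalars A)
  have h1 : ∀ p q, h (tmul A β p q) = tmul A β (e p) (f q) := fun _ _ => rfl
  linearEquivOfBasis h fun g x t => by
    induction t using ComulTensor.induction with
    | h0 => rw [smul_zero, map_zero, smul_zero]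
    | hadd s t h₁ h₂ => rw [smul_add, map_add, map_add, h₁, h₂, smul_add]
    | ht p q => simp only [basis_smul_tmul, map_sum, map_smul, h1]

/-- The tensor product distributes over direct sums on the left. -/
def prodLeft : ComulTensor A β (P × P') Q ≃ₗ[TensorDouble A β]
    ComulTensor A β P Q × ComulTensor A β P' Q :=
  let h : ComulTensor A β (P × P') Q ≃ₗ[A] ComulTensor A β P Q × ComulTensor A β P' Q :=
    TensorProduct.prodLeft A A P P' Q
  have h1 : ∀ p q, h (tmul A β p q) = (tmul A β p.1 q, tmul A β p.2 q) := fun _ _ => rfl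
  linearEquivOfBasis h fun g x t => by
    induction t using ComulTensor.induction with
    | h0 => rw [smul_zero, map_zero, smul_zero]
    | hadd s t h₁ h₂ => rw [smul_add, map_add, map_add, h₁, h₂, smul_add]
    | ht p q =>
      rw [h1, Prod.smul_mk]
      simp only [basis_smul_tmul, map_sum, map_smul, h1, Prod.smul_mk, Prod.smul_fst,
        Prod.smul_snd, prod_mk_sum]

/-- The tensor product distributes over direct sums on the right. -/
def prodRight : ComulTensor A β P (Q × Q') ≃ₗ[TensorDouble A β]
    ComulTensor A β P Q × ComulTensor A β P Q' :=
  let h : ComulTensor A β P (Q × Q') ≃ₗ[A] ComulTensor A β P Q × ComulTensor A β P Q' :=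
    TensorProduct.prodRight A A P Q Q'
  have h1 : ∀ p q, h (tmul A β p q) = (tmul A β p q.1, tmul A β p q.2) := fun _ _ => rfl
  linearEquivOfBasis h fun g x t => by
    induction t using ComulTensor.induction with
    | h0 => rw [smul_zero, map_zero, smul_zero]
    | hadd s t h₁ h₂ => rw [smul_add, map_add, map_add, h₁, h₂, smul_add]
    | ht p q =>
      rw [h1, Prod.smul_mk]
      simp only [basis_smul_tmul, map_sum, map_smul, h1, Prod.smul_mk, Prod.smul_fst,
        Prod.smul_snd, prod_mk_sum]

-- Finiteness and projectivity descend to `A`, pass to the tensor product over `A`, and return to `A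
-- ⊗ D^β(k[G])`: finiteness trivially, projectivity by averaging.
variable (β P Q) in
theorem finite_projective (hG : IsUnit (Fintype.card G : A))
    (hP : Module.Finite (TensorDouble A β) P ∧ Module.Projective (TensorDouble A β) P)
    (hQ : Module.Finite (TensorDouble A β) Q ∧ Module.Projective (TensorDouble A β) Q) :
    Module.Finite (TensorDouble A β) (ComulTensor A β P Q) ∧
      Module.Projective (TensorDouble A β) (ComulTensor A β P Q) := by
  obtain ⟨_, _⟩ := hP
  obtain ⟨_, _⟩ := hQ
  have h1 : Module.Finite A P := Module.Finite.trans (TensorDouble A β) P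
  have h2 : Module.Finite A Q := Module.Finite.trans (TensorDouble A β) Q
  have h3 : Module.Projective A P := projective_base (β := β) P
  have h4 : Module.Projective A Q := projective_base (β := β) Q
  have h5 : Module.Finite A (ComulTensor A β P Q) := inferInstanceAs (Module.Finite A (P ⊗[A] Q))
  have h6 : Module.Projective A (ComulTensor A β P Q) :=
    inferInstanceAs (Module.Projective A (P ⊗[A] Q))
  exact ⟨Module.Finite.of_restrictScalars_finite A _ _, projective_of_projective _ hG⟩

end ComulTensor

end ComulTensor

/-! ### Maps between Grothendieck groups -/

section Grothendieck

open Algebra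

variable {M N : Type*} [AddCommMonoid M] [AddCommMonoid N]

lemma grothendieckLift_of {H : Type*} [AddCommGroup H] (f : M →+ H) (x : M) :
    GrothendieckAddGroup.lift f (GrothendieckAddGroup.of x) = f x :=
  DFunLike.congr_fun (GrothendieckAddGroup.lift.symm_apply_apply f) x

lemma grothendieck_hom_ext {H : Type*} [AddCommGroup H] {f f' : GrothendieckAddGroup M →+ H}
    (h : ∀ x, f (GrothendieckAddGroup.of x) = f' (GrothendieckAddGroup.of x)) : f = f' :=
  GrothendieckAddGroup.lift.symm.injective (AddMonoidHom.ext h)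

/-- The extension of a biadditive map to the Grothendieck group. -/
def grothendieckLift₂ {H : Type*} [AddCommGroup H] (f : M → M → H)
    (hl : ∀ x x' y, f (x + x') y = f x y + f x' y)
    (hr : ∀ x y y', f x (y + y') = f x y + f x y') :
    GrothendieckAddGroup M →+ GrothendieckAddGroup M →+ H :=
  GrothendieckAddGroup.lift (AddMonoidHom.mk'
    (fun x => GrothendieckAddGroup.lift (AddMonoidHom.mk' (f x) (hr x)))
    fun x x' => grothendieck_hom_ext fun y => by
      rw [AddMonoidHom.add_apply, grothendieckLift_of, grothendieckLift_of, grothendieckLift_of]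
      exact hl x x' y)

lemma grothendieckLift₂_of {H : Type*} [AddCommGroup H] (f : M → M → H) (hl) (hr) (x y : M) :
    grothendieckLift₂ f hl hr (GrothendieckAddGroup.of x) (GrothendieckAddGroup.of y) = f x y := by
  rw [grothendieckLift₂, grothendieckLift_of]
  exact grothendieckLift_of _ _

/-- Isomorphic monoids have isomorphic Grothendieck groups. -/
def grothendieckCongr (e : M ≃+ N) : GrothendieckAddGroup M ≃+ GrothendieckAddGroup N :=
  AddMonoidHom.toAddEquiv
    (GrothendieckAddGroup.lift (GrothendieckAddGroup.of.comp e.toAddMonoidHom))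
    (GrothendieckAddGroup.lift (GrothendieckAddGroup.of.comp e.symm.toAddMonoidHom))
    (grothendieck_hom_ext fun x => by
      rw [AddMonoidHom.comp_apply, grothendieckLift_of, AddMonoidHom.comp_apply,
        grothendieckLift_of, AddMonoidHom.comp_apply]
      exact congrArg GrothendieckAddGroup.of (e.symm_apply_apply x))
    (grothendieck_hom_ext fun x => by
      rw [AddMonoidHom.comp_apply, grothendieckLift_of, AddMonoidHom.comp_apply,
        grothendieckLift_of, AddMonoidHom.comp_apply]
      exact congrArg GrothendieckAddGroup.of (e.apply_symm_apply x))

lemma grothendieckCongr_of (e : M ≃+ N) (x : M) :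
    grothendieckCongr e (GrothendieckAddGroup.of x) = GrothendieckAddGroup.of (e x) :=
  grothendieckLift_of (GrothendieckAddGroup.of.comp e.toAddMonoidHom) x

end Grothendieck

/-! ### Functoriality of `K₀` for equivalences of module categories -/

section KZeroCongr

open CategoryTheory

universe w u₁ u₂

variable {R : Type u₁} [Ring R] {S : Type u₂} [Ring S]

lemma KZero.mk_eq_mk {M N : Type w} [AddCommGroup M] [Module R M] [AddCommGroup N] [Module R N]
    (e : M ≃ₗ[R] N) (hM : Module.Finite R M ∧ Module.Projective R M)
    (hN : Module.Finite R N ∧ Module.Projective R N) : KZero.mk R M hM = KZero.mk R N hN :=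
  congrArg Algebra.GrothendieckAddGroup.of (Quotient.sound ⟨e⟩)

lemma finite_projective_of_equiv {M N : Type w} [AddCommGroup M] [Module R M] [AddCommGroup N]
    [Module R N] (e : M ≃ₗ[R] N) (hM : Module.Finite R M ∧ Module.Projective R M) :
    Module.Finite R N ∧ Module.Projective R N := by
  obtain ⟨_, _⟩ := hM
  exact ⟨Module.Finite.equiv e, Module.Projective.of_equiv e⟩

/-- An additive functor which preserves finitely generated projective modules acts on isomorphism
classes of these. -/
def IsoClass.mapFunctor (F : ModuleCat.{w} R ⥤ ModuleCat.{w} S) [F.Additive]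
    (hF : ∀ M : ModuleCat.{w} R, Module.Finite R M ∧ Module.Projective R M →
      Module.Finite S (F.obj M) ∧ Module.Projective S (F.obj M))
    (x : IsoClass.{w} R) : IsoClass.{w} S :=
  Quotient.map (fun M => (⟨F.obj M.1, hF M.1 M.2⟩ : FGProj.{w} S))
    (by
      rintro M N ⟨e⟩
      exact ⟨(F.mapIso e.toModuleIso).toLinearEquiv⟩) x

lemma IsoClass.mapFunctor_add (F : ModuleCat.{w} R ⥤ ModuleCat.{w} S) [F.Additive]
    (hF : ∀ M : ModuleCat.{w} R, Module.Finite R M ∧ Module.Projective R M →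
      Module.Finite S (F.obj M) ∧ Module.Projective S (F.obj M))
    (x y : IsoClass.{w} R) : mapFunctor F hF (x + y) = mapFunctor F hF x + mapFunctor F hF y := by
  obtain ⟨M⟩ := x
  obtain ⟨N⟩ := y
  -- Addition of classes is a direct sum, that is, a biproduct, and an additive functor preserves
  -- biproducts.
  have := Limits.preservesBinaryBiproduct_of_preservesBiproduct F M.1 N.1
  exact Quotient.sound ⟨(F.mapIso (ModuleCat.biprodIsoProd M.1 N.1).symm ≪≫ F.mapBiprod M.1 N.1 ≪≫
    ModuleCat.biprodIsoProd (F.obj M.1) (F.obj N.1)).toLinearEquiv⟩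

/-- An additive equivalence of module categories which preserves finitely generated projective
modules induces an isomorphism on `K₀`. -/
def KZero.congr (e : ModuleCat.{w} R ≌ ModuleCat.{w} S) [e.functor.Additive] [e.inverse.Additive]
    (hF : ∀ M : ModuleCat.{w} R, Module.Finite R M ∧ Module.Projective R M →
      Module.Finite S (e.functor.obj M) ∧ Module.Projective S (e.functor.obj M))
    (hI : ∀ M : ModuleCat.{w} S, Module.Finite S M ∧ Module.Projective S M →
      Module.Finite R (e.inverse.obj M) ∧ Module.Projective R (e.inverse.obj M)) :
    KZero.{w} R ≃+ KZero.{w} S :=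
  grothendieckCongr
    { toFun := IsoClass.mapFunctor e.functor hF
      invFun := IsoClass.mapFunctor e.inverse hI
      left_inv := by
        rintro ⟨M⟩
        exact Quotient.sound ⟨(e.unitIso.app M.1).symm.toLinearEquiv⟩
      right_inv := by
        rintro ⟨M⟩
        exact Quotient.sound ⟨(e.counitIso.app M.1).toLinearEquiv⟩
      map_add' := IsoClass.mapFunctor_add e.functor hF }

lemma KZero.congr_mk (e : ModuleCat.{w} R ≌ ModuleCat.{w} S) [e.functor.Additive]
    [e.inverse.Additive] (hF) (hI) (M : ModuleCat.{w} R)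
    (hM : Module.Finite R M ∧ Module.Projective R M) :
    KZero.congr e hF hI (KZero.mk R M hM) = KZero.mk S (e.functor.obj M) (hF M hM) :=
  grothendieckCongr_of _ _

end KZeroCongr

/-! ### The product on `K₀(A ⊗ D^β(k[G]))`, and the Morita equivalence on finitely generated
projectives -/

section Products

open CategoryTheory

universe w

variable {A : Type u} [CommRing A] {G : Type v} [Group G] [Fintype G] {k : Type w} [Field k]
  [Algebra k A] {β : Cocycle3 G k} {rep : ConjClasses G → G}

/-- The class of the tensor product of modules over `A ⊗ D^β(k[G])`. -/
def comulTensorClass (hG : IsUnit (Fintype.card G : A)) :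
    IsoClass.{max u v w} (TensorDouble A β) → IsoClass.{max u v w} (TensorDouble A β) →
      IsoClass.{max u v w} (TensorDouble A β) :=
  Quotient.map₂
    (fun P Q => (⟨ModuleCat.of _ (ComulTensor A β P.1 Q.1),
      ComulTensor.finite_projective β P.1 Q.1 hG P.2 Q.2⟩ : FGProj (TensorDouble A β)))
    (fun _ _ ⟨e⟩ _ _ ⟨f⟩ => ⟨ComulTensor.congr e f⟩)

/-- The product on `K₀(A ⊗ D^β(k[G]))` given by the comultiplication. -/
def mulDouble (β : Cocycle3 G k) (hG : IsUnit (Fintype.card G : A)) :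
    KZero.{max u v w} (TensorDouble A β) →+ KZero.{max u v w} (TensorDouble A β) →+
      KZero.{max u v w} (TensorDouble A β) :=
  grothendieckLift₂
    (fun x y => Algebra.GrothendieckAddGroup.of (comulTensorClass hG x y))
    (by
      rintro ⟨P⟩ ⟨P'⟩ ⟨Q⟩
      rw [← map_add]
      refine congrArg _ (Quotient.sound ⟨?_⟩)
      exact (ComulTensor.congr (LinearEquiv.refl _ (P.1 × P'.1)) (LinearEquiv.refl _ Q.1)).trans
        ComulTensor.prodLeft)
    (by
      rintro ⟨P⟩ ⟨Q⟩ ⟨Q'⟩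
      rw [← map_add]
      refine congrArg _ (Quotient.sound ⟨?_⟩)
      exact (ComulTensor.congr (LinearEquiv.refl _ P.1) (LinearEquiv.refl _ (Q.1 × Q'.1))).trans
        ComulTensor.prodRight)

lemma mulDouble_mk (hG : IsUnit (Fintype.card G : A))
    (P Q : ModuleCat.{max u v w} (TensorDouble A β))
    (hP : Module.Finite (TensorDouble A β) P ∧ Module.Projective (TensorDouble A β) P)
    (hQ : Module.Finite (TensorDouble A β) Q ∧ Module.Projective (TensorDouble A β) Q) :
    mulDouble β hG (KZero.mk _ P hP) (KZero.mk _ Q hQ) =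
      KZero.mk _ (ComulTensor A β P Q) (ComulTensor.finite_projective β P Q hG hP hQ) :=
  grothendieckLift₂_of _ _ _ _ _

instance (hrep : ∀ c, ConjClasses.mk (rep c) = c) :
    (moritaEquivalence A β hrep).eqv.inverse.Additive :=
  inferInstanceAs (restrictionFunctor A β rep).Additive

/-- The module over `A ⊗ D^β(k[G])` which corresponds to a `B^β`-module restricts to it. -/
def restrictionMoritaEquiv (hrep : ∀ c, ConjClasses.mk (rep c) = c)
    (M : ModuleCat.{max u v w} (TwistedSum A β rep)) :
    M ≃ₗ[TwistedSum A β rep]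
      Restriction A β rep ((moritaEquivalence A β hrep).eqv.functor.obj M) :=
  ((moritaEquivalence A β hrep).eqv.unitIso.app M).toLinearEquiv

/-- Projectivity is categorical, so the equivalence preserves it. Finiteness is read off from the
restriction, which is isomorphic to `M`. -/
lemma moritaEquivalence_functor_finite_projective (hrep : ∀ c, ConjClasses.mk (rep c) = c)
    (M : ModuleCat.{max u v w} (TwistedSum A β rep))
    (hM : Module.Finite (TwistedSum A β rep) M ∧ Module.Projective (TwistedSum A β rep) M) :
    Module.Finite (TensorDouble A β) ((moritaEquivalence A β hrep).eqv.functor.obj M) ∧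
      Module.Projective (TensorDouble A β) ((moritaEquivalence A β hrep).eqv.functor.obj M) := by
  obtain ⟨_, hM'⟩ := hM
  have h1 := Module.Finite.equiv (restrictionMoritaEquiv (A := A) (β := β) hrep M)
  have h2 : Projective M := (IsProjective.iff_projective (R := TwistedSum A β rep) M).1 hM'
  have h3 := ((moritaEquivalence A β hrep).eqv.map_projective_iff M).2 h2
  exact ⟨Restriction.finite_of_finite hrep _, ModuleCat.projective_of_module_projective _⟩

lemma moritaEquivalence_inverse_finite_projective (hrep : ∀ c, ConjClasses.mk (rep c) = c)
    (P : ModuleCat.{max u v w} (TensorDouble A β))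
    (hP : Module.Finite (TensorDouble A β) P ∧ Module.Projective (TensorDouble A β) P) :
    Module.Finite (TwistedSum A β rep) ((moritaEquivalence A β hrep).eqv.inverse.obj P) ∧
      Module.Projective (TwistedSum A β rep)
        ((moritaEquivalence A β hrep).eqv.inverse.obj P) := by
  obtain ⟨_, hP'⟩ := hP
  have h2 : Projective P := (IsProjective.iff_projective (R := TensorDouble A β) P).1 hP'
  have h3 := ((moritaEquivalence A β hrep).eqv.symm.map_projective_iff P).2 h2
  have h4 : Projective ((moritaEquivalence A β hrep).eqv.inverse.obj P) := h3
  exact ⟨Restriction.finite P, ModuleCat.projective_of_module_projective _⟩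

end Products

/-! ### Universal property of the extension of scalars -/

namespace BaseChange

variable {A S R : Type*} [CommRing A] [Ring S] [Algebra A S] [Ring R] [Algebra A R]
  (f : S →ₐ[A] R) {M : Type*} [AddCommGroup M] [Module A M] [Module S M]

/-- The class of a pure tensor. -/
def tmul (r : R) (m : M) : BaseChange f M := Submodule.Quotient.mk (r ⊗ₜ[A] m)

variable {f}

@[elab_as_elim]
protected lemma induction {p : BaseChange f M → Prop} (t : BaseChange f M) (h0 : p 0)
    (hadd : ∀ s t, p s → p t → p (s + t)) (ht : ∀ r m, p (tmul f r m)) : p t := by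
  obtain ⟨t, rfl⟩ := Submodule.Quotient.mk_surjective _ t
  exact TensorProduct.induction_on
    (motive := fun t => p ((Submodule.Quotient.mk t : _ ⧸ _) : BaseChange f M)) t h0 ht
    fun s t hs ht => hadd _ _ hs ht

lemma base_smul_tmul (a : A) (r : R) (m : M) : a • tmul f r m = tmul f (a • r) m := rfl

lemma tmul_add (r : R) (m m' : M) : tmul f r (m + m') = tmul f r m + tmul f r m' := by
  rw [tmul, TensorProduct.tmul_add]
  rfl

lemma add_tmul (r r' : R) (m : M) : tmul f (r + r') m = tmul f r m + tmul f r' m := by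
  rw [tmul, TensorProduct.add_tmul]
  rfl

lemma tmul_zero (r : R) : tmul f r (0 : M) = 0 := by
  rw [tmul, TensorProduct.tmul_zero]
  rfl

lemma zero_tmul (m : M) : tmul f 0 m = 0 := by
  rw [tmul, TensorProduct.zero_tmul]
  rfl

lemma tmul_base_smul (a : A) (r : R) (m : M) : tmul f r (a • m) = a • tmul f r m := by
  rw [tmul, TensorProduct.tmul_smul]
  rfl

lemma mul_tmul (r : R) (s : S) (m : M) : tmul f (r * f s) m = tmul f r (s • m) :=
  (Submodule.Quotient.eq _).2 (Submodule.subset_span ⟨r, s, m, rfl⟩)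

variable {N : Type*} [AddCommGroup N] [Module A N] [Module R N] [IsScalarTower A R N]

/-- A semilinear map extends to a linear map on the extension of scalars. -/
def lift (φ : M →ₗ[A] N) (hφ : ∀ (s : S) m, φ (s • m) = f s • φ m) : BaseChange f M →ₗ[R] N :=
  Submodule.liftQ _
    (TensorProduct.AlgebraTensorModule.lift
      { toFun := fun r => LinearMap.toSpanSingleton R (M →ₗ[A] N) φ r
        map_add' := fun r r' => map_add _ r r'
        map_smul' := fun r r' => map_smul _ r r' } : R ⊗[A] M →ₗ[R] N)
    (Submodule.span_le.2 (by
      rintro _ ⟨r, s, m, rfl⟩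
      rw [SetLike.mem_coe, LinearMap.mem_ker, map_sub]
      change (r * f s) • φ m - r • φ (s • m) = 0
      rw [hφ, mul_smul, sub_self]))

lemma lift_tmul (φ : M →ₗ[A] N) (hφ : ∀ (s : S) m, φ (s • m) = f s • φ m) (r : R) (m : M) :
    lift φ hφ (tmul f r m) = r • φ m := rfl

end BaseChange

/-! ### Sectors of a restriction -/

section Sector

open TensorDouble

section

variable {A : Type*} [CommRing A] {G : Type*} [Group G] {k : Type*} [Field k]
  [Algebra k A] {β : Cocycle3 G k}

lemma conjHom_of {x g m : G} (hm : x * g * x⁻¹ = m) (w : Subgroup.centralizer {g}) (a : A) :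
    conjHom A β hm (Crossed.of w a) = a • Crossed.of ⟨x * w * x⁻¹, conj_mem' hm w⟩
      (algebraMap k A ↑(β.theta m x w / β.theta m (x * w * x⁻¹) x)) :=
  Crossed.linLift_of _ w a

lemma conjHom_surjective {x g m : G} (hm : x * g * x⁻¹ = m) :
    Function.Surjective (conjHom A β hm) := by
  intro r
  induction r using Crossed.induction with
  | h0 => exact ⟨0, map_zero _⟩
  | hadd r s hr hs =>
    obtain ⟨r, rfl⟩ := hr
    obtain ⟨s, rfl⟩ := hs
    exact ⟨r + s, map_add _ _ _⟩
  | hof w a =>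
    have hg : x⁻¹ * m * x⁻¹⁻¹ = g := by rw [← hm]; group
    let w' : Subgroup.centralizer {g} := ⟨x⁻¹ * w * x⁻¹⁻¹, conj_mem' hg w⟩
    have hw : (⟨x * w' * x⁻¹, conj_mem' hm w'⟩ : Subgroup.centralizer {m}) = w :=
      Subtype.ext (by
        change x * (x⁻¹ * w * x⁻¹⁻¹) * x⁻¹ = w
        group)
    refine ⟨Crossed.of w'
      (a * algebraMap k A ↑(β.theta m x w' / β.theta m (x * w' * x⁻¹) x)⁻¹), ?_⟩
    rw [conjHom_of, hw, Crossed.smul_of, smul_eq_mul, mul_assoc, ← map_mul, ← Units.val_mul,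
      inv_mul_cancel, Units.val_one, map_one, mul_one]

end

variable {A : Type*} [CommRing A] {G : Type*} [Group G] [Fintype G] {k : Type*} [Field k]
  [Algebra k A] {β : Cocycle3 G k}

/-- The scalar in `conjHom` is made for this: `⌊m|xwx⁻¹⌋ ⌊m|x⌋` and `⌊m|x⌋ ⌊g|w⌋` are both multiples
of `⌊m|xw⌋`, and the scalar is the ratio of the two coefficients. Transport by `conjHom` is thus
conjugation by an arrow. -/
lemma crossedEmb_conjHom_mul_basis {x g m : G} (hm : x * g * x⁻¹ = m)
    (r : Crossed A (β.thetaZ g)) :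
    crossedEmb A β m (conjHom A β hm r) * basis A β m x = basis A β m x * crossedEmb A β g r := by
  induction r using Crossed.induction with
  | h0 => rw [map_zero, map_zero, map_zero, zero_mul, mul_zero]
  | hadd r s hr hs => rw [map_add, map_add, map_add, add_mul, hr, hs, mul_add]
  | hof w a =>
    have h1 : (x * w * x⁻¹)⁻¹ * m * (x * w * x⁻¹) = m :=
      centralizer_conj (⟨_, conj_mem' hm w⟩ : Subgroup.centralizer {m})
    rw [conjHom_of, map_smul, crossedEmb_of, crossedEmb_of, smul_mul_assoc, smul_mul_assoc,
      mul_smul_comm, basis_mul_basis h1, basis_mul_basis (by rw [← hm]; group), ← unitScalar_apply,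
      smul_smul (unitScalar A _), ← map_mul, div_mul_cancel, inv_mul_cancel_right]

variable {rep : ConjClasses G → G} (hrep : ∀ c, ConjClasses.mk (rep c) = c)
  {P : Type*} [AddCommGroup P] [Module A P] [Module (TensorDouble A β) P]
  [IsScalarTower A (TensorDouble A β) P]
  {V : Type*} [AddCommGroup V] [Module A V] [Module (TwistedSum A β rep) V]
  [IsScalarTower A (TwistedSum A β rep) V]
  (e : V ≃ₗ[TwistedSum A β rep] Restriction A β rep P)

-- This holds by definition because `sectorHom` and `conjugator` choose a witness of the same
-- existential statement.
omit [Fintype G] in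
lemma sectorHom_apply (m : G) (b : TwistedSum A β rep) :
    sectorHom A β rep hrep m b = conjHom A β (conjugator_spec hrep m) (b (ConjClasses.mk m)) := rfl

omit [Fintype G] in
lemma sectorHom_surjective (m : G) : Function.Surjective (sectorHom A β rep hrep m) := by
  intro r
  obtain ⟨s, rfl⟩ := conjHom_surjective (conjugator_spec hrep m) r
  exact ⟨TwistedSum.single _ s, by rw [sectorHom_apply, TwistedSum.single_same]⟩

/-- The map from a module to the component of its extension at `m`. -/
def sectorAux (m : G) : V →ₗ[A] component A β P m where
  toFun v := ⟨basis A β m (conjugator hrep m) • (e v (ConjClasses.mk m) : P), basis_smul_mem _ _ _⟩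
  map_add' v w := Subtype.ext (by
    rw [map_add]
    exact smul_add _ _ _)
  map_smul' a v := Subtype.ext (by
    have h : e (a • v) = a • e v := map_smul (e.restrictScalars A) a v
    rw [h]
    exact smul_algebra_smul_comm a _ _)

lemma coe_sectorAux (m : G) (v : V) : (sectorAux hrep e m v : P) =
    basis A β m (conjugator hrep m) • (e v (ConjClasses.mk m) : P) := rfl

/-- The comparison of the sectors of a `B^β`-module with the components of the corresponding module
over `A ⊗ D^β(k[G])`. -/
def sectorMap (m : G) :
    Sector A β rep hrep V m →ₗ[Crossed A (β.thetaZ m)] component A β P m :=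
  BaseChange.lift (sectorAux hrep e m) fun b v => Subtype.ext (by
    rw [coe_crossed_smul, coe_sectorAux, coe_sectorAux, map_smul, Restriction.smul_apply,
      coe_crossed_smul, smul_smul, smul_smul, sectorHom_apply, crossedEmb_conjHom_mul_basis])

/-- As `sectorHom` is surjective, every element of the sector has the form `1 ⊗ v`. If its image
vanishes, so does the component of `v` at the class of `m`, since the arrow is invertible; the
idempotent of that class then kills `v`. But `sectorHom` sends this idempotent to `1`, so it may be
moved across the tensor and `1 ⊗ v = 0`. -/
lemma sectorMap_injective (m : G) : Function.Injective (sectorMap hrep e m) := by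
  have h1 : ∀ t : Sector A β rep hrep V m, ∃ v, t = BaseChange.tmul _ 1 v := fun t => by
    induction t using BaseChange.induction with
    | h0 => exact ⟨0, (BaseChange.tmul_zero _).symm⟩
    | hadd s t hs ht =>
      obtain ⟨v, rfl⟩ := hs
      obtain ⟨w, rfl⟩ := ht
      exact ⟨v + w, (BaseChange.tmul_add _ _ _).symm⟩
    | ht r v =>
      obtain ⟨b, rfl⟩ := sectorHom_surjective (A := A) (β := β) hrep m r
      exact ⟨b • v, by rw [← BaseChange.mul_tmul, one_mul]⟩
  rw [injective_iff_map_eq_zero]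
  intro t ht
  obtain ⟨v, rfl⟩ := h1 t
  have h2 : basis A β m (conjugator hrep m) • (e v (ConjClasses.mk m) : P) = 0 := by
    have h := congrArg Subtype.val ht
    rw [sectorMap, BaseChange.lift_tmul, one_smul] at h
    exact h
  have h3 : e v (ConjClasses.mk m) = 0 := Subtype.ext (by
    rw [← idem_smul_coe (e v _), ← basisInv_mul_basis (conjugator_spec' hrep m), mul_smul, h2,
      smul_zero]
    rfl)
  have h4 : (TwistedSum.single (ConjClasses.mk m) 1 : TwistedSum A β rep) • v = 0 := by
    refine e.injective ?_
    rw [map_smul, map_zero]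
    exact (Restriction.single_smul _ _ _).trans (by rw [h3, smul_zero, map_zero])
  have h5 : sectorHom A β rep hrep m (TwistedSum.single (ConjClasses.mk m) 1) = 1 := by
    rw [sectorHom_apply, TwistedSum.single_same, map_one]
  rw [← h5, ← one_mul (sectorHom A β rep hrep m _), BaseChange.mul_tmul, h4, BaseChange.tmul_zero]

lemma sectorMap_surjective (m : G) : Function.Surjective (sectorMap hrep e m) := by
  intro p
  refine ⟨BaseChange.tmul _ 1 (e.symm (Restriction.single _
    ⟨basisInv A β m (conjugator hrep m) • (p : P),
      basisInv_smul_mem (conjugator_spec' hrep m) _⟩)), Subtype.ext ?_⟩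
  rw [sectorMap, BaseChange.lift_tmul, one_smul, coe_sectorAux, LinearEquiv.apply_symm_apply,
    Restriction.single_apply_same, smul_smul, basis_mul_basisInv, idem_smul_coe]

/-- The sectors of a `B^β`-module are the components of the corresponding module over
`A ⊗ D^β(k[G])`. -/
def sectorEquiv (m : G) :
    Sector A β rep hrep V m ≃ₗ[Crossed A (β.thetaZ m)] component A β P m :=
  LinearEquiv.ofBijective (sectorMap hrep e m)
    ⟨sectorMap_injective hrep e m, sectorMap_surjective hrep e m⟩

end Sector

/-! ### Pure tensors in the `γ`-twisted tensor product -/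

section GammaTensor

variable {A : Type*} [CommRing A] {G : Type*} [Group G] {k : Type*} [Field k] {β : Cocycle3 G k}
  {g h r : G} {hr : g * h = r} {M N : Type*} [AddCommGroup M] [Module A M] [AddCommGroup N]
  [Module A N]

namespace GammaTensor

variable (A β hr) in
/-- A pure tensor. -/
def tmul (m : M) (n : N) : GammaTensor A β hr M N := m ⊗ₜ[A] n

@[elab_as_elim]
protected lemma induction {p : GammaTensor A β hr M N → Prop} (t : GammaTensor A β hr M N)
    (h0 : p 0) (hadd : ∀ s t, p s → p t → p (s + t)) (ht : ∀ m n, p (tmul A β hr m n)) : p t :=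
  TensorProduct.induction_on (motive := p) t h0 ht hadd

lemma zero_tmul (n : N) : tmul A β hr (0 : M) n = (0 : GammaTensor A β hr M N) :=
  TensorProduct.zero_tmul _ _

variable [Algebra k A] [Module (Crossed A (β.thetaZ g)) M]
  [IsScalarTower A (Crossed A (β.thetaZ g)) M] [Module (Crossed A (β.thetaZ h)) N]
  [IsScalarTower A (Crossed A (β.thetaZ h)) N]

lemma of_smul_tmul (x : Subgroup.centralizer {g, h}) (a : A) (m : M) (n : N) :
    (Crossed.of x a : PairCrossed A β hr) • tmul A β hr m n =
      a • unitScalar A (β.gamma x g h) • tmul A β hr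
        ((Crossed.of (Subgroup.inclusion (pairZ_le_left g h) x) 1 : Crossed A (β.thetaZ g)) • m)
        ((Crossed.of (Subgroup.inclusion (pairZ_le_right g h) x) 1 :
          Crossed A (β.thetaZ h)) • n) := by
  have h := Crossed.linLift_of (α := (β.thetaZ r).comap (Subgroup.inclusion (pairZ_le_mul hr)))
    (fun x => algebraMap k A (β.gamma x g h) • TensorProduct.map
      (Algebra.lsmul A A M
        (Crossed.of (Subgroup.inclusion (pairZ_le_left g h) x) 1 : Crossed A (β.thetaZ g)))
      (Algebra.lsmul A A N
        (Crossed.of (Subgroup.inclusion (pairZ_le_right g h) x) 1 : Crossed A (β.thetaZ h)))) x a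
  exact LinearMap.congr_fun h (m ⊗ₜ[A] n)

end GammaTensor

lemma crossedMap_of [Algebra k A] {H K : Type*} [Group H] [Group K] (α : Cocycle2 H k)
    (f : K →* H) (x : K) (a : A) :
    Crossed.map α f (Crossed.of x a) = (Crossed.of (f x) a : Crossed A α) := by
  refine (Crossed.linLift_of _ x a).trans ?_
  rw [Crossed.smul_of, smul_eq_mul, mul_one]

end GammaTensor

/-! ### Components of a tensor product -/

section Pair

open TensorDouble

variable {A : Type*} [CommRing A] {G : Type*} [Group G] [Fintype G] {k : Type*} [Field k]
  [Algebra k A] {β : Cocycle3 G k}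
  {P : Type*} [AddCommGroup P] [Module A P] [Module (TensorDouble A β) P]
  [IsScalarTower A (TensorDouble A β) P]
  {Q : Type*} [AddCommGroup Q] [Module A Q] [Module (TensorDouble A β) Q]
  [IsScalarTower A (TensorDouble A β) Q]

namespace ComulTensor

/-- In `Δ⌊r|x⌋` the first leg `⌊a|x⌋` kills the component at `g` unless `x⁻¹ax = g`, so one summand
is left. -/
lemma basis_smul_tmul_component {g h r x g' h' : G} (hg : x⁻¹ * g' * x = g)
    (hr : g' * h' = r) (p : component A β P g) (q : component A β Q h) :
    basis A β r x • tmul A β (p : P) (q : Q) =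
      unitScalar A (β.gamma x g' h') •
        tmul A β (basis A β g' x • (p : P)) (basis A β h' x • (q : Q)) := by
  have h1 : g'⁻¹ * r = h' := by rw [← hr, inv_mul_cancel_left]
  rw [basis_smul_tmul, Finset.sum_eq_single g' _ (by simp), h1]
  intro a _ ha
  rw [basis_smul_coe_ne, zero_tmul, smul_zero]
  intro e
  apply ha
  rw [← hg] at e
  simpa using e

/-- For `x = 1` the scalars cancel by `γ_1(g,h) θ_g(1,1) θ_h(1,1) = θ_{gh}(1,1)`. -/
lemma tmul_mem_component {g h r : G} (hr : g * h = r) (p : component A β P g)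
    (q : component A β Q h) : tmul A β (p : P) (q : Q) ∈ component A β (ComulTensor A β P Q) r := by
  have h1 := β.gamma_one g h
  rw [hr] at h1
  rw [mem_component, idem, smul_assoc, basis_smul_tmul_component (g' := g) (h' := h) (by group) hr,
    basis_one, basis_one, smul_assoc, smul_assoc, idem_smul_coe, idem_smul_coe,
    ← h1]
  change unitScalar A _ • unitScalar A _ • ((unitScalar A _ • (p : P)) ⊗ₜ[A]
    (unitScalar A _ • (q : Q))) = (p : P) ⊗ₜ[A] (q : Q)
  rw [TensorProduct.smul_tmul_smul, smul_smul, smul_smul, ← map_mul, ← map_mul, ← map_mul,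
    mul_assoc _ (β.gamma 1 g h), ← mul_assoc (β.gamma 1 g h), inv_mul_cancel, map_one, one_smul]

end ComulTensor

/-! ### Summands `S_g ⊗^γ S'_h` of a component, for families `S`, `S'` identified with the
components of `P`, `Q` -/

variable {S : G → Type*} [∀ g, AddCommGroup (S g)] [∀ g, Module A (S g)]
  [∀ g, Module (Crossed A (β.thetaZ g)) (S g)] [∀ g, IsScalarTower A (Crossed A (β.thetaZ g)) (S g)]
  {S' : G → Type*} [∀ g, AddCommGroup (S' g)] [∀ g, Module A (S' g)]
  [∀ g, Module (Crossed A (β.thetaZ g)) (S' g)]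
  [∀ g, IsScalarTower A (Crossed A (β.thetaZ g)) (S' g)]
  (i : ∀ g, S g ≃ₗ[Crossed A (β.thetaZ g)] component A β P g)
  (i' : ∀ g, S' g ≃ₗ[Crossed A (β.thetaZ g)] component A β Q g)

/-- The inclusion of a component, for a family of modules identified with the components. -/
def familyIncl (g : G) : S g →ₗ[A] P :=
  (component A β P g).subtype ∘ₗ ((i g).restrictScalars A).toLinearMap

/-- The projection to a component, for a family of modules identified with the components. -/
def familyProj (g : G) : P →ₗ[A] S g :=
  ((i g).symm.restrictScalars A).toLinearMap ∘ₗ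
    (Algebra.lsmul A A P (idem A β g)).codRestrict (component A β P g) (idem_smul_mem g)

lemma familyProj_coe (g : G) (p : component A β P g) : familyProj i g (p : P) = (i g).symm p :=
  congrArg (i g).symm (Subtype.ext (idem_smul_coe p))

variable {r : G}

/-- The inclusion `S_g ⊗^γ S'_h → P ⊗_A Q`. -/
def pairIncl (p : {p : G × G // p.1 * p.2 = r}) :
    GammaTensor A β p.2 (S p.1.1) (S' p.1.2) →ₗ[A] ComulTensor A β P Q :=
  TensorProduct.map (familyIncl i p.1.1) (familyIncl i' p.1.2)

lemma pairIncl_tmul (p : {p : G × G // p.1 * p.2 = r}) (s : S p.1.1) (s' : S' p.1.2) :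
    pairIncl i i' p (GammaTensor.tmul A β p.2 s s') =
      ComulTensor.tmul A β (i p.1.1 s : P) (i' p.1.2 s' : Q) := rfl

/-- An element `x` of `Z(g,h)` fixes the pair, so by `basis_smul_tmul_component` the arrow `⌊r|x⌋`
acts on this summand as `γ_x(g,h) ⌊g|x⌋ ⊗ ⌊h|x⌋`, which is the twisted action. -/
lemma pairIncl_smul (p : {p : G × G // p.1 * p.2 = r}) (b : PairCrossed A β p.2)
    (t : GammaTensor A β p.2 (S p.1.1) (S' p.1.2)) : pairIncl i i' p (b • t) =
      crossedEmb A β r (Crossed.map (β.thetaZ r) (Subgroup.inclusion (pairZ_le_mul p.2)) b) •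
        pairIncl i i' p t := by
  induction t using GammaTensor.induction with
  | h0 => rw [smul_zero, map_zero, smul_zero]
  | hadd s t hs ht => rw [smul_add, map_add, map_add, hs, ht, smul_add]
  | ht s s' =>
    induction b using Crossed.induction with
    | h0 => rw [zero_smul, map_zero, map_zero, map_zero, zero_smul]
    | hadd b c hb hc => rw [add_smul, map_add, map_add, map_add, add_smul, hb, hc]
    | hof x a =>
      have hg : (x : G)⁻¹ * p.1.1 * x = p.1.1 := centralizer_conj ⟨_, pairZ_le_left _ _ x.2⟩
      refine (congrArg (pairIncl i i' p) (GammaTensor.of_smul_tmul x a s s')).trans ?_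
      rw [crossedMap_of, crossedEmb_of, smul_assoc, pairIncl_tmul, Subgroup.coe_inclusion,
        ComulTensor.basis_smul_tmul_component hg p.2]
      refine (map_smul (pairIncl i i' p) a _).trans (congrArg (a • ·) ?_)
      refine (map_smul (pairIncl i i' p) (unitScalar A _) _).trans (congrArg (_ • ·) ?_)
      refine (pairIncl_tmul i i' p _ _).trans ?_
      rw [map_smul, map_smul, coe_crossed_smul, coe_crossed_smul, crossedEmb_of, crossedEmb_of,
        one_smul, one_smul]
      rfl

lemma pairIncl_mem (p : {p : G × G // p.1 * p.2 = r})
    (t : GammaTensor A β p.2 (S p.1.1) (S' p.1.2)) :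
    pairIncl i i' p t ∈ component A β (ComulTensor A β P Q) r := by
  induction t using GammaTensor.induction with
  | h0 => rw [map_zero]; exact zero_mem _
  | hadd s t hs ht => rw [map_add]; exact add_mem hs ht
  | ht s s' => exact ComulTensor.tmul_mem_component p.2 _ _

variable (A β S S') in
/-- The module induced from a pair. -/
abbrev PairInduced (p : {p : G × G // p.1 * p.2 = r}) : Type _ :=
  BaseChange (Crossed.map (A := A) (β.thetaZ r) (Subgroup.inclusion (pairZ_le_mul p.2)))
    (GammaTensor A β p.2 (S p.1.1) (S' p.1.2))

/-- The map from an induced module to a component of `P ⊗_A Q`. -/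
def pairMap (p : {p : G × G // p.1 * p.2 = r}) : PairInduced A β S S' p
    →ₗ[Crossed A (β.thetaZ r)] component A β (ComulTensor A β P Q) r :=
  BaseChange.lift ((pairIncl i i' p).codRestrict _ (pairIncl_mem i i' p))
    fun b t => Subtype.ext (pairIncl_smul i i' p b t)

lemma coe_pairMap_tmul (p : {p : G × G // p.1 * p.2 = r}) (w : Subgroup.centralizer {r}) (a : A)
    (t : GammaTensor A β p.2 (S p.1.1) (S' p.1.2)) :
    (pairMap i i' p (BaseChange.tmul _ (Crossed.of w a) t) : ComulTensor A β P Q) =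
      a • basis A β r w • pairIncl i i' p t := by
  rw [pairMap, BaseChange.lift_tmul, coe_crossed_smul, crossedEmb_of, smul_assoc]
  rfl

/-- The projection to the conjugate by `z` of the component of a pair. -/
def pairProj (p : {p : G × G // p.1 * p.2 = r}) (z : G) :
    ComulTensor A β P Q →ₗ[A] GammaTensor A β p.2 (S p.1.1) (S' p.1.2) :=
  -- This scalar undoes the `γ` produced when `⌊r|z⌋` carries the summand of the pair to that of its
  -- conjugate by `z`.
  unitScalar A (β.gamma z (z * p.1.1 * z⁻¹) (z * p.1.2 * z⁻¹))⁻¹ •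
    (TensorProduct.map
      (familyProj i p.1.1 ∘ₗ Algebra.lsmul A A P (basisInv A β (z * p.1.1 * z⁻¹) z))
      (familyProj i' p.1.2 ∘ₗ Algebra.lsmul A A Q (basisInv A β (z * p.1.2 * z⁻¹) z)) :
      P ⊗[A] Q →ₗ[A] S p.1.1 ⊗[A] S' p.1.2)

lemma pairProj_tmul (p : {p : G × G // p.1 * p.2 = r}) (z : G) (x : P) (y : Q) :
    pairProj i i' p z (ComulTensor.tmul A β x y) =
      unitScalar A (β.gamma z (z * p.1.1 * z⁻¹) (z * p.1.2 * z⁻¹))⁻¹ •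
        GammaTensor.tmul A β p.2 (familyProj i p.1.1 (basisInv A β (z * p.1.1 * z⁻¹) z • x))
          (familyProj i' p.1.2 (basisInv A β (z * p.1.2 * z⁻¹) z • y)) :=
  rfl

omit [Fintype G] in
lemma conj_mul_conj (p : {p : G × G // p.1 * p.2 = r}) (z : Subgroup.centralizer {r}) :
    (z * p.1.1 * (z : G)⁻¹) * (z * p.1.2 * (z : G)⁻¹) = r := by
  calc (z * p.1.1 * (z : G)⁻¹) * (z * p.1.2 * (z : G)⁻¹) = z * (p.1.1 * p.1.2) * (z : G)⁻¹ := by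
        group
    _ = r := by
      rw [p.2, Subgroup.mem_centralizer_singleton_iff.1 z.2, mul_inv_cancel_right]

lemma basis_smul_pairIncl_tmul (p : {p : G × G // p.1 * p.2 = r}) (z : Subgroup.centralizer {r})
    (s : S p.1.1) (s' : S' p.1.2) :
    basis A β r z • pairIncl i i' p (GammaTensor.tmul A β p.2 s s') =
      unitScalar A (β.gamma z (z * p.1.1 * (z : G)⁻¹) (z * p.1.2 * (z : G)⁻¹)) •
        ComulTensor.tmul A β (basis A β (z * p.1.1 * (z : G)⁻¹) z • (i p.1.1 s : P))
          (basis A β (z * p.1.2 * (z : G)⁻¹) z • (i' p.1.2 s' : Q)) := by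
  rw [pairIncl_tmul]
  exact ComulTensor.basis_smul_tmul_component (by group) (conj_mul_conj p z) _ _

lemma pairProj_basis_smul (p : {p : G × G // p.1 * p.2 = r}) (z : Subgroup.centralizer {r})
    (t : GammaTensor A β p.2 (S p.1.1) (S' p.1.2)) :
    pairProj i i' p z (basis A β r z • pairIncl i i' p t) = t := by
  induction t using GammaTensor.induction with
  | h0 => rw [map_zero, smul_zero, map_zero]
  | hadd s t hs ht => rw [map_add, smul_add, map_add, hs, ht]
  | ht s s' =>
    rw [basis_smul_pairIncl_tmul, map_smul, pairProj_tmul, smul_smul (basisInv A β _ _),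
      smul_smul (basisInv A β _ _),
      basisInv_mul_basis (h := p.1.1) (by group), basisInv_mul_basis (h := p.1.2) (by group),
      idem_smul_coe, idem_smul_coe, familyProj_coe, familyProj_coe, LinearEquiv.symm_apply_apply,
      LinearEquiv.symm_apply_apply]
    exact unitScalar_smul_inv_smul _ _

/-- Already the first tensor factors are orthogonal. Comparing first entries suffices to separate
conjugates, because all these pairs have product `r`. -/
lemma pairProj_basis_smul_ne (p p₁ : {p : G × G // p.1 * p.2 = r})
    (z w : Subgroup.centralizer {r}) (h : z * p.1.1 * (z : G)⁻¹ ≠ w * p₁.1.1 * (w : G)⁻¹)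
    (t : GammaTensor A β p₁.2 (S p₁.1.1) (S' p₁.1.2)) :
    pairProj i i' p z (basis A β r w • pairIncl i i' p₁ t) = 0 := by
  induction t using GammaTensor.induction with
  | h0 => rw [map_zero, smul_zero, map_zero]
  | hadd s t hs ht => rw [map_add, smul_add, map_add, hs, ht, add_zero]
  | ht s s' =>
    rw [basis_smul_pairIncl_tmul, map_smul, pairProj_tmul, smul_smul (basisInv A β _ _),
      basisInv_mul_basis_ne h, zero_smul, map_zero, GammaTensor.zero_tmul, smul_zero, smul_zero]

end Pair

/-! ### Each `Z(r)`-orbit of pairs contributes an induced module -/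

section Induced

open TensorDouble

variable {A : Type*} [CommRing A] {G : Type*} [Group G] [Fintype G] {k : Type*} [Field k]
  [Algebra k A] {β : Cocycle3 G k}
  {P : Type*} [AddCommGroup P] [Module A P] [Module (TensorDouble A β) P]
  [IsScalarTower A (TensorDouble A β) P]
  {Q : Type*} [AddCommGroup Q] [Module A Q] [Module (TensorDouble A β) Q]
  [IsScalarTower A (TensorDouble A β) Q]
  {S : G → Type*} [∀ g, AddCommGroup (S g)] [∀ g, Module A (S g)]
  [∀ g, Module (Crossed A (β.thetaZ g)) (S g)] [∀ g, IsScalarTower A (Crossed A (β.thetaZ g)) (S g)]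
  {S' : G → Type*} [∀ g, AddCommGroup (S' g)] [∀ g, Module A (S' g)]
  [∀ g, Module (Crossed A (β.thetaZ g)) (S' g)]
  [∀ g, IsScalarTower A (Crossed A (β.thetaZ g)) (S' g)]
  (i : ∀ g, S g ≃ₗ[Crossed A (β.thetaZ g)] component A β P g)
  (i' : ∀ g, S' g ≃ₗ[Crossed A (β.thetaZ g)] component A β Q g)
  {r : G}

/-- Independence of the coset representative: `u ∈ Z(g,h)` moves across the balanced tensor product,
and the `θ_r(z,u)` from splitting `⌊r|zu⌋` cancels the one from `1_z 1_u`. -/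
lemma tmul_pairProj_basis_mul_smul (p : {p : G × G // p.1 * p.2 = r})
    (z : Subgroup.centralizer {r}) (u : Subgroup.centralizer {p.1.1, p.1.2}) (a : A)
    (t : GammaTensor A β p.2 (S p.1.1) (S' p.1.2)) :
    (BaseChange.tmul _ (Crossed.of z 1) (pairProj i i' p z
        (a • basis A β r (z * Subgroup.inclusion (pairZ_le_mul p.2) u : Subgroup.centralizer {r}) •
          pairIncl i i' p t)) : PairInduced A β S S' p) =
      BaseChange.tmul _ (Crossed.of (z * Subgroup.inclusion (pairZ_le_mul p.2) u) a) t := by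
  have h1 : basis A β r u • pairIncl i i' p t = pairIncl i i' p ((Crossed.of u 1 :
      PairCrossed A β p.2) • t) := by
    rw [pairIncl_smul, crossedMap_of, crossedEmb_of, one_smul]
    rfl
  have h2 := unitScalar_inv_smul_smul (A := A) (β.theta r z u)
    (basis A β r (z * u) • pairIncl i i' p t)
  rw [← smul_assoc (unitScalar A (β.theta r z u)), ← basis_mul_basis (centralizer_conj z), mul_smul,
    h1] at h2
  have h3 : (Crossed.of z 1 : Crossed A (β.thetaZ r)) * Crossed.map (β.thetaZ r)
      (Subgroup.inclusion (pairZ_le_mul p.2)) (Crossed.of u 1) =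
        unitScalar A (β.theta r z u) •
          Crossed.of (z * Subgroup.inclusion (pairZ_le_mul p.2) u) 1 := by
    rw [crossedMap_of, Crossed.of_mul_of, Crossed.smul_of, one_mul, one_mul, smul_eq_mul, mul_one]
    rfl
  rw [Subgroup.coe_mul, Subgroup.coe_inclusion, ← h2, map_smul, map_smul, pairProj_basis_smul,
    BaseChange.tmul_base_smul, BaseChange.tmul_base_smul, ← BaseChange.mul_tmul, h3,
    ← BaseChange.base_smul_tmul, unitScalar_inv_smul_smul, BaseChange.base_smul_tmul,
    Crossed.smul_of, smul_eq_mul, mul_one]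

/-- The stabilizer of a pair, as a subgroup of the centralizer of its product. -/
abbrev pairStabilizer (p : {p : G × G // p.1 * p.2 = r}) :
    Subgroup (Subgroup.centralizer {r}) :=
  (Subgroup.centralizer {p.1.1, p.1.2}).subgroupOf (Subgroup.centralizer {r})

omit [Fintype G] in
lemma conj_snd_of_conj_fst {p q : {p : G × G // p.1 * p.2 = r}} {z : G}
    (hz : z ∈ Subgroup.centralizer {r}) (h : q.1.1 = z * p.1.1 * z⁻¹) :
    q.1.2 = z * p.1.2 * z⁻¹ := by
  refine mul_left_cancel (a := q.1.1) ?_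
  rw [q.2, h, conj_mul_conj p ⟨z, hz⟩]

-- If `z` and `w` conjugate the first entry to the same element, then `z⁻¹w` centralizes it;
-- centralizing the product `r` as well, it centralizes the second entry.
omit [Fintype G] in
lemma mk_eq_mk_of_conj_eq {p : {p : G × G // p.1 * p.2 = r}} {z w : Subgroup.centralizer {r}}
    (h : z * p.1.1 * (z : G)⁻¹ = w * p.1.1 * (w : G)⁻¹) :
    (QuotientGroup.mk z : _ ⧸ pairStabilizer p) = QuotientGroup.mk w := by
  rw [QuotientGroup.eq, Subgroup.mem_subgroupOf, Subgroup.mem_centralizer_iff]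
  have h1 : p.1.1 = ((z⁻¹ * w : Subgroup.centralizer {r}) : G) * p.1.1 *
      ((z⁻¹ * w : Subgroup.centralizer {r}) : G)⁻¹ := by
    calc p.1.1 = (z : G)⁻¹ * (z * p.1.1 * (z : G)⁻¹) * z := by group
      _ = _ := by
        rw [h, Subgroup.coe_mul, Subgroup.coe_inv]
        group
  have h2 := conj_snd_of_conj_fst (p := p) (q := p) (z⁻¹ * w).2 h1
  rintro x (rfl | rfl)
  · exact (eq_mul_inv_iff_mul_eq.1 h1)
  · exact (eq_mul_inv_iff_mul_eq.1 h2)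

omit [Fintype G] in
lemma quotient_eq_of_conj_eq {o o₁ : Quotient (pairSetoid r)} {z w : Subgroup.centralizer {r}}
    (h : z * o.out.1.1 * (z : G)⁻¹ = w * o₁.out.1.1 * (w : G)⁻¹) : o = o₁ := by
  rw [← Quotient.out_eq o, ← Quotient.out_eq o₁]
  refine Quotient.sound ?_
  have h1 : o₁.out.1.1 = ((w⁻¹ * z : Subgroup.centralizer {r}) : G) * o.out.1.1 *
      ((w⁻¹ * z : Subgroup.centralizer {r}) : G)⁻¹ := by
    calc o₁.out.1.1 = (w : G)⁻¹ * (w * o₁.out.1.1 * (w : G)⁻¹) * w := by group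
      _ = _ := by
        rw [← h, Subgroup.coe_mul, Subgroup.coe_inv]
        group
  exact ⟨_, (w⁻¹ * z).2, h1, conj_snd_of_conj_fst (w⁻¹ * z).2 h1⟩

/-- The projection of a component of `P ⊗_A Q` to an induced module. -/
def pairInv (p : {p : G × G // p.1 * p.2 = r}) :
    component A β (ComulTensor A β P Q) r →ₗ[A] PairInduced A β S S' p :=
  haveI : Fintype (Subgroup.centralizer {r} ⧸ pairStabilizer p) := Fintype.ofFinite _
  -- The cosets parametrize the conjugates of the pair under `Z(r)`, and each conjugate summand is
  -- brought back to the pair.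
  ∑ q : Subgroup.centralizer {r} ⧸ pairStabilizer p,
    { toFun := fun t => BaseChange.tmul _ (Crossed.of q.out 1) (pairProj i i' p q.out t)
      map_add' := fun s t => by
        rw [Submodule.coe_add, map_add, BaseChange.tmul_add]
      map_smul' := fun a t => by
        rw [Submodule.coe_smul, map_smul, BaseChange.tmul_base_smul, RingHom.id_apply] }

lemma pairInv_apply (p : {p : G × G // p.1 * p.2 = r})
    [Fintype (Subgroup.centralizer {r} ⧸ pairStabilizer p)]
    (t : component A β (ComulTensor A β P Q) r) : pairInv i i' p t =
      ∑ q : Subgroup.centralizer {r} ⧸ pairStabilizer p,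
        BaseChange.tmul _ (Crossed.of q.out 1) (pairProj i i' p q.out t) := by
  rw [pairInv, LinearMap.sum_apply]
  refine Finset.sum_congr (by ext; simp) fun q _ => rfl

/-- On `1_w ⊗ t` only the coset of `w` contributes. Its chosen representative differs from `w` by an
element of `Z(g,h)`, which `tmul_pairProj_basis_mul_smul` absorbs. -/
lemma pairInv_pairMap (p : {p : G × G // p.1 * p.2 = r}) (ξ : PairInduced A β S S' p) :
    pairInv i i' p (pairMap i i' p ξ) = ξ := by
  have : Fintype (Subgroup.centralizer {r} ⧸ pairStabilizer p) := Fintype.ofFinite _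
  induction ξ using BaseChange.induction with
  | h0 => rw [map_zero, map_zero]
  | hadd s t hs ht => rw [map_add, map_add, hs, ht]
  | ht b t =>
    induction b using Crossed.induction with
    | h0 => rw [BaseChange.zero_tmul, map_zero, map_zero]
    | hadd b c hb hc => rw [BaseChange.add_tmul, map_add, map_add, hb, hc]
    | hof w a =>
      rw [pairInv_apply, Finset.sum_eq_single (QuotientGroup.mk w) _ (by simp)]
      · generalize hz : (QuotientGroup.mk w : _ ⧸ pairStabilizer p).out = z
        have hzw : (QuotientGroup.mk z : _ ⧸ pairStabilizer p) = QuotientGroup.mk w := by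
          rw [← hz]
          exact Quotient.out_eq _
        rw [QuotientGroup.eq, Subgroup.mem_subgroupOf] at hzw
        have h1 : w = z * Subgroup.inclusion (pairZ_le_mul p.2) ⟨_, hzw⟩ := Subtype.ext (by
          simp)
        have h2 := tmul_pairProj_basis_mul_smul i i' p z ⟨_, hzw⟩ a t
        rw [← h1] at h2
        rw [coe_pairMap_tmul, h2]
      · intro q _ hq
        rw [coe_pairMap_tmul, map_smul, pairProj_basis_smul_ne, smul_zero, BaseChange.tmul_zero]
        intro h
        apply hq
        rw [← mk_eq_mk_of_conj_eq h]
        exact (Quotient.out_eq q).symm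

/-- Pairs from different orbits have no common conjugate under `Z(r)`, so every projection vanishes.
-/
lemma pairInv_pairMap_ne {o o₁ : Quotient (pairSetoid r)} (h : o ≠ o₁)
    (ξ : PairInduced A β S S' o₁.out) :
    (pairInv i i' o.out (pairMap i i' o₁.out ξ) : PairInduced A β S S' o.out) = 0 := by
  have : Fintype (Subgroup.centralizer {r} ⧸ pairStabilizer o.out) := Fintype.ofFinite _
  induction ξ using BaseChange.induction with
  | h0 => rw [map_zero, map_zero]
  | hadd s t hs ht => rw [map_add, map_add, hs, ht, add_zero]
  | ht b t =>
    induction b using Crossed.induction with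
    | h0 => rw [BaseChange.zero_tmul, map_zero, map_zero]
    | hadd b c hb hc => rw [BaseChange.add_tmul, map_add, map_add, hb, hc, add_zero]
    | hof w a =>
      rw [pairInv_apply]
      refine Finset.sum_eq_zero fun q _ => ?_
      rw [coe_pairMap_tmul, map_smul, pairProj_basis_smul_ne, smul_zero, BaseChange.tmul_zero]
      exact fun e => h (quotient_eq_of_conj_eq e)

variable (r) in
/-- The comparison map for one component of a tensor product. -/
def inducedMap [Fintype (Quotient (pairSetoid r))] :
    (∀ o : Quotient (pairSetoid r), PairInduced A β S S' o.out)
      →ₗ[Crossed A (β.thetaZ r)] component A β (ComulTensor A β P Q) r where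
  toFun ξ := ∑ o : Quotient (pairSetoid r), pairMap i i' o.out (ξ o)
  map_add' ξ η := by
    rw [← Finset.sum_add_distrib]
    exact Finset.sum_congr rfl fun o _ => map_add _ _ _
  map_smul' b ξ := by
    rw [RingHom.id_apply, Finset.smul_sum]
    exact Finset.sum_congr rfl fun o _ => map_smul (pairMap i i' o.out) b (ξ o)

lemma inducedMap_apply [Fintype (Quotient (pairSetoid r))]
    (ξ : ∀ o : Quotient (pairSetoid r), PairInduced A β S S' o.out) :
    inducedMap i i' r ξ = ∑ o : Quotient (pairSetoid r), pairMap i i' o.out (ξ o) := rfl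

lemma inducedMap_injective [Fintype (Quotient (pairSetoid r))] :
    Function.Injective (inducedMap i i' r) := by
  rw [injective_iff_map_eq_zero]
  intro ξ hξ
  funext o
  -- The map `pairInv` at `o` recovers the coordinate at `o` and kills the others.
  have h := congrArg (pairInv i i' o.out) hξ
  rwa [inducedMap_apply, map_sum, map_zero, Finset.sum_eq_single o _ (by simp),
    pairInv_pairMap] at h
  intro o₁ _ ho
  exact pairInv_pairMap_ne i i' ho.symm _

lemma tmul_mem_range_pairMap (p : {p : G × G // p.1 * p.2 = r}) (z : Subgroup.centralizer {r})
    {g h : G} (hg : g = z * p.1.1 * (z : G)⁻¹) (hh : h = z * p.1.2 * (z : G)⁻¹)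
    (x : component A β P g) (y : component A β Q h) :
    ∃ ξ : PairInduced A β S S' p,
      (pairMap i i' p ξ : ComulTensor A β P Q) = ComulTensor.tmul A β (x : P) (y : Q) := by
  subst hg hh
  have hx : basisInv A β (z * p.1.1 * (z : G)⁻¹) (z : G) • (x : P) ∈ component A β P p.1.1 :=
    basisInv_smul_mem (by group) _
  have hy : basisInv A β (z * p.1.2 * (z : G)⁻¹) (z : G) • (y : Q) ∈ component A β Q p.1.2 :=
    basisInv_smul_mem (by group) _
  -- Both factors are pulled back to the representative pair along inverse arrows; acting by `z`
  -- restores them and produces the `γ` that the coefficient cancels.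
  refine ⟨BaseChange.tmul _ (Crossed.of z
    (unitScalar A (β.gamma z (z * p.1.1 * (z : G)⁻¹) (z * p.1.2 * (z : G)⁻¹))⁻¹))
    (GammaTensor.tmul A β p.2 ((i _).symm ⟨_, hx⟩) ((i' _).symm ⟨_, hy⟩)), ?_⟩
  rw [coe_pairMap_tmul, basis_smul_pairIncl_tmul, unitScalar_inv_smul_smul,
    LinearEquiv.apply_symm_apply, LinearEquiv.apply_symm_apply, smul_smul, smul_smul,
    basis_mul_basisInv, basis_mul_basisInv, idem_smul_coe, idem_smul_coe]

lemma inducedMap_surjective [Fintype (Quotient (pairSetoid r))] :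
    Function.Surjective (inducedMap i i' r) := by
  classical
  have h1 : ∀ (g h : G) (hr : g * h = r) (x : component A β P g) (y : component A β Q h),
      (⟨ComulTensor.tmul A β (x : P) (y : Q), ComulTensor.tmul_mem_component hr x y⟩ :
        component A β (ComulTensor A β P Q) r) ∈ LinearMap.range (inducedMap i i' r) := by
    intro g h hr x y
    let o : Quotient (pairSetoid r) := Quotient.mk _ ⟨(g, h), hr⟩
    obtain ⟨z, hz, hg, hh⟩ : pairSetoid r o.out ⟨(g, h), hr⟩ := Quotient.exact (Quotient.out_eq o)
    obtain ⟨ξ, hξ⟩ := tmul_mem_range_pairMap i i' o.out ⟨z, hz⟩ hg hh x y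
    refine ⟨Pi.single o ξ, Subtype.ext ?_⟩
    rw [inducedMap_apply, Finset.sum_eq_single o _ (by simp), Pi.single_eq_same, hξ]
    intro o₁ _ ho
    rw [Pi.single_eq_of_ne ho, map_zero]
  -- An element of the component is fixed by `idem r`, so it is enough to treat `idem r • t` for
  -- arbitrary `t`; on a pure tensor, `Δ` expands this into tensors from the components at `a` and
  -- `a⁻¹r`, for all `a`.
  have h2 : ∀ t : ComulTensor A β P Q,
      (⟨idem A β r • t, idem_smul_mem r t⟩ : component A β (ComulTensor A β P Q) r) ∈
        LinearMap.range (inducedMap i i' r) := by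
    intro t
    induction t using ComulTensor.induction with
    | h0 =>
      have h3 : (⟨idem A β r • 0, idem_smul_mem r 0⟩ : component A β (ComulTensor A β P Q) r) =
          0 := Subtype.ext (smul_zero _)
      rw [h3]
      exact zero_mem _
    | hadd s t hs ht =>
      have h3 : (⟨idem A β r • (s + t), idem_smul_mem r _⟩ :
          component A β (ComulTensor A β P Q) r) =
            ⟨idem A β r • s, idem_smul_mem r s⟩ + ⟨idem A β r • t, idem_smul_mem r t⟩ :=
        Subtype.ext (smul_add _ _ _)
      rw [h3]
      exact add_mem hs ht
    | ht x y =>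
      have h3 : ∀ a : G, a * (a⁻¹ * r) = r := fun a => mul_inv_cancel_left a r
      have h4 : (⟨idem A β r • ComulTensor.tmul A β x y, idem_smul_mem r _⟩ :
          component A β (ComulTensor A β P Q) r) = unitScalar A (β.theta r 1 1)⁻¹ •
          ∑ a : G, unitScalar A (β.gamma 1 a (a⁻¹ * r)) •
            ⟨_, ComulTensor.tmul_mem_component (h3 a) ⟨_, basis_smul_mem a 1 x⟩
              ⟨_, basis_smul_mem (a⁻¹ * r) 1 y⟩⟩ := Subtype.ext (by
        rw [Submodule.coe_smul, Submodule.coe_sum]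
        change idem A β r • ComulTensor.tmul A β x y = _
        rw [TensorDouble.idem, smul_assoc, ComulTensor.basis_smul_tmul]
        rfl)
      -- The range is a submodule over the crossed product, so a scalar of `A` acts through its
      -- multiple of the unit.
      have h5 : ∀ (a : A) {t : component A β (ComulTensor A β P Q) r},
          t ∈ LinearMap.range (inducedMap i i' r) →
            a • t ∈ LinearMap.range (inducedMap i i' r) := fun a t ht => by
        rw [← one_smul (Crossed A (β.thetaZ r)) t, ← smul_assoc]
        exact Submodule.smul_mem _ _ ht
      rw [h4]
      exact h5 _ (sum_mem fun a _ => h5 _ (h1 _ _ (h3 a) _ _))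
  intro t
  obtain ⟨ξ, hξ⟩ := h2 t
  exact ⟨ξ, hξ.trans (Subtype.ext (idem_smul_coe t))⟩

end Induced

/-! ### The product of `B^β`-modules -/

section PushPull

variable {A : Type*} [CommRing A] {G : Type*} [Group G] [Fintype G] {k : Type*} [Field k]
  [Algebra k A] {β : Cocycle3 G k} {rep : ConjClasses G → G}
  (hrep : ∀ c, ConjClasses.mk (rep c) = c)
  {P : Type*} [AddCommGroup P] [Module A P] [Module (TensorDouble A β) P]
  [IsScalarTower A (TensorDouble A β) P]
  {Q : Type*} [AddCommGroup Q] [Module A Q] [Module (TensorDouble A β) Q]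
  [IsScalarTower A (TensorDouble A β) Q]
  {V W : Type*} [AddCommGroup V] [Module A V] [Module (TwistedSum A β rep) V]
  [IsScalarTower A (TwistedSum A β rep) V] [AddCommGroup W] [Module A W]
  [Module (TwistedSum A β rep) W] [IsScalarTower A (TwistedSum A β rep) W]
  (e : V ≃ₗ[TwistedSum A β rep] Restriction A β rep P)
  (e' : W ≃ₗ[TwistedSum A β rep] Restriction A β rep Q)

/-- One component of the product of two restrictions. -/
def sectorProductEquiv (c : ConjClasses G) : SectorProduct A β rep hrep V W c
    ≃ₗ[Crossed A (β.thetaZ (rep c))] component A β (ComulTensor A β P Q) (rep c) :=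
  haveI : Fintype (Quotient (pairSetoid (rep c))) := Fintype.ofFinite _
  LinearEquiv.ofBijective
    (inducedMap (sectorEquiv hrep e) (sectorEquiv hrep e') (rep c) :
      SectorProduct A β rep hrep V W c →ₗ[Crossed A (β.thetaZ (rep c))]
        component A β (ComulTensor A β P Q) (rep c))
    ⟨inducedMap_injective _ _, inducedMap_surjective _ _⟩

/-- The product of the restrictions of two modules is the restriction of their tensor product. -/
def pushPullEquiv : PushPull A β rep hrep V W ≃ₗ[TwistedSum A β rep]
    Restriction A β rep (ComulTensor A β P Q) where
  toFun x c := sectorProductEquiv hrep e e' c (x c)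
  invFun y c := (sectorProductEquiv hrep e e' c).symm (y c)
  left_inv _ := funext fun _ => LinearEquiv.symm_apply_apply _ _
  right_inv _ := funext fun _ => LinearEquiv.apply_symm_apply _ _
  map_add' x y := funext fun c => map_add (sectorProductEquiv hrep e e' c) (x c) (y c)
  map_smul' b x := funext fun c => map_smul (sectorProductEquiv hrep e e' c) (b c) (x c)

end PushPull

/-! ### The comparison of the products -/

section Comparison

open CategoryTheory

universe w

variable {A : Type u} [CommRing A] {G : Type v} [Group G] [Fintype G] {k : Type w} [Field k]
  [Algebra k A] {β : Cocycle3 G k} {rep : ConjClasses G → G}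
  (hrep : ∀ c, ConjClasses.mk (rep c) = c)

variable (β) in
/-- The isomorphism on `K₀` induced by the Morita equivalence. -/
def moritaKZero : KZero.{max u v w} (TwistedSum A β rep) ≃+ KZero.{max u v w} (TensorDouble A β) :=
  KZero.congr (moritaEquivalence A β hrep).eqv
    (moritaEquivalence_functor_finite_projective hrep)
    (moritaEquivalence_inverse_finite_projective hrep)

lemma moritaKZero_mk (M : ModuleCat.{max u v w} (TwistedSum A β rep))
    (hM : Module.Finite (TwistedSum A β rep) M ∧ Module.Projective (TwistedSum A β rep) M) :
    moritaKZero β hrep (KZero.mk _ M hM) =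
      KZero.mk _ ((moritaEquivalence A β hrep).eqv.functor.obj M)
        (moritaEquivalence_functor_finite_projective hrep M hM) :=
  KZero.congr_mk _ _ _ _ _

lemma moritaKZero_symm_mk (P : ModuleCat.{max u v w} (TensorDouble A β))
    (hP : Module.Finite (TensorDouble A β) P ∧ Module.Projective (TensorDouble A β) P) :
    (moritaKZero β hrep).symm (KZero.mk _ P hP) =
      KZero.mk _ ((moritaEquivalence A β hrep).eqv.inverse.obj P)
        (moritaEquivalence_inverse_finite_projective hrep P hP) := by
  rw [AddEquiv.symm_apply_eq, moritaKZero_mk]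
  exact KZero.mk_eq_mk
    ((moritaEquivalence A β hrep).eqv.counitIso.app P).symm.toLinearEquiv _ _

variable (β) in
/-- The product on `K₀(B^β)`. -/
def mulTwistedSum (hG : IsUnit (Fintype.card G : A)) :
    KZero.{max u v w} (TwistedSum A β rep) →+ KZero.{max u v w} (TwistedSum A β rep) →+
      KZero.{max u v w} (TwistedSum A β rep) :=
  -- The product is defined by transport, so that compatibility with the isomorphism on `K₀` is
  -- built in; `mulTwistedSum_mk` identifies it with `M * N`.
  AddMonoidHom.mk' (fun x => (moritaKZero β hrep).symm.toAddMonoidHom.comp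
      ((mulDouble β hG (moritaKZero β hrep x)).comp (moritaKZero β hrep).toAddMonoidHom))
    fun x x' => AddMonoidHom.ext fun y => by
      change (moritaKZero β hrep).symm (mulDouble β hG (moritaKZero β hrep (x + x'))
        (moritaKZero β hrep y)) = _
      rw [map_add, map_add, AddMonoidHom.add_apply, map_add]
      rfl

lemma mulTwistedSum_apply (hG : IsUnit (Fintype.card G : A))
    (x y : KZero.{max u v w} (TwistedSum A β rep)) : mulTwistedSum β hrep hG x y =
      (moritaKZero β hrep).symm (mulDouble β hG (moritaKZero β hrep x) (moritaKZero β hrep y)) :=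
  rfl

/-- The product of two `B^β`-modules corresponds to the tensor product over `A ⊗ D^β(k[G])`. -/
def pushPullMoritaEquiv (M N : ModuleCat.{max u v w} (TwistedSum A β rep)) :
    (moritaEquivalence A β hrep).eqv.inverse.obj (ModuleCat.of _
      (ComulTensor A β ((moritaEquivalence A β hrep).eqv.functor.obj M)
        ((moritaEquivalence A β hrep).eqv.functor.obj N)))
      ≃ₗ[TwistedSum A β rep] PushPull A β rep hrep M N :=
  (restrictionFunctorObjEquiv (LinearEquiv.refl _ (ComulTensor A β
    ((moritaEquivalence A β hrep).eqv.functor.obj M)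
    ((moritaEquivalence A β hrep).eqv.functor.obj N)))).trans
  (pushPullEquiv hrep (restrictionMoritaEquiv (A := A) (β := β) hrep M)
    (restrictionMoritaEquiv (A := A) (β := β) hrep N)).symm

/-- By `pushPullMoritaEquiv`, `M * N` is isomorphic to the restriction of the tensor product of the
corresponding modules. The same isomorphism shows that `M * N` is finitely generated and projective,
with no separate study of induced modules. -/
lemma mulTwistedSum_mk (hG : IsUnit (Fintype.card G : A))
    (M N : ModuleCat.{max u v w} (TwistedSum A β rep))
    (hM : Module.Finite (TwistedSum A β rep) M ∧ Module.Projective (TwistedSum A β rep) M)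
    (hN : Module.Finite (TwistedSum A β rep) N ∧ Module.Projective (TwistedSum A β rep) N) :
    ∃ h, mulTwistedSum β hrep hG (KZero.mk _ M hM) (KZero.mk _ N hN) =
      KZero.mk _ (PushPull A β rep hrep M N) h := by
  let T : ModuleCat.{max u v w} (TensorDouble A β) := ModuleCat.of _
    (ComulTensor A β ((moritaEquivalence A β hrep).eqv.functor.obj M)
      ((moritaEquivalence A β hrep).eqv.functor.obj N))
  have h : Module.Finite (TensorDouble A β) T ∧ Module.Projective (TensorDouble A β) T :=
    ComulTensor.finite_projective β _ _ hG
      (moritaEquivalence_functor_finite_projective hrep M hM)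
      (moritaEquivalence_functor_finite_projective hrep N hN)
  refine ⟨finite_projective_of_equiv (pushPullMoritaEquiv hrep M N)
    (moritaEquivalence_inverse_finite_projective hrep T h), ?_⟩
  rw [mulTwistedSum_apply, moritaKZero_mk, moritaKZero_mk, mulDouble_mk]
  exact (moritaKZero_symm_mk hrep T h).trans
    (KZero.mk_eq_mk (pushPullMoritaEquiv hrep M N) _ _)

end Comparison

end DrinfeldTwist

end

theorem mainTheorem11
    {𝕜 : Type} [RCLike 𝕜] {k : Type} [Field k] [Algebra k 𝕜]
    {E H : Type*} [NormedAddCommGroup E] [NormedSpace ℝ E] [TopologicalSpace H]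
    (I : ModelWithCorners ℝ E H) (X : Type u) [TopologicalSpace X] [ChartedSpace H X]
    [IsManifold I ∞ X] {G : Type v} [Group G] [Fintype G] (β : Cocycle3 G k)
    (rep : ConjClasses G → G) (hrep : ∀ c, ConjClasses.mk (rep c) = c) :
    ∃ (e : MoritaEquivalence k (TwistedSum (smoothFunctions 𝕜 I X) β rep)
        (TensorDouble (smoothFunctions 𝕜 I X) β))
      (φ : KZero.{max u v} (TwistedSum (smoothFunctions 𝕜 I X) β rep) ≃+
        KZero.{max u v} (TensorDouble (smoothFunctions 𝕜 I X) β))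
      (mulB : KZero.{max u v} (TwistedSum (smoothFunctions 𝕜 I X) β rep) →+
        KZero.{max u v} (TwistedSum (smoothFunctions 𝕜 I X) β rep) →+
        KZero.{max u v} (TwistedSum (smoothFunctions 𝕜 I X) β rep))
      (mulD : KZero.{max u v} (TensorDouble (smoothFunctions 𝕜 I X) β) →+
        KZero.{max u v} (TensorDouble (smoothFunctions 𝕜 I X) β) →+
        KZero.{max u v} (TensorDouble (smoothFunctions 𝕜 I X) β)),
      (∀ (M : ModuleCat.{max u v} (TwistedSum (smoothFunctions 𝕜 I X) β rep))
        (hM : Module.Finite _ M ∧ Module.Projective _ M),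
        ∃ h, φ (KZero.mk _ M hM) = KZero.mk _ (e.eqv.functor.obj M) h) ∧
      (∀ (M N : ModuleCat.{max u v} (TwistedSum (smoothFunctions 𝕜 I X) β rep))
        (hM : Module.Finite _ M ∧ Module.Projective _ M)
        (hN : Module.Finite _ N ∧ Module.Projective _ N),
        ∃ h, mulB (KZero.mk _ M hM) (KZero.mk _ N hN) =
          KZero.mk _ (PushPull (smoothFunctions 𝕜 I X) β rep hrep M N) h) ∧
      (∀ (P Q : ModuleCat.{max u v} (TensorDouble (smoothFunctions 𝕜 I X) β))
        (hP : Module.Finite _ P ∧ Module.Projective _ P)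
        (hQ : Module.Finite _ Q ∧ Module.Projective _ Q),
        ∃ h, mulD (KZero.mk _ P hP) (KZero.mk _ Q hQ) =
          KZero.mk _ (ComulTensor (smoothFunctions 𝕜 I X) β P Q) h) ∧
      (∀ x y, φ (mulB x y) = mulD (φ x) (φ y)) := by
  -- A field mapping to `ℝ` or `ℂ` has characteristic zero, so `|G|` is invertible in `k` and in
  -- every `k`-algebra. Nothing else about smooth functions is needed.
  have : CharZero k := (algebraMap k 𝕜).charZero
  have h1 : IsUnit (algebraMap k (smoothFunctions 𝕜 I X) (Fintype.card G : k)) :=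
    (IsUnit.mk0 _ (Nat.cast_ne_zero.2 Fintype.card_ne_zero)).map _
  have hG : IsUnit (Fintype.card G : smoothFunctions 𝕜 I X) := by rwa [map_natCast] at h1
  exact ⟨moritaEquivalence _ β hrep, moritaKZero β hrep, mulTwistedSum β hrep hG, mulDouble β hG,
    fun M hM => ⟨_, moritaKZero_mk hrep M hM⟩,
    fun M N hM hN => mulTwistedSum_mk hrep hG M N hM hN,
    fun P Q hP hQ => ⟨_, mulDouble_mk hG P Q hP hQ⟩,
    fun x y => by rw [mulTwistedSum_apply, AddEquiv.apply_symm_apply]⟩
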